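/- **Setting.** Let $(W,S)$ be a Coxeter system with length function $\ell$, let $\bar S$ be the set of classes of elements of $S$ under conjugacy in $W$, and let $\mathbb Z[\bar S]$ be the free abelian group on $\bar S$ (for $s\in S$ we also write $s$ for its class). *Hecke algebra and cells.* Let $\Gamma$ be a totally ordered abelian group and $\varphi:\bar S\to\Gamma$ a map. Let $\mathcal H=\mathcal H(W,S,\varphi)$ be the $\mathbb Z[\Gamma]$-algebra, free with basis $(T_w)_{w\in W}$, such that $T_wT_{w'}=T_{ww'}$ if $\ell(ww')=\ell(w)+\ell(w')$ and $(T_s-e^{\varphi(s)})(T_s+e^{-\varphi(s)})=0$ for $s\in S$. Let $h\mapsto\bar h$ be its ring involution with $\overline{e^\gamma}=e^{-\gamma}$, $\overline{T_w}=T_{w^{-1}}^{-1}$, and let $C_w$ be the unique element with $\overline{C_w}=C_w$ and $C_w-T_w\in\bigoplus_{y}\mathbb Z[\Gamma_{<0}]T_y$; then $(C_w)_{w\in W}$ is a $\mathbb Z[\Gamma]$-basis of $\mathcal H$. For $?\in\{L,R,LR\}$ let $\leqslant_?^\varphi$ be the transitive closure of the relation "there is $h\in\mathcal H$ such that $C_x$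 occurs with non-zero coefficient in $hC_y$ (if $?=L$), in $C_yh$ (if $?=R$), in $hC_y$ or in $C_yh$ (if $?=LR$)" between $x$ and $y$. Let $\sim_?^\varphi$ be the associated equivalence relation; its classes are the $?$-cells. For a $?$-cell $C$ put $M_C^{?,\varphi}=\bigl(\bigoplus_{w\leqslant_?^\varphi C}\mathbb Z[\Gamma]C_w\bigr)/\bigl(\bigoplus_{w<_?^\varphi C}\mathbb Z[\Gamma]C_w\bigr)$ and $\mathbb ZM_C^{?,\varphi}=\mathbb Z\otimes_{\mathbb Z[\Gamma]}M_C^{?,\varphi}$ (via $e^\gamma\mapsto 1$), on which $w\in W$ acts through $T_w$: this is a left $\mathbb ZW$-module, a right $\mathbb ZW$-module or a $(\mathbb ZW,\mathbb ZW)$-bimodule (a "$\mathbb ZW$-$?$-module") according as $?=L,R,LR$. *Positive subsets.* Let $\Lambda=\mathbb Z[\bar S]$. A subset $X\subseteq\Lambda$ is positive if $\Lambda=X\cup(-X)$, $X+X\subseteq X$ and $X\cap(-X)$ is a subgroup. Let $\mathcal Pos$ be the set of positive subsets of $\Lambda$, with the topology in which $U$ is open if for every $X\in U$ there is a finite $E\subseteq\Lambda$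 with $X\in\mathcal U(E)\subseteq U$, where $\mathcal U(E)=\{Y: Y\cap E=\varnothing\}$. For $X\in\mathcal Pos$, the group $\Gamma_X=\Lambda/(X\cap -X)$ is totally ordered by $\gamma\leqslant\gamma'$ iff $\gamma'-\gamma$ has a representative in $X$; let $\varphi_X:\bar S\to\Gamma_X$ be the canonical map, and replace the superscript $\varphi_X$ by $X$. For $\lambda\in\Lambda\setminus\{0\}$ the rational hyperplane $\mathcal H_\lambda$ is $\{X\in\mathcal Pos:\lambda\in X\cap(-X)\}$; $\mathcal Pos$ is the disjoint union of $\mathcal U(\lambda)$, $\mathcal H_\lambda$ and $\mathcal U(-\lambda)$. For a set $\mathfrak A$ of rational hyperplanes, the $\mathfrak A$-facets are the classes of the equivalence relation "for every $\mathcal H_\lambda\in\mathfrak A$, $X$ and $Y$ lie in the same one of $\mathcal U(\lambda),\mathcal H_\lambda,\mathcal U(-\lambda)$", and the $\mathfrak A$-chambers are the facets that meet no element of $\mathfrak A$. The set $\mathfrak A$ is complete if $\mathcal H_\omega\in\mathfrak A$ for all $\omega\in\bar S$. For a facet $\mathcal F$, let $W_{\mathcal F}$ be the subgroup generated by the $s\in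 S$ with $\mathcal F\subseteq\mathcal H_s$. *Conjecture A for $(W,S)$.* There is a finite complete set $\mathfrak A$ of rational hyperplanes such that, for all $?\in\{L,R,LR\}$: (a) if $X,Y$ belong to the same $\mathfrak A$-facet $\mathcal F$, then $\sim_?^X$ and $\sim_?^Y$ coincide (write $\sim_?^{\mathcal F}$); (b) for every $\mathfrak A$-facet $\mathcal F$, the cells for $\sim_?^{\mathcal F}$ are the minimal non-empty subsets $C$ of $W$ such that (b1) for every chamber $\mathcal C$ with $\mathcal F\subseteq\overline{\mathcal C}$, $C$ is a union of cells for $\sim_?^{\mathcal C}$, and (b2) $C$ is stable by translation by $W_{\mathcal F}$ on the left if $?=L$, on the right if $?=R$, on both sides if $?=LR$. If there is a smallest (for inclusion) such $\mathfrak A$, its elements are called the essential hyperplanes of $(W,S)$. *Conjecture B for $(W,S)$.* Let $\mathfrak A$ be the set of essential hyperplanes, $?\in\{L,R,LR\}$, $X\in\mathcal Pos$, $C$ a cell for $\sim_?^X$, $\mathcal C$ an $\mathfrak A$-chamber with $X\in\overline{\mathcal C}$, and $Y\in\mathcal C$. Then $C$ is the disjoint union of the cells $(C_i)_{i\in I}$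 for $\sim_?^Y$ contained in $C$, and there are a natural number $d$ and a partition $I=I_1\,\dot\cup\cdots\dot\cup\,I_d$ such that (a) if $i\in I_k$, $j\in I_l$ and $C_i\leqslant_?^Y C_j$, then $k\leqslant l$; (b) there is a filtration $0=M_0\subseteq M_1\subseteq\cdots\subseteq M_d=\mathbb ZM_C^{?,X}$ by $\mathbb ZW$-$?$-submodules with $M_k/M_{k-1}\simeq\bigoplus_{i\in I_k}\mathbb ZM_{C_i}^{?,Y}$ for $1\leqslant k\leqslant d$. **Proposition.** If $S=\{s,t\}$ and $st$ has infinite order, then Conjectures A and B hold for $(W,S)$. The essential hyperplanes of $(W,S)$ are $\mathcal H_s$, $\mathcal H_t$, $\mathcal H_{s-t}$ and $\mathcal H_{s+t}$. -/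

import Mathlib

open scoped TensorProduct DirectSum Pointwise

noncomputable section

namespace KLCells

universe u v w

/-! ## Positive subsets of an abelian group -/

/-- A positive subset `X` of `Λ`: `Λ = X ∪ -X`, `X + X ⊆ X` and `X ∩ -X` is a subgroup of `Λ`. -/
structure Pos (Λ : Type u) [AddCommGroup Λ] where
  carrier : Set Λ
  union_neg : carrier ∪ -carrier = Set.univ
  add_subset : carrier + carrier ⊆ carrier
  inter_neg : ∃ K : AddSubgroup Λ, (K : Set Λ) = carrier ∩ -carrier

namespace Pos

variable {Λ : Type u} [AddCommGroup Λ]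

instance : Membership Λ (Pos Λ) := ⟨fun X a => a ∈ X.carrier⟩

theorem mem_or_neg_mem (X : Pos Λ) (a : Λ) : a ∈ X ∨ -a ∈ X := by
  have h : a ∈ X.carrier ∪ -X.carrier := by rw [X.union_neg]; trivial
  exact h

theorem add_mem (X : Pos Λ) {a b : Λ} (ha : a ∈ X) (hb : b ∈ X) : a + b ∈ X :=
  X.add_subset (Set.add_mem_add ha hb)

theorem zero_mem (X : Pos Λ) : (0 : Λ) ∈ X := by
  rcases X.mem_or_neg_mem 0 with h | h
  · exact h
  · simpa using h

/-- The subgroup `X ∩ -X`. -/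
def ker (X : Pos Λ) : AddSubgroup Λ where
  carrier := X.carrier ∩ -X.carrier
  zero_mem' := ⟨X.zero_mem, show -(0 : Λ) ∈ X by simpa using X.zero_mem⟩
  add_mem' := by
    rintro a b ⟨ha, ha'⟩ ⟨hb, hb'⟩
    refine ⟨X.add_mem ha hb, ?_⟩
    have h : -b + -a ∈ X := X.add_mem hb' ha'
    rw [← neg_add_rev] at h
    exact h
  neg_mem' := by
    rintro a ⟨ha, ha'⟩
    exact ⟨ha', by simpa using ha⟩

/-- The quotient group `Γ_X = Λ / (X ∩ -X)`. -/
def Quo (X : Pos Λ) : Type u := Λ ⧸ X.ker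

instance (X : Pos Λ) : AddCommGroup X.Quo := inferInstanceAs (AddCommGroup (Λ ⧸ X.ker))

/-- The canonical morphism `Λ → Γ_X`. -/
def can (X : Pos Λ) : Λ →+ X.Quo := QuotientAddGroup.mk' X.ker

theorem can_surjective (X : Pos Λ) : Function.Surjective X.can :=
  QuotientAddGroup.mk'_surjective X.ker

theorem mem_of_can_eq (X : Pos Λ) {a b : Λ} (h : X.can a = X.can b) (ha : a ∈ X) : b ∈ X := by
  have h1 : -a + b ∈ X.ker := QuotientAddGroup.eq.1 h
  have h2 : a + (-a + b) ∈ X := X.add_mem ha h1.1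
  simpa using h2

theorem can_eq_zero (X : Pos Λ) {a : Λ} (h : a ∈ X) (h' : -a ∈ X) : X.can a = 0 :=
  (QuotientAddGroup.eq_zero_iff a).2 ⟨h, h'⟩

open Classical in
/-- The total order on `Γ_X`: `γ ≤ γ'` if `γ' - γ` has a representative in `X`. -/
instance (X : Pos Λ) : LinearOrder X.Quo where
  le g g' := ∃ a ∈ X, X.can a = g' - g
  le_refl g := ⟨0, X.zero_mem, by simp⟩
  le_trans := by
    rintro g g' g'' ⟨a, ha, hag⟩ ⟨b, hb, hbg⟩
    exact ⟨a + b, X.add_mem ha hb, by rw [map_add, hag, hbg]; abel⟩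
  le_antisymm := by
    rintro g g' ⟨a, ha, hag⟩ ⟨b, hb, hbg⟩
    have h : X.can b = X.can (-a) := by rw [map_neg, hag, hbg]; abel
    have h0 : X.can a = 0 := X.can_eq_zero ha (X.mem_of_can_eq h hb)
    rw [h0] at hag
    exact (sub_eq_zero.1 hag.symm).symm
  le_total := by
    intro g g'
    obtain ⟨a, ha⟩ := X.can_surjective (g' - g)
    rcases X.mem_or_neg_mem a with h | h
    · exact Or.inl ⟨a, h, ha⟩
    · exact Or.inr ⟨-a, h, by rw [map_neg, ha]; abel⟩
  toDecidableLE := Classical.decRel _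

instance (X : Pos Λ) : IsOrderedAddMonoid X.Quo where
  add_le_add_left := by
    rintro g g' ⟨a, ha, hag⟩ c
    exact ⟨a, ha, by rw [hag]; abel⟩

/-! ### Topology, rational hyperplanes, facets -/

/-- `U(E)`: the positive subsets that do not meet `E`. -/
def avoid (E : Set Λ) : Set (Pos Λ) := {X | ∀ a ∈ E, a ∉ X}

instance : TopologicalSpace (Pos Λ) where
  IsOpen U := ∀ X ∈ U, ∃ E : Set Λ, E.Finite ∧ X ∈ avoid E ∧ avoid E ⊆ U
  isOpen_univ := fun _ _ => ⟨∅, Set.finite_empty, fun _ h => absurd h (Set.notMem_empty _),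
    Set.subset_univ _⟩
  isOpen_inter := by
    rintro U V hU hV X ⟨hXU, hXV⟩
    obtain ⟨E, hE, hXE, hEU⟩ := hU X hXU
    obtain ⟨F, hF, hXF, hFV⟩ := hV X hXV
    refine ⟨E ∪ F, hE.union hF, ?_, fun Y hY => ⟨hEU ?_, hFV ?_⟩⟩
    · rintro a (ha | ha)
      · exact hXE a ha
      · exact hXF a ha
    · exact fun a ha => hY a (Or.inl ha)
    · exact fun a ha => hY a (Or.inr ha)
  isOpen_sUnion := by
    rintro S hS X ⟨U, hU, hXU⟩
    obtain ⟨E, hE, hXE, hEU⟩ := hS U hU X hXU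
    exact ⟨E, hE, hXE, fun Y hY => ⟨U, hU, hEU hY⟩⟩

/-- The subset `H_a = {X | a ∈ X ∩ -X}` (a rational hyperplane when `a ≠ 0`). -/
def hyp (a : Λ) : Set (Pos Λ) := {X | a ∈ X ∧ -a ∈ X}

def IsRationalHyperplane (H : Set (Pos Λ)) : Prop := ∃ a : Λ, a ≠ 0 ∧ H = hyp a

/-- For a rational hyperplane `H = H_a`: `X` and `Y` lie in the same one of the three sets
`U(a)`, `H`, `U(-a)`, which do not depend, up to the order, on the choice of `a`. -/
def SameSide (H : Set (Pos Λ)) (X Y : Pos Λ) : Prop :=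
  ∀ a : Λ, a ≠ 0 → H = hyp a →
    (X ∈ avoid {a} ∧ Y ∈ avoid {a}) ∨ (X ∈ H ∧ Y ∈ H) ∨ (X ∈ avoid {-a} ∧ Y ∈ avoid {-a})

/-- Facets of a set `𝔄` of rational hyperplanes. -/
def IsFacet (𝔄 : Set (Set (Pos Λ))) (F : Set (Pos Λ)) : Prop :=
  ∃ X : Pos Λ, F = {Y | ∀ H ∈ 𝔄, SameSide H X Y}

/-- Chambers: facets that meet no hyperplane of `𝔄`. -/
def IsChamber (𝔄 : Set (Set (Pos Λ))) (F : Set (Pos Λ)) : Prop :=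
  IsFacet 𝔄 F ∧ ∀ H ∈ 𝔄, Disjoint F H

end Pos

/-! ## Hecke algebras with unequal parameters -/

section Hecke

variable {B : Type u} {W : Type v} [Group W] {M : CoxeterMatrix B} (cs : CoxeterSystem M W)

/-- Two indices of simple reflections are equivalent if the reflections are conjugate in `W`. -/
def conjSetoid : Setoid B where
  r i j := IsConj (cs.simple i) (cs.simple j)
  iseqv := ⟨fun _ => IsConj.refl _, fun h => h.symm, fun h h' => h.trans h'⟩

/-- The set of conjugacy classes of simple reflections. -/
abbrev SBar : Type u := Quotient (conjSetoid cs)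

/-- The free abelian group `ℤ[S̄]`. -/
abbrev ZSBar : Type u := SBar cs →₀ ℤ

/-- The class of a simple reflection, as a basis element of `ℤ[S̄]`. -/
def cls (i : B) : ZSBar cs := Finsupp.single (Quotient.mk (conjSetoid cs) i) 1

variable {Γ : Type w} [AddCommGroup Γ]

/-- `e^γ` in the group algebra `ℤ[Γ]`. -/
def ex (γ : Γ) : AddMonoidAlgebra ℤ Γ := AddMonoidAlgebra.single γ 1

variable (φ : SBar cs → Γ)

/-- The parameter of a simple reflection. -/
def par (i : B) : Γ := φ (Quotient.mk (conjSetoid cs) i)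

/-- The relations of the Hecke algebra. -/
inductive HeckeRel : FreeAlgebra (AddMonoidAlgebra ℤ Γ) W →
    FreeAlgebra (AddMonoidAlgebra ℤ Γ) W → Prop
  | one : HeckeRel (FreeAlgebra.ι _ 1) 1
  | mul (w w' : W) (h : cs.length (w * w') = cs.length w + cs.length w') :
      HeckeRel (FreeAlgebra.ι _ w * FreeAlgebra.ι _ w') (FreeAlgebra.ι _ (w * w'))
  | quad (i : B) :
      HeckeRel ((FreeAlgebra.ι _ (cs.simple i) - algebraMap _ _ (ex (par cs φ i))) *
        (FreeAlgebra.ι _ (cs.simple i) + algebraMap _ _ (ex (-par cs φ i)))) 0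

/-- The Hecke algebra with parameter `φ`: the `ℤ[Γ]`-algebra generated by the `T_w`, `w ∈ W`,
with `T_w T_w' = T_{ww'}` if `ℓ(ww') = ℓ(w) + ℓ(w')`, `T_1 = 1`, and
`(T_s - e^{φ(s)}) (T_s + e^{-φ(s)}) = 0`. It is free over `ℤ[Γ]` with basis `(T_w)`. -/
def Hecke : Type (max v w) := RingQuot (HeckeRel cs φ)

instance : Ring (Hecke cs φ) := inferInstanceAs (Ring (RingQuot (HeckeRel cs φ)))

instance : Algebra (AddMonoidAlgebra ℤ Γ) (Hecke cs φ) :=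
  inferInstanceAs (Algebra (AddMonoidAlgebra ℤ Γ) (RingQuot (HeckeRel cs φ)))

/-- The standard basis element `T_w`. -/
def T (w : W) : Hecke cs φ :=
  RingQuot.mkAlgHom (AddMonoidAlgebra ℤ Γ) (HeckeRel cs φ) (FreeAlgebra.ι _ w)

theorem T_one : T cs φ 1 = 1 := by
  have h := RingQuot.mkAlgHom_rel (AddMonoidAlgebra ℤ Γ) (HeckeRel.one (cs := cs) (φ := φ))
  rw [map_one] at h
  exact h

theorem T_mul (w w' : W) (h : cs.length (w * w') = cs.length w + cs.length w') :
    T cs φ w * T cs φ w' = T cs φ (w * w') := by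
  have h := RingQuot.mkAlgHom_rel (AddMonoidAlgebra ℤ Γ) (HeckeRel.mul (φ := φ) w w' h)
  rw [map_mul] at h
  exact h

theorem T_quad (i : B) :
    (T cs φ (cs.simple i) - algebraMap _ _ (ex (par cs φ i))) *
      (T cs φ (cs.simple i) + algebraMap _ _ (ex (-par cs φ i))) = 0 := by
  have h := RingQuot.mkAlgHom_rel (AddMonoidAlgebra ℤ Γ) (HeckeRel.quad (cs := cs) (φ := φ) i)
  rw [map_mul, map_sub, map_add, AlgHom.commutes, AlgHom.commutes, map_zero] at h
  exact h

theorem ex_mul_ex_neg (γ : Γ) : ex γ * ex (-γ) = (1 : AddMonoidAlgebra ℤ Γ) := by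
  simp [ex, AddMonoidAlgebra.single_mul_single, AddMonoidAlgebra.one_def]

theorem T_simple_sq (i : B) :
    T cs φ (cs.simple i) * T cs φ (cs.simple i) =
      1 + (ex (par cs φ i) - ex (-par cs φ i)) • T cs φ (cs.simple i) := by
  have h := T_quad cs φ i
  rw [sub_mul, mul_add, mul_add, ← map_mul, ex_mul_ex_neg, map_one, ← Algebra.commutes,
    ← Algebra.smul_def, ← Algebra.smul_def] at h
  rw [sub_smul]
  rw [← sub_eq_zero, ← h]
  abel

theorem isUnit_T_simple (i : B) : IsUnit (T cs φ (cs.simple i)) := by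
  have h := T_simple_sq cs φ i
  refine ⟨⟨T cs φ (cs.simple i),
    T cs φ (cs.simple i) - algebraMap _ _ (ex (par cs φ i) - ex (-par cs φ i)), ?_, ?_⟩, rfl⟩
  · rw [mul_sub, h, Algebra.smul_def, Algebra.commutes]
    abel
  · rw [sub_mul, h, Algebra.smul_def]
    abel

theorem isUnit_T (w : W) : IsUnit (T cs φ w) := by
  induction hn : cs.length w generalizing w with
  | zero =>
    rw [cs.length_eq_zero_iff.1 hn, T_one]
    exact isUnit_one
  | succ n ih =>
    have hw : w ≠ 1 := by
      rintro rfl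
      simp at hn
    obtain ⟨i, hi⟩ := cs.exists_leftDescent_of_ne_one hw
    have hl := cs.isLeftDescent_iff.1 hi
    have h1 : T cs φ (cs.simple i) * T cs φ (cs.simple i * w) = T cs φ w := by
      rw [T_mul, cs.simple_mul_simple_cancel_left]
      rw [cs.simple_mul_simple_cancel_left, cs.length_simple]
      omega
    rw [← h1]
    exact (isUnit_T_simple cs φ i).mul (ih _ (by omega))

/-! ### The bar involution -/

/-- The ring automorphism `e^γ ↦ e^{-γ}` of `ℤ[Γ]`. -/
def barZ : AddMonoidAlgebra ℤ Γ →+* AddMonoidAlgebra ℤ Γ :=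
  AddMonoidAlgebra.mapDomainRingHom ℤ (-AddMonoidHom.id Γ)

/-- The Hecke algebra with the scalar action of `ℤ[Γ]` twisted by `e^γ ↦ e^{-γ}`. -/
def HeckeBar : Type (max v w) := Hecke cs φ

instance : Ring (HeckeBar cs φ) := inferInstanceAs (Ring (Hecke cs φ))

instance : Algebra (AddMonoidAlgebra ℤ Γ) (HeckeBar cs φ) :=
  RingHom.toAlgebra' (S := Hecke cs φ)
    ((algebraMap (AddMonoidAlgebra ℤ Γ) (Hecke cs φ)).comp barZ)
    (fun c x => Algebra.commutes (barZ c) x)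

/-- The element `T_{w⁻¹}⁻¹`. -/
def Tinv (w : W) : Hecke cs φ := Ring.inverse (T cs φ w⁻¹)

theorem T_mul_Tinv (w : W) : T cs φ w⁻¹ * Tinv cs φ w = 1 :=
  Ring.mul_inverse_cancel _ (isUnit_T cs φ w⁻¹)

theorem Tinv_mul_T (w : W) : Tinv cs φ w * T cs φ w⁻¹ = 1 :=
  Ring.inverse_mul_cancel _ (isUnit_T cs φ w⁻¹)

theorem Tinv_eq {w : W} {x : Hecke cs φ} (h : x * T cs φ w⁻¹ = 1) : Tinv cs φ w = x :=
  (left_inv_eq_right_inv h (T_mul_Tinv cs φ w)).symm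

theorem Tinv_simple (i : B) : Tinv cs φ (cs.simple i) =
    T cs φ (cs.simple i) - algebraMap _ _ (ex (par cs φ i) - ex (-par cs φ i)) := by
  refine Tinv_eq cs φ ?_
  rw [cs.inv_simple, sub_mul, T_simple_sq, Algebra.smul_def]
  abel

theorem Tinv_mul (w w' : W) (h : cs.length (w * w') = cs.length w + cs.length w') :
    Tinv cs φ w * Tinv cs φ w' = Tinv cs φ (w * w') := by
  refine (Tinv_eq cs φ ?_).symm
  have h1 : T cs φ (w * w')⁻¹ = T cs φ w'⁻¹ * T cs φ w⁻¹ := by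
    rw [T_mul, mul_inv_rev]
    rw [← mul_inv_rev, cs.length_inv, cs.length_inv, cs.length_inv, h, add_comm]
  rw [h1, mul_assoc, ← mul_assoc (Tinv cs φ w'), Tinv_mul_T, one_mul, Tinv_mul_T]

theorem barZ_ex (γ : Γ) : barZ (ex γ) = ex (-γ) := by
  simp [barZ, ex]

theorem Tinv_quad (i : B) :
    (Tinv cs φ (cs.simple i) - algebraMap _ _ (ex (-par cs φ i))) *
      (Tinv cs φ (cs.simple i) + algebraMap _ _ (ex (par cs φ i))) = 0 := by
  refine Eq.trans ?_ (T_quad cs φ i)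
  rw [Tinv_simple, map_sub]
  congr 1 <;> abel

/-- The element `T_{w⁻¹}⁻¹` in the algebra with twisted scalars. -/
def TinvBar (w : W) : HeckeBar cs φ := Tinv cs φ w

theorem algebraMap_heckeBar (γ : Γ) :
    algebraMap (AddMonoidAlgebra ℤ Γ) (HeckeBar cs φ) (ex γ) =
      algebraMap (AddMonoidAlgebra ℤ Γ) (Hecke cs φ) (ex (-γ)) := by
  rw [← barZ_ex]
  rfl

theorem TinvBar_rel {x y : FreeAlgebra (AddMonoidAlgebra ℤ Γ) W} (h : HeckeRel cs φ x y) :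
    FreeAlgebra.lift (AddMonoidAlgebra ℤ Γ) (TinvBar cs φ) x =
      FreeAlgebra.lift (AddMonoidAlgebra ℤ Γ) (TinvBar cs φ) y := by
  cases h with
  | one =>
    rw [FreeAlgebra.lift_ι_apply, map_one]
    exact Tinv_eq cs φ (x := 1) (by rw [inv_one, T_one, one_mul])
  | mul w w' h =>
    rw [map_mul, FreeAlgebra.lift_ι_apply, FreeAlgebra.lift_ι_apply, FreeAlgebra.lift_ι_apply]
    exact Tinv_mul cs φ w w' h
  | quad i =>
    rw [map_mul, map_sub, map_add, FreeAlgebra.lift_ι_apply, AlgHom.commutes, AlgHom.commutes,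
      map_zero, algebraMap_heckeBar, algebraMap_heckeBar, neg_neg]
    exact Tinv_quad cs φ i

/-- The bar involution, as a morphism of algebras to the algebra with twisted scalars. -/
def barAlg : RingQuot (HeckeRel cs φ) →ₐ[AddMonoidAlgebra ℤ Γ] HeckeBar cs φ :=
  RingQuot.liftAlgHom (AddMonoidAlgebra ℤ Γ)
    ⟨FreeAlgebra.lift (AddMonoidAlgebra ℤ Γ) (TinvBar cs φ), fun _ _ h => TinvBar_rel cs φ h⟩

/-- The bar involution of the Hecke algebra: the ring endomorphism
with `e^γ ↦ e^{-γ}` and `T_w ↦ T_{w⁻¹}⁻¹`. -/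
def bar : Hecke cs φ →+* Hecke cs φ := (barAlg cs φ).toRingHom

theorem bar_T (w : W) : bar cs φ (T cs φ w) = Tinv cs φ w := by
  have h : barAlg cs φ (RingQuot.mkAlgHom (AddMonoidAlgebra ℤ Γ) (HeckeRel cs φ)
      (FreeAlgebra.ι _ w)) = TinvBar cs φ w := by
    rw [barAlg, RingQuot.liftAlgHom_mkAlgHom_apply, FreeAlgebra.lift_ι_apply]
  exact h

theorem bar_algebraMap (c : AddMonoidAlgebra ℤ Γ) :
    bar cs φ (algebraMap _ _ c) = algebraMap _ _ (barZ c) :=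
  AlgHom.commutes (barAlg cs φ) c

/-! ### Left, right and two-sided ideals and the action of `W` on specialised quotients -/

/-- Left, right, two-sided. -/
inductive Side : Type
  | L
  | R
  | LR

/-- Left multiplications are allowed. -/
def Side.left : Side → Prop
  | .L => True
  | .R => False
  | .LR => True

/-- Right multiplications are allowed. -/
def Side.right : Side → Prop
  | .L => False
  | .R => True
  | .LR => True

/-- Left, right or two-sided ideals of the Hecke algebra. -/
def IsIdealOf (σ : Side) (I : Submodule (AddMonoidAlgebra ℤ Γ) (Hecke cs φ)) : Prop :=
  (σ.left → ∀ h x : Hecke cs φ, x ∈ I → h * x ∈ I) ∧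
    (σ.right → ∀ h x : Hecke cs φ, x ∈ I → x * h ∈ I)

/-- The left, right or two-sided ideal generated by a set. -/
def idealSpan (σ : Side) (E : Set (Hecke cs φ)) :
    Submodule (AddMonoidAlgebra ℤ Γ) (Hecke cs φ) :=
  sInf {I | IsIdealOf cs φ σ I ∧ E ⊆ I}

theorem isIdealOf_idealSpan (σ : Side) (E : Set (Hecke cs φ)) :
    IsIdealOf cs φ σ (idealSpan cs φ σ E) := by
  refine ⟨fun hσ h x hx => ?_, fun hσ h x hx => ?_⟩
  · rw [idealSpan, Submodule.mem_sInf] at hx ⊢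
    exact fun I hI => hI.1.1 hσ h x (hx I hI)
  · rw [idealSpan, Submodule.mem_sInf] at hx ⊢
    exact fun I hI => hI.1.2 hσ h x (hx I hI)

/-- The ring `ℤ`, viewed as a `ℤ[Γ]`-module through the augmentation `e^γ ↦ 1`. -/
def AugInt (_ : Type w) : Type := ℤ

instance : AddCommGroup (AugInt Γ) := inferInstanceAs (AddCommGroup ℤ)

/-- The augmentation `ℤ[Γ] → ℤ`. -/
def aug : AddMonoidAlgebra ℤ Γ →+* ℤ := (AddMonoidAlgebra.lift ℤ ℤ Γ 1).toRingHom

theorem aug_ex (γ : Γ) : aug (ex γ) = 1 := by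
  simp [aug, ex]

instance : Module (AddMonoidAlgebra ℤ Γ) (AugInt Γ) := Module.compHom ℤ (aug (Γ := Γ))

theorem ex_smul_augInt (γ : Γ) (z : AugInt Γ) : ex γ • z = z := by
  have h : (aug (ex γ) : ℤ) * (show ℤ from z) = z := by rw [aug_ex, one_mul]
  exact h

section Quotient

variable (I J : Submodule (AddMonoidAlgebra ℤ Γ) (Hecke cs φ))

/-- The specialisation `ℤ ⊗_{ℤ[Γ]} (I / J)`. -/
abbrev Spec : Type (max v w) := AugInt Γ ⊗[AddMonoidAlgebra ℤ Γ] (↥I ⧸ J.submoduleOf I)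

/-- An operator of the Hecke algebra that preserves `I` and `J`, acting on `I / J`. -/
def opQuot (f : Module.End (AddMonoidAlgebra ℤ Γ) (Hecke cs φ)) (hI : ∀ x ∈ I, f x ∈ I)
    (hJ : ∀ x ∈ J, f x ∈ J) : Module.End (AddMonoidAlgebra ℤ Γ) (↥I ⧸ J.submoduleOf I) :=
  Submodule.mapQ _ _ (f.restrict hI) (fun x hx => hJ x.1 hx)

/-- An operator of the Hecke algebra that preserves `I` and `J`, acting on `ℤ ⊗ (I / J)`. -/
def opSpec (f : Module.End (AddMonoidAlgebra ℤ Γ) (Hecke cs φ)) (hI : ∀ x ∈ I, f x ∈ I)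
    (hJ : ∀ x ∈ J, f x ∈ J) : Module.End (AddMonoidAlgebra ℤ Γ) (Spec cs φ I J) :=
  (opQuot cs φ I J f hI hJ).lTensor (AugInt Γ)

variable {I J}

theorem mulLeft_mem (hI : ∀ h x : Hecke cs φ, x ∈ I → h * x ∈ I) (h : Hecke cs φ) :
    ∀ x ∈ I, LinearMap.mulLeft (AddMonoidAlgebra ℤ Γ) h x ∈ I := hI h

theorem mulRight_mem (hI : ∀ h x : Hecke cs φ, x ∈ I → x * h ∈ I) (h : Hecke cs φ) :
    ∀ x ∈ I, LinearMap.mulRight (AddMonoidAlgebra ℤ Γ) h x ∈ I := hI h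

theorem opSpec_tmul (f : Module.End (AddMonoidAlgebra ℤ Γ) (Hecke cs φ)) (hI : ∀ x ∈ I, f x ∈ I)
    (hJ : ∀ x ∈ J, f x ∈ J) (z : AugInt Γ) (x : I) :
    opSpec cs φ I J f hI hJ (z ⊗ₜ Submodule.Quotient.mk x) =
      z ⊗ₜ Submodule.Quotient.mk ⟨f x.1, hI x.1 x.2⟩ := rfl

theorem end_spec_ext {f g : Module.End (AddMonoidAlgebra ℤ Γ) (Spec cs φ I J)}
    (h : ∀ (z : AugInt Γ) (x : I), f (z ⊗ₜ Submodule.Quotient.mk x) =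
      g (z ⊗ₜ Submodule.Quotient.mk x)) : f = g := by
  refine TensorProduct.ext' fun z y => ?_
  obtain ⟨x, rfl⟩ := Submodule.Quotient.mk_surjective _ y
  exact h z x

theorem ex_sub_ex_smul_spec (γ δ : Γ) (y : Spec cs φ I J) : (ex γ - ex δ) • y = 0 := by
  induction y using TensorProduct.induction_on with
  | zero => rw [smul_zero]
  | tmul z m =>
    rw [TensorProduct.smul_tmul', sub_smul, ex_smul_augInt, ex_smul_augInt, sub_self,
      TensorProduct.zero_tmul]
  | add a b ha hb => rw [smul_add, ha, hb, add_zero]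

/-- A map `g` with `g(1) = 1`, `g(ww') = g(w) g(w')` if `ℓ(ww') = ℓ(w) + ℓ(w')`, and `g(s)² = 1`,
is a morphism of monoids. -/
def homOfLength {E : Type*} [Monoid E] (g : W → E) (h1 : g 1 = 1)
    (hmul : ∀ w w', cs.length (w * w') = cs.length w + cs.length w' → g (w * w') = g w * g w')
    (hsq : ∀ i, g (cs.simple i) * g (cs.simple i) = 1) : W →* E where
  toFun := g
  map_one' := h1
  map_mul' := by
    have key : ∀ i w, g (cs.simple i * w) = g (cs.simple i) * g w := by
      intro i w
      rcases cs.length_simple_mul w i with h | h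
      · exact hmul _ _ (by rw [h, cs.length_simple, add_comm])
      · have h2 := hmul (cs.simple i) (cs.simple i * w) (by
          rw [cs.simple_mul_simple_cancel_left, cs.length_simple]; omega)
        rw [cs.simple_mul_simple_cancel_left] at h2
        rw [h2, ← mul_assoc, hsq, one_mul]
    intro w w'
    induction w using cs.simple_induction_left with
    | one => rw [one_mul, h1, one_mul]
    | mul_simple_left w i ih => rw [mul_assoc, key, ih, key, mul_assoc]

/-- Left action of `W` on `ℤ ⊗ (I / J)`: the element `w` acts by left multiplication by `T_w`. -/
def leftAct (hI : ∀ h x : Hecke cs φ, x ∈ I → h * x ∈ I)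
    (hJ : ∀ h x : Hecke cs φ, x ∈ J → h * x ∈ J) :
    W →* Module.End (AddMonoidAlgebra ℤ Γ) (Spec cs φ I J) :=
  homOfLength cs
    (fun w => opSpec cs φ I J (LinearMap.mulLeft _ (T cs φ w)) (mulLeft_mem cs φ hI _)
      (mulLeft_mem cs φ hJ _))
    (by
      refine end_spec_ext cs φ fun z x => ?_
      rw [opSpec_tmul, Module.End.one_apply]
      congr 2
      exact Subtype.ext (by simp [T_one]))
    (by
      intro w w' h
      refine end_spec_ext cs φ fun z x => ?_
      rw [Module.End.mul_apply, opSpec_tmul, opSpec_tmul, opSpec_tmul]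
      congr 2
      exact Subtype.ext (by simp [← T_mul cs φ w w' h]))
    (by
      intro i
      refine end_spec_ext cs φ fun z x => ?_
      rw [Module.End.mul_apply, opSpec_tmul, opSpec_tmul, Module.End.one_apply]
      refine Eq.trans ?_ ((congrArg (fun y => z ⊗ₜ[AddMonoidAlgebra ℤ Γ] Submodule.Quotient.mk x + y)
        (ex_sub_ex_smul_spec cs φ (par cs φ i) (-par cs φ i) (z ⊗ₜ Submodule.Quotient.mk
          ⟨T cs φ (cs.simple i) * x.1, hI _ _ x.2⟩))).trans (add_zero _))
      rw [← TensorProduct.tmul_smul, ← TensorProduct.tmul_add, ← Submodule.Quotient.mk_smul,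
        ← Submodule.Quotient.mk_add]
      congr 2
      refine Subtype.ext ?_
      simp [← mul_assoc, T_simple_sq, add_mul])

/-- Right action of `W` on `ℤ ⊗ (I / J)`: the element `w` acts by right multiplication by `T_w`. -/
def rightAct (hI : ∀ h x : Hecke cs φ, x ∈ I → x * h ∈ I)
    (hJ : ∀ h x : Hecke cs φ, x ∈ J → x * h ∈ J) :
    W →* (Module.End (AddMonoidAlgebra ℤ Γ) (Spec cs φ I J))ᵐᵒᵖ :=
  homOfLength cs
    (fun w => MulOpposite.op
      (opSpec cs φ I J (LinearMap.mulRight _ (T cs φ w)) (mulRight_mem cs φ hI _)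
        (mulRight_mem cs φ hJ _)))
    (by
      refine congrArg MulOpposite.op (end_spec_ext cs φ fun z x => ?_)
      rw [opSpec_tmul, Module.End.one_apply]
      congr 2
      exact Subtype.ext (by simp [T_one]))
    (by
      intro w w' h
      rw [← MulOpposite.op_mul]
      refine congrArg MulOpposite.op (end_spec_ext cs φ fun z x => ?_)
      rw [Module.End.mul_apply, opSpec_tmul, opSpec_tmul, opSpec_tmul]
      congr 2
      exact Subtype.ext (by simp [← T_mul cs φ w w' h, mul_assoc]))
    (by
      intro i
      rw [← MulOpposite.op_mul]
      refine congrArg MulOpposite.op (end_spec_ext cs φ fun z x => ?_)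
      rw [Module.End.mul_apply, opSpec_tmul, opSpec_tmul, Module.End.one_apply]
      refine Eq.trans ?_ ((congrArg (fun y => z ⊗ₜ[AddMonoidAlgebra ℤ Γ] Submodule.Quotient.mk x + y)
        (ex_sub_ex_smul_spec cs φ (par cs φ i) (-par cs φ i) (z ⊗ₜ Submodule.Quotient.mk
          ⟨x.1 * T cs φ (cs.simple i), hI _ _ x.2⟩))).trans (add_zero _))
      rw [← TensorProduct.tmul_smul, ← TensorProduct.tmul_add, ← Submodule.Quotient.mk_smul,
        ← Submodule.Quotient.mk_add]
      congr 2
      refine Subtype.ext ?_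
      simp [mul_assoc, T_simple_sq, mul_add])

theorem commute_left_right (hI : ∀ h x : Hecke cs φ, x ∈ I → h * x ∈ I)
    (hJ : ∀ h x : Hecke cs φ, x ∈ J → h * x ∈ J) (hI' : ∀ h x : Hecke cs φ, x ∈ I → x * h ∈ I)
    (hJ' : ∀ h x : Hecke cs φ, x ∈ J → x * h ∈ J) (w w' : W) :
    Commute (leftAct cs φ hI hJ w) (rightAct cs φ hI' hJ' w').unop := by
  refine end_spec_ext cs φ fun z x => ?_
  have h : (⟨T cs φ w * (x.1 * T cs φ w'), hI _ _ (hI' _ _ x.2)⟩ : I) =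
      ⟨T cs φ w * x.1 * T cs φ w', hI' _ _ (hI _ _ x.2)⟩ := Subtype.ext (mul_assoc _ _ _).symm
  exact congrArg (fun y => z ⊗ₜ[AddMonoidAlgebra ℤ Γ] Submodule.Quotient.mk y) h

end Quotient

/-- The group `W`, `W^op` or `W × W^op`; a left module over its group ring is a left `ℤW`-module,
a right `ℤW`-module or a `(ℤW, ℤW)`-bimodule. -/
def ActGroup (W : Type v) : Side → Type v
  | .L => W
  | .R => Wᵐᵒᵖ
  | .LR => W × Wᵐᵒᵖ

instance (σ : Side) : Group (ActGroup W σ) :=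
  match σ with
  | .L => inferInstanceAs (Group W)
  | .R => inferInstanceAs (Group Wᵐᵒᵖ)
  | .LR => inferInstanceAs (Group (W × Wᵐᵒᵖ))

/-- The morphism `W^op → E` attached to a morphism `W → E^op`. -/
def unopHom {E : Type*} [Monoid E] (f : W →* Eᵐᵒᵖ) : Wᵐᵒᵖ →* E where
  toFun w := (f w.unop).unop
  map_one' := by simp
  map_mul' := by simp

/-- The action of `W` on `ℤ ⊗ (I / J)` by multiplication by the `T_w` on the left, on the right,
or on both sides. -/
def act (σ : Side) {I J : Submodule (AddMonoidAlgebra ℤ Γ) (Hecke cs φ)}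
    (hI : IsIdealOf cs φ σ I) (hJ : IsIdealOf cs φ σ J) :
    ActGroup W σ →* Module.End (AddMonoidAlgebra ℤ Γ) (Spec cs φ I J) :=
  match σ, hI, hJ with
  | .L, hI, hJ => leftAct cs φ (hI.1 trivial) (hJ.1 trivial)
  | .R, hI, hJ => unopHom (rightAct cs φ (hI.2 trivial) (hJ.2 trivial))
  | .LR, hI, hJ =>
    MonoidHom.noncommCoprod (leftAct cs φ (hI.1 trivial) (hJ.1 trivial))
      (unopHom (rightAct cs φ (hI.2 trivial) (hJ.2 trivial)))
      (fun w w' => commute_left_right cs φ (hI.1 trivial) (hJ.1 trivial) (hI.2 trivial)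
        (hJ.2 trivial) w w'.unop)

/-! ### Kazhdan-Lusztig basis, cells, cell modules -/

variable [LinearOrder Γ] [IsOrderedAddMonoid Γ]

/-- `⊕_w ℤ[Γ_{<0}] T_w`. -/
def heckeNeg : AddSubgroup (Hecke cs φ) :=
  AddSubgroup.closure {x | ∃ γ : Γ, γ < 0 ∧ ∃ w : W, x = ex γ • T cs φ w}

/-- The characterisation of the Kazhdan-Lusztig basis element `C_w`. -/
def IsKL (w : W) (c : Hecke cs φ) : Prop :=
  bar cs φ c = c ∧ c - T cs φ w ∈ heckeNeg cs φ

/-- The Kazhdan-Lusztig basis element `C_w`: the unique element with `IsKL`. -/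
def klBasis (w : W) : Hecke cs φ := Classical.epsilon (IsKL cs φ w)

/-- `C_x` occurs with a non-zero coefficient in the decomposition of `h` on the basis `(C_w)`. -/
def Occurs (x : W) (h : Hecke cs φ) : Prop :=
  ∃ c : W →₀ AddMonoidAlgebra ℤ Γ, h = c.sum (fun w a => a • klBasis cs φ w) ∧ c x ≠ 0

/-- The elementary relation `x ← y`. -/
def Arrow (σ : Side) (x y : W) : Prop :=
  ∃ h : Hecke cs φ, (σ.left ∧ Occurs cs φ x (h * klBasis cs φ y)) ∨
    (σ.right ∧ Occurs cs φ x (klBasis cs φ y * h))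

/-- The preorder `x ≤ y`. -/
def CellLE (σ : Side) (x y : W) : Prop := Relation.TransGen (Arrow cs φ σ) x y

/-- The equivalence relation `x ∼ y`. -/
def CellEquiv (σ : Side) (x y : W) : Prop := CellLE cs φ σ x y ∧ CellLE cs φ σ y x

/-- The cells. -/
def IsCell (σ : Side) (C : Set W) : Prop := ∃ w : W, C = {x | CellEquiv cs φ σ x w}

/-- The ideal `H_{≤ C}` generated by the `C_w` with `w ≤ C` (since the `ℤ[Γ]`-span of these
elements is an ideal, it is equal to that span). -/
def idealLE (σ : Side) (C : Set W) : Submodule (AddMonoidAlgebra ℤ Γ) (Hecke cs φ) :=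
  idealSpan cs φ σ {h | ∃ w : W, (∃ c ∈ C, CellLE cs φ σ w c) ∧ h = klBasis cs φ w}

/-- The ideal `H_{< C}` generated by the `C_w` with `w < C`, i.e. `w ≤ C` and `w ∉ C`
(equal to the `ℤ[Γ]`-span of these elements). -/
def idealLT (σ : Side) (C : Set W) : Submodule (AddMonoidAlgebra ℤ Γ) (Hecke cs φ) :=
  idealSpan cs φ σ {h | ∃ w : W, ((∃ c ∈ C, CellLE cs φ σ w c) ∧ w ∉ C) ∧ h = klBasis cs φ w}

/-- The specialised cell module `ℤ ⊗_{ℤ[Γ]} (H_{≤ C} / H_{< C})`. -/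
def ZCellModule (σ : Side) (C : Set W) : Type (max v w) :=
  Spec cs φ (idealLE cs φ σ C) (idealLT cs φ σ C)

instance (σ : Side) (C : Set W) : AddCommGroup (ZCellModule cs φ σ C) :=
  inferInstanceAs (AddCommGroup (Spec cs φ (idealLE cs φ σ C) (idealLT cs φ σ C)))

/-- The structure of `ℤW`-module (left, right or bimodule) of the specialised cell module. -/
instance (σ : Side) (C : Set W) :
    Module (MonoidAlgebra ℤ (ActGroup W σ)) (ZCellModule cs φ σ C) :=
  Module.compHom (Spec cs φ (idealLE cs φ σ C) (idealLT cs φ σ C))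
    (MonoidAlgebra.lift ℤ _ (ActGroup W σ)
      (act cs φ σ (I := idealLE cs φ σ C) (J := idealLT cs φ σ C)
        (isIdealOf_idealSpan cs φ σ _) (isIdealOf_idealSpan cs φ σ _))).toRingHom

end Hecke

/-! ## The conjectures -/

section Conjectures

variable {B : Type u} {W : Type v} [Group W] {M : CoxeterMatrix B} (cs : CoxeterSystem M W)

/-- The parameter `φ_X : S̄ → Γ_X`. -/
def parOf (X : Pos (ZSBar cs)) : SBar cs → X.Quo := fun ω => X.can (Finsupp.single ω 1)

/-- The parabolic subgroup `W_F` of a facet: generated by the simple reflections whose class `ω`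
satisfies `F ⊆ H_ω`. -/
def parabolic (F : Set (Pos (ZSBar cs))) : Subgroup W :=
  Subgroup.closure {w | ∃ i : B, F ⊆ Pos.hyp (cls cs i) ∧ w = cs.simple i}

/-- Stability under translations by a subgroup, on the left, on the right or on both sides. -/
def TransStable (σ : Side) (H : Subgroup W) (C : Set W) : Prop :=
  (σ.left → ∀ w ∈ H, ∀ x ∈ C, w * x ∈ C) ∧ (σ.right → ∀ w ∈ H, ∀ x ∈ C, x * w ∈ C)

/-- A finite complete rational hyperplane arrangement. -/
structure IsCompleteArrangement (𝔄 : Set (Set (Pos (ZSBar cs)))) : Prop where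
  finite : 𝔄.Finite
  rational : ∀ H ∈ 𝔄, Pos.IsRationalHyperplane H
  complete : ∀ i : B, Pos.hyp (cls cs i) ∈ 𝔄

/-- `C` is a non-empty subset of `W` which is stable by translation by `W_F` and a union of cells
for every parameter in a chamber whose closure contains `F`. -/
def FacetUnion (𝔄 : Set (Set (Pos (ZSBar cs)))) (F : Set (Pos (ZSBar cs))) (σ : Side)
    (C : Set W) : Prop :=
  C.Nonempty ∧
    (∀ Ch, Pos.IsChamber 𝔄 Ch → F ⊆ closure Ch → ∀ Y ∈ Ch,
      ∃ 𝒮 : Set (Set W), (∀ D ∈ 𝒮, IsCell cs (parOf cs Y) σ D) ∧ C = ⋃₀ 𝒮) ∧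
    TransStable σ (parabolic cs F) C

/-- The arrangement `𝔄` satisfies the properties required in Conjecture A: the cells are constant
on the facets, and the cells of a facet `F` are the minimal sets satisfying `FacetUnion`. -/
structure SatisfiesA (𝔄 : Set (Set (Pos (ZSBar cs)))) : Prop extends
    IsCompleteArrangement cs 𝔄 where
  const : ∀ (σ : Side) (F : Set (Pos (ZSBar cs))), Pos.IsFacet 𝔄 F → ∀ X ∈ F, ∀ Y ∈ F,
    ∀ x y : W, CellEquiv cs (parOf cs X) σ x y ↔ CellEquiv cs (parOf cs Y) σ x y
  cells : ∀ (σ : Side) (F : Set (Pos (ZSBar cs))), Pos.IsFacet 𝔄 F → ∀ X ∈ F, ∀ C : Set W,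
    IsCell cs (parOf cs X) σ C ↔ Minimal (FacetUnion cs 𝔄 F σ) C

/-- Conjecture A for `(W, S)`. -/
def ConjectureA : Prop := ∃ 𝔄 : Set (Set (Pos (ZSBar cs))), SatisfiesA cs 𝔄

/-- `𝔄` is the set of essential hyperplanes: the smallest arrangement as in Conjecture A. -/
def IsEssentialArrangement (𝔄 : Set (Set (Pos (ZSBar cs)))) : Prop :=
  IsLeast {𝔄' | SatisfiesA cs 𝔄'} 𝔄

/-- The cells for `Y` that are contained in `C`. -/
abbrev SubCells (Y : Pos (ZSBar cs)) (σ : Side) (C : Set W) : Type v :=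
  {D : Set W // IsCell cs (parOf cs Y) σ D ∧ D ⊆ C}

/-- For a cell `C` relative to `X` and a parameter `Y`: there are a partition of the set of cells
for `Y` contained in `C` into `d` blocks, compatible with the preorder of `Y`, and a filtration
of the cell module of `C` by `ℤW`-submodules whose successive quotients are the direct sums of
the cell modules of the cells of the blocks. -/
def HasCellFiltration (X Y : Pos (ZSBar cs)) (σ : Side) (C : Set W) : Prop :=
  ∃ (d : ℕ) (κ : SubCells cs Y σ C → Fin d),
    Function.Surjective κ ∧
    (∀ i j : SubCells cs Y σ C,
      (∃ x ∈ i.1, ∃ y ∈ j.1, CellLE cs (parOf cs Y) σ x y) → κ i ≤ κ j) ∧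
    ∃ N : Fin (d + 1) → Submodule (MonoidAlgebra ℤ (ActGroup W σ))
        (ZCellModule cs (parOf cs X) σ C),
      Monotone N ∧ N 0 = ⊥ ∧ N (Fin.last d) = ⊤ ∧
      ∀ k : Fin d, Nonempty
        ((↥(N k.succ) ⧸ (N k.castSucc).submoduleOf (N k.succ))
          ≃ₗ[MonoidAlgebra ℤ (ActGroup W σ)]
        ⨁ i : {i : SubCells cs Y σ C // κ i = k}, ZCellModule cs (parOf cs Y) σ i.1.1)

/-- Conjecture B for `(W, S)`, with respect to the arrangement of essential hyperplanes: if `C` is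
a cell for `X` and `Y` lies in a chamber whose closure contains `X`, then `C` is the (disjoint)
union of the cells for `Y` contained in `C`, and the cell module of `C` has a filtration as in
`HasCellFiltration`. -/
def ConjectureB : Prop :=
  ∀ 𝔄 : Set (Set (Pos (ZSBar cs))), IsEssentialArrangement cs 𝔄 →
    ∀ (σ : Side) (X : Pos (ZSBar cs)) (C : Set W), IsCell cs (parOf cs X) σ C →
      ∀ Ch, Pos.IsChamber 𝔄 Ch → X ∈ closure Ch → ∀ Y ∈ Ch,
        C = (⋃ i : SubCells cs Y σ C, i.1) ∧ HasCellFiltration cs X Y σ C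

end Conjectures

end KLCells

end

set_option linter.unusedSectionVars false

open scoped TensorProduct DirectSum Pointwise

noncomputable section

namespace KLCells

universe u v w

/-! ## Infinite dihedral groups -/

/-! The proof determines all cells explicitly, uniformly in the parameters. A sign character `ε` of
`W` can be prescribed freely on `s` and `t`, and replacing `T_w` by `ε(w) T_w` changes the signs of
the parameters but not the cells. After exchanging `s` and `t` if necessary, one may thus assume `0
≤ b ≤ a`, where `a` and `b` are the normalised parameters of `s` and `t` (`NormPar`,
`exists_normPar`).

The Kazhdan-Lusztig elements are then written down in three regimes: `C_w = T_w` for `a = b = 0`,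
the elements `eqKL` for `a = b > 0`, and the elements `uKL` for `a > b`. The formulas for
multiplication by `C_s` and `C_t` give the existence of the basis, a supply of left ideals spanned
by subsets of the basis, and the connectivity of the cells.

The result is best seen through a rank: `0` for words ending in `s`, `1` for words ending in `t`
other than `t`, `2` for `t`, and `3` for `1`. The elements of rank `< 1`, `< 2`, `< 3` span left
ideals when `0 < a`, `b < a`, `0 < b` respectively (`lower_left`), and the left cells are the blocks
cut out by the conditions that hold (`cellEquiv_iff`). Right cells follow by the anti-involution
`T_w ↦ T_{w⁻¹}`; for two-sided cells the ranks `0` and `1` merge.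

The conditions change only on the walls `a = 0`, `b = 0` and `a = b`, that is, on `H_s`, `H_t` and,
according to the signs, `H_{s-t}` or `H_{s+t}`. In a chamber all cuts hold and the cells are the
fibres of the rank. A point in the closure of the chamber satisfies `0 ≤ b ≤ a` for the same signs,
so its cells are intervals of ranks. Conversely, a set as in Conjecture A cannot be smaller than
such a cell: for `b = 0`, translation by `t` links `1` and `t`; for `a = b`, the facet also lies in
the closure of the opposite chamber, where `t` and `st` lie in one cell; for `a = b = 0`, the group
`W_F` is everything (`satisfiesA`). No hyperplane can be dropped: `H_s` and `H_t` are imposed by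
completeness, and `t` and `st` are separated as soon as one leaves `a = b > 0` towards `b < a`
(`hyp_sub_mem`).

For Conjecture B, everything is moved into `ℤW` by the specialisation `e^γ ↦ 1`. A specialised cell
module is the quotient of the images of two lower sets whose difference is the cell
(`cellModule_equiv`), and the image of the elements of rank `< k` is generated by elements that do
not depend on the parameters (`map_klSpan_eq`). So the chain of images for a chamber induces the
required filtration of every cell module in its closure (`hasCellFiltration`). -/

/-- The alternating product `x y x ⋯` with `k` factors. -/
def alt {G : Type*} [Monoid G] : G → G → ℕ → G
  | _, _, 0 => 1
  | x, y, k + 1 => x * alt y x k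

theorem alt_zero {G : Type*} [Monoid G] (x y : G) : alt x y 0 = 1 := rfl

theorem alt_succ {G : Type*} [Monoid G] (x y : G) (k : ℕ) : alt x y (k + 1) = x * alt y x k := rfl

theorem alt_even {G : Type*} [Monoid G] (x y : G) (n : ℕ) : alt x y (2 * n) = (x * y) ^ n := by
  induction n with
  | zero => rw [mul_zero, pow_zero, alt_zero]
  | succ n ih => rw [mul_add, mul_one, alt_succ, alt_succ, ih, pow_succ', mul_assoc]

theorem alt_odd {G : Type*} [Monoid G] (x y : G) (n : ℕ) :
    alt x y (2 * n + 1) = x * (y * x) ^ n := by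
  rw [alt_succ, alt_even]

section Dihedral

variable {B : Type u} {W : Type v} [Group W] {M : CoxeterMatrix B} (cs : CoxeterSystem M W)

/-- The simple reflections are `s` and `t`, and `st` has infinite order. -/
structure InfDihedral (s t : B) : Prop where
  eq_or_eq : ∀ i : B, i = s ∨ i = t
  not_finite : ¬ IsOfFinOrder (cs.simple s * cs.simple t)

variable {cs} {s t : B}

namespace InfDihedral

variable (hD : InfDihedral cs s t)

include hD

theorem symm : InfDihedral cs t s where
  eq_or_eq i := (hD.eq_or_eq i).symm
  not_finite h := hD.not_finite (by
    have h1 := h.inv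
    rwa [mul_inv_rev, cs.inv_simple, cs.inv_simple] at h1)

theorem ne : s ≠ t := by
  rintro rfl
  exact hD.not_finite (by rw [cs.simple_mul_simple_self]; exact IsOfFinOrder.one)

theorem pow_ne_one {n : ℕ} (hn : n ≠ 0) : (cs.simple s * cs.simple t) ^ n ≠ 1 := fun h =>
  hD.not_finite (isOfFinOrder_iff_pow_eq_one.2 ⟨n, Nat.pos_of_ne_zero hn, h⟩)

theorem matrix_eq_zero : M s t = 0 := by
  by_contra h
  exact hD.pow_ne_one h (cs.simple_mul_simple_pow s t)

theorem eq_of_ne {i j k : B} (h : i ≠ j) (h' : j ≠ k) : i = k := by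
  rcases hD.eq_or_eq i with rfl | rfl <;> rcases hD.eq_or_eq j with rfl | rfl <;>
    rcases hD.eq_or_eq k with rfl | rfl <;> first | rfl | exact absurd rfl h | exact absurd rfl h'

-- With two letters available, each letter of a word without repetition is forced by its
-- predecessor. The letter `j` put in front encodes the fact that the word starts with `i`.
omit hD in
theorem wordProd_pair_chain (hD : InfDihedral cs s t) (n : ℕ) (i j : B) (hij : i ≠ j) (l : List B)
    (hl : l.length = 2 * n) (hc : (j :: l).IsChain (· ≠ ·)) :
    cs.wordProd l = (cs.simple i * cs.simple j) ^ n := by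
  induction n generalizing l with
  | zero => rw [List.length_eq_zero_iff.1 hl, cs.wordProd_nil, pow_zero]
  | succ n ih =>
    match l, hl, hc with
    | a :: b :: l, hl, hc =>
      rw [List.isChain_cons_cons, List.isChain_cons_cons] at hc
      obtain rfl : i = a := hD.eq_of_ne hij hc.1
      obtain rfl : j = b := hD.eq_of_ne hij.symm hc.2.1
      rw [cs.wordProd_cons, cs.wordProd_cons, ih l (by simpa [mul_add] using hl) hc.2.2, pow_succ',
        mul_assoc]

/-- Parity of the length excludes odd words. An even word is a power of `st` or of `ts`, which is
trivial only for exponent zero. -/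
theorem eq_nil_of_wordProd_eq_one {l : List B} (hc : l.IsChain (· ≠ ·))
    (h : cs.wordProd l = 1) : l = [] := by
  have hpar : l.length % 2 = 0 := by
    have h1 : ∀ l : List B, cs.length (cs.wordProd l) % 2 = l.length % 2 := by
      intro l
      induction l with
      | nil => simp
      | cons a l ih =>
        rw [cs.wordProd_cons, cs.length_mul_mod_two, Nat.add_mod, ih, cs.length_simple,
          List.length_cons]
        omega
    rw [← h1, h, cs.length_one]
  obtain ⟨n, hn⟩ : ∃ n, l.length = 2 * n := ⟨l.length / 2, by omega⟩
  rcases l with - | ⟨a, l⟩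
  · rfl
  exfalso
  have hn0 : n ≠ 0 := by
    rintro rfl
    simp at hn
  rcases hD.eq_or_eq a with rfl | rfl
  · have h2 := wordProd_pair_chain hD n a t hD.ne (a :: l) hn
      (List.isChain_cons_cons.2 ⟨hD.ne.symm, hc⟩)
    exact hD.pow_ne_one hn0 (h2.symm.trans h)
  · have h2 := wordProd_pair_chain hD n a s hD.ne.symm (a :: l) hn
      (List.isChain_cons_cons.2 ⟨hD.ne, hc⟩)
    exact hD.symm.pow_ne_one hn0 (h2.symm.trans h)

theorem eq_of_wordProd_eq {l l' : List B} (hc : l.IsChain (· ≠ ·)) (hc' : l'.IsChain (· ≠ ·))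
    (h : cs.wordProd l = cs.wordProd l') : l = l' := by
  induction l generalizing l' with
  | nil => exact (hD.eq_nil_of_wordProd_eq_one hc' (by rw [← h, cs.wordProd_nil])).symm
  | cons a l ih =>
    cases l' with
    | nil => exact hD.eq_nil_of_wordProd_eq_one hc (by rw [h, cs.wordProd_nil])
    | cons b l' =>
      by_cases hab : a = b
      · subst hab
        rw [cs.wordProd_cons, cs.wordProd_cons, mul_right_inj] at h
        exact congrArg (a :: ·) (ih hc.tail hc'.tail h)
      · exfalso
        -- If the first letters differ, the reversed first word followed by the second is again free
        -- of repetitions, and it represents `1`.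
        have h1 : ((a :: l).reverse ++ (b :: l')).IsChain (· ≠ ·) := by
          rw [List.isChain_append]
          refine ⟨?_, hc', ?_⟩
          · rw [List.isChain_reverse]
            exact hc.imp fun _ _ h => h.symm
          · simpa using hab
        have h2 := hD.eq_nil_of_wordProd_eq_one h1 (by
          rw [cs.wordProd_append, cs.wordProd_reverse, h, inv_mul_cancel])
        simp at h2

omit hD in
theorem isChain_of_isReduced {l : List B} (hl : cs.IsReduced l) : l.IsChain (· ≠ ·) := by
  induction l with
  | nil => exact List.isChain_nil
  | cons a l ih =>
    cases l with
    | nil => exact List.isChain_singleton _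
    | cons b l =>
      refine List.isChain_cons_cons.2 ⟨?_, ih (by simpa using hl.drop 1)⟩
      rintro rfl
      have h1 := cs.length_wordProd_le l
      rw [CoxeterSystem.IsReduced, cs.wordProd_cons, cs.wordProd_cons,
        cs.simple_mul_simple_cancel_left] at hl
      simp at hl
      omega

theorem isReduced_of_isChain {l : List B} (hl : l.IsChain (· ≠ ·)) : cs.IsReduced l := by
  obtain ⟨l', h1, h2⟩ := cs.exists_isReduced (cs.wordProd l)
  rwa [hD.eq_of_wordProd_eq hl (isChain_of_isReduced h1) h2]

theorem eq_of_isReduced {l l' : List B} (hl : cs.IsReduced l) (hl' : cs.IsReduced l')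
    (h : cs.wordProd l = cs.wordProd l') : l = l' :=
  hD.eq_of_wordProd_eq (isChain_of_isReduced hl) (isChain_of_isReduced hl') h

/-- Characters of `W` with prescribed values on the simple reflections. -/
theorem exists_character (f : B → ℤˣ) : ∃ ε : W →* ℤˣ, ∀ i, ε (cs.simple i) = f i := by
  have hf : M.IsLiftable f := by
    intro i j
    by_cases hij : i = j
    · subst hij
      rw [M.diagonal, pow_one, Int.units_mul_self]
    · have : M i j = 0 := by
        rcases hD.eq_or_eq i with rfl | rfl <;> rcases hD.eq_or_eq j with rfl | rfl
        · exact absurd rfl hij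
        · exact hD.matrix_eq_zero
        · exact hD.symm.matrix_eq_zero
        · exact absurd rfl hij
      rw [this, pow_zero]
  exact ⟨cs.lift ⟨f, hf⟩, fun i => cs.lift_apply_simple hf i⟩

/-- A character to `ℤˣ` is constant on conjugacy classes but can be prescribed freely on `s` and
`t`. Hence `S̄` has two elements and `ℤ[S̄]` has rank two. -/
theorem not_isConj : ¬ IsConj (cs.simple s) (cs.simple t) := by
  classical
  obtain ⟨ε, hε⟩ := hD.exists_character (fun i => if i = s then -1 else 1)
  intro h
  have h1 : IsConj (ε (cs.simple s)) (ε (cs.simple t)) := ε.map_isConj h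
  rw [isConj_iff_eq, hε, hε, if_pos rfl, if_neg hD.ne.symm] at h1
  exact absurd h1 (by decide)

/-! ### Lengths of alternating products -/

theorem length_alt (k : ℕ) : cs.length (alt (cs.simple s) (cs.simple t) k) = k := by
  -- The word of the alternating product, built by a recursion that swaps the two letters at each
  -- step.
  let L : B → B → ℕ → List B := fun i j k => Nat.rec (motive := fun _ => B → B → List B)
    (fun _ _ => []) (fun _ f i j => i :: f j i) k i j
  have hlen : ∀ k i j, (L i j k).length = k := by
    intro k
    induction k with
    | zero => intro i j; rfl
    | succ k ih => intro i j; exact congrArg (· + 1) (ih j i)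
  have hprod : ∀ k i j, cs.wordProd (L i j k) = alt (cs.simple i) (cs.simple j) k := by
    intro k
    induction k with
    | zero => intro i j; exact cs.wordProd_nil
    | succ k ih => intro i j; exact (cs.wordProd_cons _ _).trans (by rw [ih j i]; rfl)
  have hchain : ∀ k i j, i ≠ j → (i :: L j i k).IsChain (· ≠ ·) := by
    intro k
    induction k with
    | zero => intro i j _; exact List.isChain_singleton _
    | succ k ih => intro i j hij; exact List.isChain_cons_cons.2 ⟨hij, ih j i hij.symm⟩
  rw [← hprod, hD.isReduced_of_isChain (l := L s t k), hlen]
  exact (hchain k t s hD.ne.symm).tail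

/-- Every element of `W` is an alternating product. -/
theorem exists_alt (w : W) : ∃ k, w = alt (cs.simple s) (cs.simple t) k ∨
    w = alt (cs.simple t) (cs.simple s) k := by
  induction w using cs.simple_induction_left with
  | one => exact ⟨0, Or.inl rfl⟩
  | mul_simple_left w i ih =>
    have key : ∀ i j : B, i ≠ j → (∃ k, w = alt (cs.simple i) (cs.simple j) k ∨
        w = alt (cs.simple j) (cs.simple i) k) →
        ∃ k, cs.simple i * w = alt (cs.simple i) (cs.simple j) k ∨
        cs.simple i * w = alt (cs.simple j) (cs.simple i) k := by
      rintro i j - ⟨k, rfl | rfl⟩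
      · cases k with
        | zero => exact ⟨1, Or.inl rfl⟩
        | succ k => exact ⟨k, Or.inr (by rw [alt_succ, cs.simple_mul_simple_cancel_left])⟩
      · exact ⟨k + 1, Or.inl rfl⟩
    rcases hD.eq_or_eq i with rfl | rfl
    · exact key i t hD.ne ih
    · obtain ⟨k, h⟩ := key i s hD.ne.symm ⟨ih.choose, ih.choose_spec.symm⟩
      exact ⟨k, h.symm⟩

/-- The element `y^p (x y x ⋯ x) y^q`, where the middle factor has length `2 n + 1`. -/
def dc {G : Type*} [Monoid G] (x y : G) (n : ℕ) (p q : Bool) : G :=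
  (bif p then y else 1) * alt x y (2 * n + 1) * (bif q then y else 1)

omit hD in
theorem alt_odd_mul {G : Type*} [Monoid G] (x y : G) (n : ℕ) :
    alt x y (2 * n + 1) * y = alt x y (2 * n + 2) := by
  rw [alt_odd, show 2 * n + 2 = 2 * (n + 1) by ring, alt_even, pow_succ', mul_assoc,
    ← (SemiconjBy.pow_right (show SemiconjBy y (x * y) (y * x) from (mul_assoc y x y).symm) n).eq,
    mul_assoc]

omit hD in
theorem dc_eq_alt {G : Type*} [Monoid G] (x y : G) (n : ℕ) (q : Bool) :
    dc x y n false q = alt x y (2 * n + 1 + q.toNat) ∧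
      dc x y n true q = alt y x (2 * n + 1 + q.toNat + 1) := by
  have h1 : dc x y n false q = alt x y (2 * n + 1 + q.toNat) := by
    cases q
    · simp [dc]
    · simp [dc, alt_odd_mul]
  refine ⟨h1, ?_⟩
  rw [alt_succ, ← h1]
  simp [dc, mul_assoc]

theorem length_dc (n : ℕ) (p q : Bool) :
    cs.length (dc (cs.simple s) (cs.simple t) n p q) = 2 * n + 1 + p.toNat + q.toNat := by
  cases p
  · rw [(dc_eq_alt _ _ _ _).1, hD.length_alt, Bool.toNat_false, add_zero]
  · rw [(dc_eq_alt _ _ _ _).2, hD.symm.length_alt, Bool.toNat_true]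
    omega

/-- The middle factor of `dc` runs from the first to the last letter `s` of the word; only `1` and
`t` contain no `s`. This form suits unequal parameters, where `C_w` has factors `C_t` at its ends.
-/
theorem cases_dc (w : W) : w = 1 ∨ w = cs.simple t ∨
    ∃ n p q, w = dc (cs.simple s) (cs.simple t) n p q := by
  obtain ⟨k, rfl | rfl⟩ := hD.exists_alt w
  · rcases k with - | k
    · exact Or.inl rfl
    · right; right
      rcases Nat.even_or_odd' k with ⟨n, rfl | rfl⟩
      · exact ⟨n, false, false, by rw [(dc_eq_alt _ _ _ _).1]; rfl⟩
      · exact ⟨n, false, true, by rw [(dc_eq_alt _ _ _ _).1]; rfl⟩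
  · rcases k with - | - | k
    · exact Or.inl rfl
    · exact Or.inr (Or.inl (mul_one _))
    · right; right
      rcases Nat.even_or_odd' k with ⟨n, rfl | rfl⟩
      · exact ⟨n, true, false, by rw [(dc_eq_alt _ _ _ _).2]; rfl⟩
      · exact ⟨n, true, true, by rw [(dc_eq_alt _ _ _ _).2]; rfl⟩

omit hD in
theorem alt_inv_odd (n : ℕ) : (alt (cs.simple s) (cs.simple t) (2 * n + 1))⁻¹ =
    alt (cs.simple s) (cs.simple t) (2 * n + 1) := by
  induction n with
  | zero => rw [mul_zero, zero_add, alt_succ, alt_zero, mul_one, cs.inv_simple]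
  | succ n ih =>
    rw [show 2 * (n + 1) + 1 = 2 * n + 1 + 1 + 1 by ring, alt_succ, alt_succ, mul_inv_rev,
      mul_inv_rev, ih, cs.inv_simple, cs.inv_simple, alt_odd_mul, ← alt_succ,
      show 2 * n + 1 + 1 = 2 * (n + 1) by ring, alt_even,
      alt_even, (SemiconjBy.pow_right (show SemiconjBy (cs.simple s) (cs.simple t * cs.simple s)
        (cs.simple s * cs.simple t) from (mul_assoc _ _ _).symm) (n + 1)).eq]

omit hD in
theorem dc_inv (n : ℕ) (p q : Bool) : (dc (cs.simple s) (cs.simple t) n p q)⁻¹ =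
    dc (cs.simple s) (cs.simple t) n q p := by
  cases p <;> cases q <;> simp [dc, alt_inv_odd, mul_assoc]

theorem isRightDescent_dc_right (n : ℕ) (p q : Bool) :
    cs.IsRightDescent (dc (cs.simple s) (cs.simple t) n p q) t ↔ q = true := by
  have h : ∀ q, dc (cs.simple s) (cs.simple t) n p q * cs.simple t =
      dc (cs.simple s) (cs.simple t) n p (!q) := by
    intro q
    cases q <;> simp [dc, mul_assoc]
  rw [CoxeterSystem.IsRightDescent, h, hD.length_dc, hD.length_dc]
  cases q <;> simp

theorem isRightDescent_dc_left (n : ℕ) (p q : Bool) :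
    cs.IsRightDescent (dc (cs.simple s) (cs.simple t) n p q) s ↔ q = false := by
  have h0 : alt (cs.simple s) (cs.simple t) (2 * n + 1) * cs.simple s =
      alt (cs.simple s) (cs.simple t) (2 * n) := by
    rw [alt_odd, alt_even, (SemiconjBy.pow_right (show SemiconjBy (cs.simple s)
      (cs.simple t * cs.simple s) (cs.simple s * cs.simple t) from (mul_assoc _ _ _).symm) n).eq,
      cs.simple_mul_simple_cancel_right]
  have h1 : alt (cs.simple s) (cs.simple t) (2 * n + 2) * cs.simple s =
      alt (cs.simple s) (cs.simple t) (2 * n + 3) := by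
    rw [show 2 * n + 2 = 2 * (n + 1) by ring, show 2 * n + 3 = 2 * (n + 1) + 1 by ring, alt_odd,
      alt_even, (SemiconjBy.pow_right (show SemiconjBy (cs.simple s)
      (cs.simple t * cs.simple s) (cs.simple s * cs.simple t) from (mul_assoc _ _ _).symm) _).eq]
  rw [CoxeterSystem.IsRightDescent, hD.length_dc]
  cases p <;> cases q
  · simp [dc, h0, hD.length_alt]
  · simp only [dc, cond_false, cond_true, one_mul]
    rw [alt_odd_mul, h1, hD.length_alt]
    simp
  · simp only [dc, cond_false, cond_true, mul_one]
    rw [mul_assoc, h0, ← alt_succ, hD.symm.length_alt]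
    simp
  · simp only [dc, cond_true]
    rw [mul_assoc (cs.simple t), alt_odd_mul, mul_assoc, h1, ← alt_succ, hD.symm.length_alt]
    simp

omit hD in
theorem isRightDescent_simple_self : cs.IsRightDescent (cs.simple s) s := by
  simp [CoxeterSystem.IsRightDescent]

theorem not_isRightDescent_simple : ¬ cs.IsRightDescent (cs.simple t) s := by
  have h : cs.simple t * cs.simple s = alt (cs.simple t) (cs.simple s) 2 := by
    simp [alt]
  rw [CoxeterSystem.IsRightDescent, h, hD.symm.length_alt, cs.length_simple]
  omega

end InfDihedral

end Dihedral

/-! ## The standard basis of the Hecke algebra -/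

section StandardBasis

variable {B : Type u} {W : Type v} [Group W] {M : CoxeterMatrix B} (cs : CoxeterSystem M W)
variable {Γ : Type w} [AddCommGroup Γ] (φ : SBar cs → Γ)

/-- The coefficient `e^φ(i) - e^{-φ(i)}` of the quadratic relation. -/
def qpar (i : B) : AddMonoidAlgebra ℤ Γ := ex (par cs φ i) - ex (-par cs φ i)

theorem T_simple_mul_of_lt {i : B} {w : W} (h : ¬ cs.IsLeftDescent w i) :
    T cs φ (cs.simple i) * T cs φ w = T cs φ (cs.simple i * w) :=
  T_mul cs φ _ _ (by rw [cs.not_isLeftDescent_iff.1 h, cs.length_simple, add_comm])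

theorem T_simple_mul_of_gt {i : B} {w : W} (h : cs.IsLeftDescent w i) :
    T cs φ (cs.simple i) * T cs φ w = T cs φ (cs.simple i * w) + qpar cs φ i • T cs φ w := by
  have h1 : ¬ cs.IsLeftDescent (cs.simple i * w) i :=
    cs.isLeftDescent_iff_not_isLeftDescent_mul.1 h
  have h2 := T_simple_mul_of_lt cs φ h1
  rw [cs.simple_mul_simple_cancel_left] at h2
  rw [← h2, ← mul_assoc, T_simple_sq, add_mul, one_mul, smul_mul_assoc]
  rfl

theorem T_simple_mul (i : B) (w : W) : ∃ c : AddMonoidAlgebra ℤ Γ, (c = 0 ∨ c = qpar cs φ i) ∧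
    T cs φ (cs.simple i) * T cs φ w = T cs φ (cs.simple i * w) + c • T cs φ w := by
  by_cases h : cs.IsLeftDescent w i
  · exact ⟨_, Or.inr rfl, T_simple_mul_of_gt cs φ h⟩
  · exact ⟨0, Or.inl rfl, by rw [T_simple_mul_of_lt cs φ h, zero_smul, add_zero]⟩

/-- A subalgebra containing the `T_s` is everything. -/
theorem subalgebra_eq_top (A : Subalgebra (AddMonoidAlgebra ℤ Γ) (Hecke cs φ))
    (h : ∀ i, T cs φ (cs.simple i) ∈ A) : A = ⊤ := by
  have hT : ∀ w, T cs φ w ∈ A := by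
    intro w
    induction hn : cs.length w generalizing w with
    | zero =>
      rw [cs.length_eq_zero_iff.1 hn, T_one]
      exact A.one_mem
    | succ n ih =>
      have hw : w ≠ 1 := by
        rintro rfl
        simp at hn
      obtain ⟨i, hi⟩ := cs.exists_leftDescent_of_ne_one hw
      have h1 := T_simple_mul_of_lt cs φ (cs.isLeftDescent_iff_not_isLeftDescent_mul.1 hi)
      rw [cs.simple_mul_simple_cancel_left] at h1
      rw [← h1]
      exact A.mul_mem (h i) (ih _ (by have := cs.isLeftDescent_iff.1 hi; omega))
  rw [eq_top_iff]
  rintro x -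
  obtain ⟨y, rfl⟩ := RingQuot.mkAlgHom_surjective (AddMonoidAlgebra ℤ Γ) (HeckeRel cs φ) x
  induction y using FreeAlgebra.induction with
  | grade0 r =>
    rw [AlgHom.commutes]
    exact A.algebraMap_mem r
  | grade1 w => exact hT w
  | mul a b ha hb =>
    rw [map_mul]
    exact A.mul_mem ha hb
  | add a b ha hb =>
    rw [map_add]
    exact A.add_mem ha hb

/-- A submodule stable by left multiplication by the `T_s` is a left ideal. -/
theorem mul_mem_of_simple (I : Submodule (AddMonoidAlgebra ℤ Γ) (Hecke cs φ))
    (h : ∀ i, ∀ x ∈ I, T cs φ (cs.simple i) * x ∈ I) (a x : Hecke cs φ) (hx : x ∈ I) :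
    a * x ∈ I := by
  let A : Subalgebra (AddMonoidAlgebra ℤ Γ) (Hecke cs φ) :=
    { carrier := {a | ∀ x ∈ I, a * x ∈ I}
      mul_mem' := fun {a b} ha hb x hx => by
        rw [mul_assoc]
        exact ha _ (hb _ hx)
      add_mem' := fun {a b} ha hb x hx => by
        rw [add_mul]
        exact I.add_mem (ha _ hx) (hb _ hx)
      algebraMap_mem' := fun r x hx => by
        rw [← Algebra.smul_def]
        exact I.smul_mem r hx }
  have hA : a ∈ A := by
    rw [subalgebra_eq_top cs φ A h]
    trivial
  exact hA x hx

theorem span_T : Submodule.span (AddMonoidAlgebra ℤ Γ) (Set.range (T cs φ)) = ⊤ := by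
  rw [eq_top_iff]
  rintro x -
  rw [← mul_one x]
  refine mul_mem_of_simple cs φ _ (fun i y hy => ?_) x 1 ?_
  · induction hy using Submodule.span_induction with
    | mem y hy =>
      obtain ⟨w, rfl⟩ := hy
      obtain ⟨c, -, hc⟩ := T_simple_mul cs φ i w
      rw [hc]
      exact Submodule.add_mem _ (Submodule.subset_span ⟨_, rfl⟩)
        (Submodule.smul_mem _ _ (Submodule.subset_span ⟨_, rfl⟩))
    | zero => rw [mul_zero]; exact Submodule.zero_mem _
    | add a b _ _ ha hb => rw [mul_add]; exact Submodule.add_mem _ ha hb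
    | smul r a _ ha => rw [mul_smul_comm]; exact Submodule.smul_mem _ _ ha
  · rw [← T_one]
    exact Submodule.subset_span ⟨1, rfl⟩

open Classical in
/-- The operator of `T_i` in the regular representation. -/
def regOp (i : B) : Module.End (AddMonoidAlgebra ℤ Γ) (W →₀ AddMonoidAlgebra ℤ Γ) :=
  Finsupp.linearCombination _ fun w => Finsupp.single (cs.simple i * w) 1 +
    if cs.IsLeftDescent w i then Finsupp.single w (qpar cs φ i) else 0

theorem regOp_of_lt {i : B} {w : W} (h : ¬ cs.IsLeftDescent w i) :
    regOp cs φ i (Finsupp.single w 1) = Finsupp.single (cs.simple i * w) 1 := by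
  rw [regOp, Finsupp.linearCombination_single, if_neg h, one_smul, add_zero]

theorem regOp_of_gt {i : B} {w : W} (h : cs.IsLeftDescent w i) :
    regOp cs φ i (Finsupp.single w 1) =
      Finsupp.single (cs.simple i * w) 1 + qpar cs φ i • Finsupp.single w 1 := by
  rw [regOp, Finsupp.linearCombination_single, if_pos h, one_smul, Finsupp.smul_single,
    smul_eq_mul, mul_one]

theorem regOp_sq (i : B) : regOp cs φ i * regOp cs φ i = 1 + qpar cs φ i • regOp cs φ i := by
  refine Finsupp.lhom_ext' fun w => LinearMap.ext_ring ?_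
  change regOp cs φ i (regOp cs φ i (Finsupp.single w 1)) =
    Finsupp.single w 1 + qpar cs φ i • regOp cs φ i (Finsupp.single w 1)
  by_cases h : cs.IsLeftDescent w i
  · have h1 : ¬ cs.IsLeftDescent (cs.simple i * w) i :=
      cs.isLeftDescent_iff_not_isLeftDescent_mul.1 h
    have h2 := regOp_of_lt cs φ h1
    rw [cs.simple_mul_simple_cancel_left] at h2
    conv_lhs => rw [regOp_of_gt cs φ h, map_add, map_smul, h2]
  · have h1 : cs.IsLeftDescent (cs.simple i * w) i := by
      by_contra h'
      exact h (cs.isLeftDescent_iff_not_isLeftDescent_mul.2 h')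
    rw [regOp_of_lt cs φ h, regOp_of_gt cs φ h1, cs.simple_mul_simple_cancel_left]

theorem regOp_quad (i : B) :
    (regOp cs φ i - algebraMap _ _ (ex (par cs φ i))) *
      (regOp cs φ i + algebraMap _ _ (ex (-par cs φ i))) = 0 := by
  refine LinearMap.ext fun v => ?_
  have h := LinearMap.congr_fun (regOp_sq cs φ i) v
  change regOp cs φ i (regOp cs φ i v) = v + qpar cs φ i • regOp cs φ i v at h
  change regOp cs φ i (regOp cs φ i v + ex (-par cs φ i) • v) -
    ex (par cs φ i) • (regOp cs φ i v + ex (-par cs φ i) • v) = 0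
  rw [map_add, map_smul, h, smul_add, smul_smul, ex_mul_ex_neg, one_smul, qpar, sub_smul]
  abel

variable {cs} {s t : B} (hD : InfDihedral cs s t)

/-- The operator of `T_w` in the regular representation. -/
def regT (w : W) : Module.End (AddMonoidAlgebra ℤ Γ) (W →₀ AddMonoidAlgebra ℤ Γ) :=
  ((cs.exists_isReduced w).choose.map (regOp cs φ)).prod

include hD

/-- Reduced words are unique here, so there is no braid relation to verify and the operators can be
composed along any reduced word. -/
theorem regT_wordProd {l : List B} (hl : cs.IsReduced l) :
    regT φ (cs.wordProd l) = (l.map (regOp cs φ)).prod := by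
  have h := (cs.exists_isReduced (cs.wordProd l)).choose_spec
  rw [regT, hD.eq_of_isReduced h.1 hl h.2.symm]

theorem regT_rel {x y : FreeAlgebra (AddMonoidAlgebra ℤ Γ) W} (h : HeckeRel cs φ x y) :
    FreeAlgebra.lift (AddMonoidAlgebra ℤ Γ) (regT (cs := cs) φ) x =
      FreeAlgebra.lift (AddMonoidAlgebra ℤ Γ) (regT (cs := cs) φ) y := by
  cases h with
  | one =>
    rw [FreeAlgebra.lift_ι_apply, map_one]
    simpa using regT_wordProd φ hD (l := []) (by simp [CoxeterSystem.IsReduced])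
  | mul w w' h =>
    rw [map_mul, FreeAlgebra.lift_ι_apply, FreeAlgebra.lift_ι_apply, FreeAlgebra.lift_ι_apply]
    obtain ⟨l, hl, rfl⟩ := cs.exists_isReduced w
    obtain ⟨l', hl', rfl⟩ := cs.exists_isReduced w'
    have h1 : cs.IsReduced (l ++ l') := by
      rw [CoxeterSystem.IsReduced, cs.wordProd_append, h, hl, hl', List.length_append]
    rw [← cs.wordProd_append, regT_wordProd φ hD h1, regT_wordProd φ hD hl,
      regT_wordProd φ hD hl', List.map_append, List.prod_append]
  | quad i =>
    rw [map_mul, map_sub, map_add, FreeAlgebra.lift_ι_apply, AlgHom.commutes, AlgHom.commutes,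
      map_zero]
    have h1 := regT_wordProd φ hD (l := [i]) (by simp [CoxeterSystem.IsReduced])
    rw [cs.wordProd_singleton, List.map_singleton, List.prod_singleton] at h1
    rw [h1]
    exact regOp_quad cs φ i

/-- The regular representation of the Hecke algebra of an infinite dihedral group. -/
theorem exists_regular : ∃ f : Hecke cs φ →ₐ[AddMonoidAlgebra ℤ Γ]
    Module.End (AddMonoidAlgebra ℤ Γ) (W →₀ AddMonoidAlgebra ℤ Γ), ∀ w, f (T cs φ w) = regT φ w :=
  ⟨RingQuot.liftAlgHom (AddMonoidAlgebra ℤ Γ)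
    ⟨FreeAlgebra.lift (AddMonoidAlgebra ℤ Γ) (regT (cs := cs) φ), fun _ _ h => regT_rel φ hD h⟩,
    fun w => by
      refine (RingQuot.liftAlgHom_mkAlgHom_apply _ _ _ _).trans ?_
      rw [FreeAlgebra.lift_ι_apply]⟩

theorem regT_apply_one (w : W) : regT (cs := cs) φ w (Finsupp.single 1 1) = Finsupp.single w 1 := by
  obtain ⟨l, hl, rfl⟩ := cs.exists_isReduced w
  rw [regT_wordProd φ hD hl]
  induction l with
  | nil => simp
  | cons i l ih =>
    have hl' : cs.IsReduced l := by simpa using hl.drop 1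
    rw [List.map_cons, List.prod_cons, Module.End.mul_apply, ih hl', cs.wordProd_cons,
      regOp_of_lt]
    rw [cs.not_isLeftDescent_iff, ← cs.wordProd_cons, hl, hl', List.length_cons]

theorem linearIndependent_T : LinearIndependent (AddMonoidAlgebra ℤ Γ) (T cs φ) := by
  obtain ⟨f, hf⟩ := exists_regular φ hD
  let g : Hecke cs φ →ₗ[AddMonoidAlgebra ℤ Γ] (W →₀ AddMonoidAlgebra ℤ Γ) :=
    LinearMap.applyₗ (Finsupp.single 1 1) ∘ₗ f.toLinearMap
  refine LinearIndependent.of_comp g ?_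
  have : g ∘ T cs φ = fun w => Finsupp.single w 1 := by
    funext w
    change f (T cs φ w) (Finsupp.single 1 1) = _
    rw [hf, regT_apply_one φ hD]
  rw [this]
  exact Finsupp.linearIndependent_single_one _ _

/-- The standard basis of the Hecke algebra. -/
def stdBasis : Module.Basis W (AddMonoidAlgebra ℤ Γ) (Hecke cs φ) :=
  Module.Basis.mk (linearIndependent_T φ hD) (span_T cs φ).ge

theorem stdBasis_apply (w : W) : stdBasis φ hD w = T cs φ w :=
  Module.Basis.mk_apply _ _ _

theorem stdBasis_repr_T (w : W) : (stdBasis φ hD).repr (T cs φ w) = Finsupp.single w 1 := by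
  rw [← stdBasis_apply φ hD, Module.Basis.repr_self]

end StandardBasis

/-! ## Exponents of elements of the group algebra of an ordered group -/

section Exponents

variable {Γ : Type w} [AddCommGroup Γ] [LinearOrder Γ] [IsOrderedAddMonoid Γ]

/-- The elements of `ℤ[Γ]` whose exponents are all `< γ`. -/
def ltZ (γ : Γ) : AddSubgroup (AddMonoidAlgebra ℤ Γ) where
  carrier := {a | ∀ δ, a.coeff δ ≠ 0 → δ < γ}
  zero_mem' := fun δ h => absurd rfl h
  add_mem' := by
    intro a b ha hb δ h
    by_contra hδ
    have h1 : a.coeff δ = 0 := by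
      by_contra h1
      exact hδ (ha δ h1)
    have h2 : b.coeff δ = 0 := by
      by_contra h2
      exact hδ (hb δ h2)
    rw [AddMonoidAlgebra.coeff_add, Finsupp.add_apply, h1, h2] at h
    exact h rfl
  neg_mem' := by
    intro a ha δ h
    refine ha δ fun h' => h ?_
    have h1 : (-a).coeff δ = -(a.coeff δ) := rfl
    rw [h1, h', neg_zero]

theorem mul_mem_ltZ {γ : Γ} {a b : AddMonoidAlgebra ℤ Γ} (ha : ∀ δ, a.coeff δ ≠ 0 → δ ≤ γ)
    {γ' : Γ} (hb : b ∈ ltZ γ') : a * b ∈ ltZ (γ + γ') := by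
  classical
  intro δ h
  have h1 := AddMonoidAlgebra.support_coeff_mul_subset a b (Finsupp.mem_support_iff.2 h)
  obtain ⟨x, hx, y, hy, rfl⟩ := Finset.mem_add.1 h1
  exact add_lt_add_of_le_of_lt (ha x (Finsupp.mem_support_iff.1 hx))
    (hb y (Finsupp.mem_support_iff.1 hy))

theorem ex_mem_ltZ {γ δ : Γ} (h : δ < γ) : ex δ ∈ ltZ γ := by
  intro δ' h'
  rw [ex, AddMonoidAlgebra.coeff_single, Finsupp.single_apply_ne_zero] at h'
  rw [h'.1]
  exact h

omit [LinearOrder Γ] [IsOrderedAddMonoid Γ] in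
theorem barZ_coeff (a : AddMonoidAlgebra ℤ Γ) (γ : Γ) : (barZ a).coeff γ = a.coeff (-γ) := by
  induction a using AddMonoidAlgebra.induction_linear with
  | zero => simp
  | add a b ha hb => rw [map_add, AddMonoidAlgebra.coeff_add, Finsupp.add_apply, ha, hb]; rfl
  | single δ n =>
    classical
    have : barZ (AddMonoidAlgebra.single δ n) = AddMonoidAlgebra.single (-δ) n := by simp [barZ]
    rw [this, AddMonoidAlgebra.coeff_single, AddMonoidAlgebra.coeff_single, Finsupp.single_apply,
      Finsupp.single_apply]
    congr 1
    exact propext neg_eq_iff_eq_neg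

omit [LinearOrder Γ] [IsOrderedAddMonoid Γ] in
theorem ex_add (γ δ : Γ) : ex (γ + δ) = ex γ * ex δ := by
  simp [ex, AddMonoidAlgebra.single_mul_single]

end Exponents

section KL

variable {B : Type u} {W : Type v} [Group W] {M : CoxeterMatrix B} {cs : CoxeterSystem M W}
variable {Γ : Type w} [AddCommGroup Γ] (φ : SBar cs → Γ)
variable {s t : B} (hD : InfDihedral cs s t)

/-! ## The bar involution and the standard basis -/

theorem bar_smul (a : AddMonoidAlgebra ℤ Γ) (h : Hecke cs φ) :
    bar cs φ (a • h) = barZ a • bar cs φ h := by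
  rw [Algebra.smul_def, map_mul, bar_algebraMap, Algebra.smul_def]

theorem bar_T_simple (i : B) : bar cs φ (T cs φ (cs.simple i)) =
    T cs φ (cs.simple i) - algebraMap _ _ (qpar cs φ i) := by
  rw [bar_T, Tinv_simple]
  rfl

/-- The span of the `T_w` with `ℓ(w) < n`. -/
def lenSpan (n : ℕ) : Submodule (AddMonoidAlgebra ℤ Γ) (Hecke cs φ) :=
  Submodule.span _ (T cs φ '' {w | cs.length w < n})

theorem T_mem_lenSpan {n : ℕ} {w : W} (h : cs.length w < n) : T cs φ w ∈ lenSpan φ n :=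
  Submodule.subset_span ⟨w, h, rfl⟩

theorem lenSpan_mono {m n : ℕ} (h : m ≤ n) : lenSpan (cs := cs) φ m ≤ lenSpan φ n :=
  Submodule.span_mono (Set.image_mono fun _ hw => lt_of_lt_of_le hw h)

theorem T_simple_mul_mem_lenSpan {n : ℕ} (i : B) {h : Hecke cs φ} (hh : h ∈ lenSpan φ n) :
    T cs φ (cs.simple i) * h ∈ lenSpan φ (n + 1) := by
  induction hh using Submodule.span_induction with
  | mem x hx =>
    obtain ⟨w, hw, rfl⟩ := hx
    obtain ⟨c, -, hc⟩ := T_simple_mul cs φ i w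
    rw [hc]
    have h1 := cs.length_mul_le (cs.simple i) w
    rw [cs.length_simple] at h1
    have hw' : cs.length w < n := hw
    exact add_mem (T_mem_lenSpan φ (by omega))
      (Submodule.smul_mem _ _ (T_mem_lenSpan φ (by omega)))
  | zero => rw [mul_zero]; exact zero_mem _
  | add a b _ _ ha hb => rw [mul_add]; exact add_mem ha hb
  | smul r a _ ha => rw [mul_smul_comm]; exact Submodule.smul_mem _ _ ha

/-- Peel off a left descent `i` and use `bar T_i = T_i - q_i`: every correction has smaller length.
This unitriangularity is all that the uniqueness of `C_w` needs. -/
theorem bar_T_sub_mem (w : W) : bar cs φ (T cs φ w) - T cs φ w ∈ lenSpan φ (cs.length w) := by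
  induction hn : cs.length w generalizing w with
  | zero =>
    rw [cs.length_eq_zero_iff.1 hn, T_one, map_one, sub_self]
    exact zero_mem _
  | succ n ih =>
    have hw : w ≠ 1 := by
      rintro rfl
      simp at hn
    obtain ⟨i, hi⟩ := cs.exists_leftDescent_of_ne_one hw
    have hl : cs.length (cs.simple i * w) = n := by
      have := cs.isLeftDescent_iff.1 hi
      omega
    have h1 := T_simple_mul_of_lt cs φ (cs.isLeftDescent_iff_not_isLeftDescent_mul.1 hi)
    rw [cs.simple_mul_simple_cancel_left] at h1
    have h2 := ih _ hl
    have h3 : bar cs φ (T cs φ w) - T cs φ w = T cs φ (cs.simple i) *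
        (bar cs φ (T cs φ (cs.simple i * w)) - T cs φ (cs.simple i * w)) - qpar cs φ i •
        (bar cs φ (T cs φ (cs.simple i * w)) - T cs φ (cs.simple i * w)) -
        qpar cs φ i • T cs φ (cs.simple i * w) := by
      rw [← h1, map_mul, bar_T_simple, sub_mul, ← Algebra.smul_def, mul_sub, smul_sub]
      abel
    rw [h3]
    exact sub_mem (sub_mem (T_simple_mul_mem_lenSpan φ i h2)
      (Submodule.smul_mem _ _ (lenSpan_mono φ (Nat.le_succ n) h2)))
      (Submodule.smul_mem _ _ (T_mem_lenSpan φ (by omega)))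

/-! ## The anti-involution `T_w ↦ T_{w⁻¹}` -/

theorem tau_rel {x y : FreeAlgebra (AddMonoidAlgebra ℤ Γ) W} (h : HeckeRel cs φ x y) :
    FreeAlgebra.lift (AddMonoidAlgebra ℤ Γ) (fun w : W => MulOpposite.op (T cs φ w⁻¹)) x =
      FreeAlgebra.lift (AddMonoidAlgebra ℤ Γ) (fun w : W => MulOpposite.op (T cs φ w⁻¹)) y := by
  cases h with
  | one => rw [FreeAlgebra.lift_ι_apply, map_one, inv_one, T_one, MulOpposite.op_one]
  | mul w w' h =>
    rw [map_mul, FreeAlgebra.lift_ι_apply, FreeAlgebra.lift_ι_apply, FreeAlgebra.lift_ι_apply,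
      ← MulOpposite.op_mul, T_mul, mul_inv_rev]
    rw [← mul_inv_rev, cs.length_inv, cs.length_inv, cs.length_inv, h, add_comm]
  | quad i =>
    rw [map_mul, map_sub, map_add, FreeAlgebra.lift_ι_apply, AlgHom.commutes, AlgHom.commutes,
      map_zero, cs.inv_simple]
    have h1 := T_simple_sq cs φ i
    have h2 : MulOpposite.op (T cs φ (cs.simple i)) * MulOpposite.op (T cs φ (cs.simple i)) =
        1 + (ex (par cs φ i) - ex (-par cs φ i)) • MulOpposite.op (T cs φ (cs.simple i)) := by
      rw [← MulOpposite.op_mul, h1]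
      rfl
    rw [sub_mul, mul_add, mul_add, ← map_mul, ex_mul_ex_neg, map_one, ← Algebra.commutes,
      ← Algebra.smul_def, ← Algebra.smul_def, h2, sub_smul]
    abel

/-- The anti-involution `T_w ↦ T_{w⁻¹}`, as a morphism to the opposite algebra. -/
def tauAlg : RingQuot (HeckeRel cs φ) →ₐ[AddMonoidAlgebra ℤ Γ] (Hecke cs φ)ᵐᵒᵖ :=
  RingQuot.liftAlgHom (AddMonoidAlgebra ℤ Γ)
    ⟨FreeAlgebra.lift (AddMonoidAlgebra ℤ Γ) (fun w : W => MulOpposite.op (T cs φ w⁻¹)),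
      fun _ _ h => tau_rel φ h⟩

/-- The anti-involution `T_w ↦ T_{w⁻¹}` of the Hecke algebra. -/
def tau : Hecke cs φ →ₗ[AddMonoidAlgebra ℤ Γ] Hecke cs φ where
  toFun x := (tauAlg φ x).unop
  map_add' x y := congrArg MulOpposite.unop (map_add (tauAlg φ) x y)
  map_smul' a x := congrArg MulOpposite.unop (map_smul (tauAlg φ) a x)

theorem tau_T (w : W) : tau φ (T cs φ w) = T cs φ w⁻¹ := by
  have h : tauAlg φ (RingQuot.mkAlgHom (AddMonoidAlgebra ℤ Γ) (HeckeRel cs φ)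
      (FreeAlgebra.ι _ w)) = MulOpposite.op (T cs φ w⁻¹) := by
    rw [tauAlg, RingQuot.liftAlgHom_mkAlgHom_apply, FreeAlgebra.lift_ι_apply]
  exact congrArg MulOpposite.unop h

theorem tau_mul (x y : Hecke cs φ) : tau φ (x * y) = tau φ y * tau φ x :=
  congrArg MulOpposite.unop (map_mul (tauAlg φ) x y)

theorem tau_one : tau φ (1 : Hecke cs φ) = 1 :=
  congrArg MulOpposite.unop (map_one (tauAlg φ))

theorem induction_T {p : Hecke cs φ → Prop} (h : Hecke cs φ) (hT : ∀ w, p (T cs φ w))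
    (h0 : p 0) (hadd : ∀ x y, p x → p y → p (x + y))
    (hsmul : ∀ (a : AddMonoidAlgebra ℤ Γ) x, p x → p (a • x)) : p h := by
  have hh : h ∈ Submodule.span (AddMonoidAlgebra ℤ Γ) (Set.range (T cs φ)) := by
    rw [span_T]
    trivial
  induction hh using Submodule.span_induction with
  | mem x hx =>
    obtain ⟨w, rfl⟩ := hx
    exact hT w
  | zero => exact h0
  | add a b _ _ ha hb => exact hadd a b ha hb
  | smul r a _ ha => exact hsmul r a ha

theorem tau_tau (h : Hecke cs φ) : tau φ (tau φ h) = h := by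
  induction h using induction_T with
  | hT w => rw [tau_T, tau_T, inv_inv]
  | h0 => rw [map_zero, map_zero]
  | hadd x y hx hy => rw [map_add, map_add, hx, hy]
  | hsmul a x hx => rw [map_smul, map_smul, hx]

theorem bar_tau (h : Hecke cs φ) : bar cs φ (tau φ h) = tau φ (bar cs φ h) := by
  induction h using induction_T with
  | hT w =>
    rw [tau_T, bar_T, bar_T]
    refine Tinv_eq cs φ ?_
    rw [← tau_T, ← tau_mul, T_mul_Tinv, tau_one]
  | h0 => rw [map_zero, map_zero, map_zero]
  | hadd x y hx hy => rw [map_add, map_add, map_add, map_add, hx, hy]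
  | hsmul a x hx => rw [map_smul, bar_smul, bar_smul, map_smul, hx]

end KL

/-! ## The Kazhdan-Lusztig basis -/

section KLBasis

variable {B : Type u} {W : Type v} [Group W] {M : CoxeterMatrix B} {cs : CoxeterSystem M W}
variable {Γ : Type w} [AddCommGroup Γ] [LinearOrder Γ] [IsOrderedAddMonoid Γ] (φ : SBar cs → Γ)
variable {s t : B} (hD : InfDihedral cs s t)

theorem smul_T_mem_heckeNeg {γ : Γ} (h : γ < 0) (w : W) : ex γ • T cs φ w ∈ heckeNeg cs φ :=
  AddSubgroup.subset_closure ⟨γ, h, w, rfl⟩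

theorem repr_mem_of_heckeNeg {h : Hecke cs φ} (hh : h ∈ heckeNeg cs φ) (w : W) :
    (stdBasis φ hD).repr h w ∈ ltZ (0 : Γ) := by
  classical
  induction hh using AddSubgroup.closure_induction with
  | mem x hx =>
    obtain ⟨γ, hγ, y, rfl⟩ := hx
    rw [map_smul, stdBasis_repr_T, Finsupp.smul_apply, Finsupp.single_apply]
    split_ifs
    · rw [smul_eq_mul, mul_one]
      exact ex_mem_ltZ hγ
    · rw [smul_zero]
      exact zero_mem _
  | zero => rw [map_zero]; exact zero_mem _
  | add x y _ _ hx hy => rw [map_add]; exact add_mem hx hy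
  | neg x _ hx => rw [map_neg]; exact neg_mem hx

theorem tau_mem_heckeNeg {h : Hecke cs φ} (hh : h ∈ heckeNeg cs φ) : tau φ h ∈ heckeNeg cs φ := by
  induction hh using AddSubgroup.closure_induction with
  | mem x hx =>
    obtain ⟨δ, hδ, y, rfl⟩ := hx
    rw [map_smul, tau_T]
    exact smul_T_mem_heckeNeg φ hδ _
  | zero => rw [map_zero]; exact zero_mem _
  | add x y _ _ hx hy => rw [map_add]; exact add_mem hx hy
  | neg x _ hx => rw [map_neg]; exact neg_mem hx

include hD

theorem repr_eq_zero_of_lenSpan {n : ℕ} {h : Hecke cs φ} (hh : h ∈ lenSpan φ n) {w : W}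
    (hw : n ≤ cs.length w) : (stdBasis φ hD).repr h w = 0 := by
  induction hh using Submodule.span_induction with
  | mem x hx =>
    obtain ⟨y, hy, rfl⟩ := hx
    rw [stdBasis_repr_T, Finsupp.single_eq_of_ne]
    rintro rfl
    exact absurd hy (not_lt.2 hw)
  | zero => rw [map_zero]; rfl
  | add a b _ _ ha hb => rw [map_add, Finsupp.add_apply, ha, hb, add_zero]
  | smul r a _ ha => rw [map_smul, Finsupp.smul_apply, ha, smul_zero]

/-- At an element of maximal length in the support, unitriangularity makes the coefficient invariant
under `e^γ ↦ e^{-γ}`, whereas all its exponents are negative. -/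
theorem eq_zero_of_bar_eq {h : Hecke cs φ} (hb : bar cs φ h = h) (hn : h ∈ heckeNeg cs φ) :
    h = 0 := by
  by_contra h0
  set r := (stdBasis φ hD).repr h with hr
  have hr0 : r ≠ 0 := fun h' => h0 ((stdBasis φ hD).repr.map_eq_zero_iff.1 h')
  obtain ⟨w, hw, hmax⟩ := r.support.exists_max_image cs.length
    (Finsupp.support_nonempty_iff.2 hr0)
  have hsum : h = r.sum fun y a => a • T cs φ y := by
    conv_lhs => rw [← (stdBasis φ hD).linearCombination_repr h]
    simp only [Finsupp.linearCombination_apply, stdBasis_apply]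
    rfl
  have h1 : (stdBasis φ hD).repr (bar cs φ h) w = barZ (r w) := by
    have h2 : bar cs φ h = r.sum fun y a => barZ a • bar cs φ (T cs φ y) := by
      conv_lhs => rw [hsum]
      rw [Finsupp.sum, map_sum]
      exact Finset.sum_congr rfl fun y _ => bar_smul φ _ _
    rw [h2, Finsupp.sum, map_sum, Finsupp.finsetSum_apply, Finset.sum_eq_single w]
    · have h3 := repr_eq_zero_of_lenSpan φ hD (bar_T_sub_mem φ w) le_rfl
      rw [map_sub, Finsupp.sub_apply, stdBasis_repr_T, Finsupp.single_eq_same, sub_eq_zero] at h3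
      rw [map_smul, Finsupp.smul_apply, h3, smul_eq_mul, mul_one]
    · intro y hy hyw
      have h3 := repr_eq_zero_of_lenSpan φ hD (bar_T_sub_mem φ y) (hmax y hy)
      rw [map_sub, Finsupp.sub_apply, stdBasis_repr_T, Finsupp.single_eq_of_ne (Ne.symm hyw),
        sub_zero] at h3
      rw [map_smul, Finsupp.smul_apply, h3, smul_zero]
    · exact fun h' => absurd hw h'
  rw [hb] at h1
  have h2 := repr_mem_of_heckeNeg φ hD hn w
  have h3 : (r w).coeff ≠ 0 := fun h' =>
    Finsupp.mem_support_iff.1 hw (AddMonoidAlgebra.coeff_eq_zero.1 h')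
  obtain ⟨γ, hγ⟩ := Finsupp.ne_iff.1 h3
  have h4 := h2 γ hγ
  have h5 : (r w).coeff (-γ) ≠ 0 := by
    rw [← hr] at h1
    rw [h1, barZ_coeff, neg_neg]
    exact hγ
  exact absurd h4 (not_lt.2 (neg_neg_iff_pos.1 (h2 _ h5)).le)

theorem IsKL.unique {w : W} {c c' : Hecke cs φ} (h : IsKL cs φ w c) (h' : IsKL cs φ w c') :
    c = c' := by
  refine sub_eq_zero.1 (eq_zero_of_bar_eq φ hD ?_ ?_)
  · rw [map_sub, h.1, h'.1]
  · have := sub_mem h.2 h'.2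
    rwa [sub_sub_sub_cancel_right] at this

theorem IsKL.klBasis_eq {w : W} {c : Hecke cs φ} (h : IsKL cs φ w c) : klBasis cs φ w = c :=
  IsKL.unique φ hD (Classical.epsilon_spec (p := IsKL cs φ w) ⟨c, h⟩) h

omit hD in
theorem IsKL.tau {w : W} {c : Hecke cs φ} (h : IsKL cs φ w c) : IsKL cs φ w⁻¹ (tau φ c) := by
  refine ⟨by rw [bar_tau, h.1], ?_⟩
  rw [← tau_T, ← map_sub]
  exact tau_mem_heckeNeg φ h.2

variable (hex : ∀ w : W, ∃ c, IsKL cs φ w c)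

include hex

omit hD in
theorem isKL_klBasis (w : W) : IsKL cs φ w (klBasis cs φ w) := Classical.epsilon_spec (hex w)

theorem tau_klBasis (w : W) : tau φ (klBasis cs φ w) = klBasis cs φ w⁻¹ :=
  (IsKL.klBasis_eq φ hD (IsKL.tau φ (isKL_klBasis φ hex w))).symm

theorem linearIndependent_klBasis : LinearIndependent (AddMonoidAlgebra ℤ Γ) (klBasis cs φ) := by
  classical
  rw [linearIndependent_iff]
  intro r hr
  by_contra h0
  let S : Finset (W × Γ) := r.support.sigma (fun w => (r w).coeff.support) |>.image
    fun p => (p.1, p.2)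
  have hS : ∀ w γ, (r w).coeff γ ≠ 0 ↔ (w, γ) ∈ S := by
    intro w γ
    simp only [S, Finset.mem_image, Finset.mem_sigma, Finsupp.mem_support_iff, Sigma.exists,
      Prod.mk.injEq]
    constructor
    · intro h
      exact ⟨w, γ, ⟨fun h' => h (by rw [h']; rfl), h⟩, rfl, rfl⟩
    · rintro ⟨a, b, h, rfl, rfl⟩
      exact h.2
  have hne : S.Nonempty := by
    obtain ⟨w, hw⟩ := Finsupp.ne_iff.1 h0
    have h3 : (r w).coeff ≠ 0 := fun h' => hw (AddMonoidAlgebra.coeff_eq_zero.1 h')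
    obtain ⟨γ, hγ⟩ := Finsupp.ne_iff.1 h3
    exact ⟨(w, γ), (hS w γ).1 hγ⟩
  -- Here `γ` is the largest exponent occurring in any coefficient. Passing from `T_y` to `C_y` only
  -- adds terms with exponents `< γ`, so the monomial at `(w, γ)` cannot cancel; no order on `W` is
  -- involved.
  obtain ⟨⟨w, γ⟩, hwS, hmax⟩ := S.exists_max_image Prod.snd hne
  have h1 : (stdBasis φ hD).repr (Finsupp.linearCombination _ (klBasis cs φ) r) w - r w ∈
      ltZ γ := by
    have h2 : Finsupp.linearCombination _ (klBasis cs φ) r =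
        Finsupp.linearCombination _ (T cs φ) r +
          r.sum fun y a => a • (klBasis cs φ y - T cs φ y) := by
      rw [Finsupp.linearCombination_apply, Finsupp.linearCombination_apply, ← Finsupp.sum_add]
      exact Finsupp.sum_congr fun y _ => by rw [smul_sub, add_sub_cancel]
    have h3 : (stdBasis φ hD).repr (Finsupp.linearCombination _ (T cs φ) r) = r := by
      have : T cs φ = stdBasis φ hD := funext fun y => (stdBasis_apply φ hD y).symm
      rw [this, (stdBasis φ hD).repr_linearCombination]
    rw [h2, map_add, h3, Finsupp.add_apply, add_sub_cancel_left, Finsupp.sum, map_sum,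
      Finsupp.finsetSum_apply]
    refine sum_mem fun y _ => ?_
    rw [map_smul, Finsupp.smul_apply, smul_eq_mul, ← add_zero γ]
    exact mul_mem_ltZ (fun δ hδ => hmax (y, δ) ((hS y δ).1 hδ))
      (repr_mem_of_heckeNeg φ hD (isKL_klBasis φ hex y).2 w)
  rw [hr, map_zero, Finsupp.zero_apply, zero_sub, neg_mem_iff] at h1
  exact lt_irrefl _ (h1 γ ((hS w γ).2 hwS))

variable (hsp : Submodule.span (AddMonoidAlgebra ℤ Γ) (Set.range (klBasis cs φ)) = ⊤)

/-- The Kazhdan-Lusztig basis. -/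
def klB : Module.Basis W (AddMonoidAlgebra ℤ Γ) (Hecke cs φ) :=
  Module.Basis.mk (linearIndependent_klBasis φ hD hex) hsp.ge

theorem klB_apply (w : W) : klB φ hD hex hsp w = klBasis cs φ w := Module.Basis.mk_apply _ _ _

theorem occurs_iff (x : W) (h : Hecke cs φ) :
    Occurs cs φ x h ↔ (klB φ hD hex hsp).repr h x ≠ 0 := by
  have hb : ⇑(klB φ hD hex hsp) = klBasis cs φ := funext (klB_apply φ hD hex hsp)
  constructor
  · rintro ⟨c, rfl, hc⟩
    have := (klB φ hD hex hsp).repr_linearCombination c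
    rw [hb, Finsupp.linearCombination_apply] at this
    rwa [this]
  · intro hx
    refine ⟨(klB φ hD hex hsp).repr h, ?_, hx⟩
    have := (klB φ hD hex hsp).linearCombination_repr h
    rw [hb, Finsupp.linearCombination_apply] at this
    exact this.symm

end KLBasis

/-! ## Cells and lower sets -/

section Cells

variable {B : Type u} {W : Type v} [Group W] {M : CoxeterMatrix B} {cs : CoxeterSystem M W}
variable {Γ : Type w} [AddCommGroup Γ] [LinearOrder Γ] [IsOrderedAddMonoid Γ] {φ : SBar cs → Γ}

/-- The Kazhdan-Lusztig elements exist and span the Hecke algebra. -/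
structure KLSystem (φ : SBar cs → Γ) (s t : B) : Prop where
  dih : InfDihedral cs s t
  ex : ∀ w : W, ∃ c, IsKL cs φ w c
  span : Submodule.span (AddMonoidAlgebra ℤ Γ) (Set.range (klBasis cs φ)) = ⊤

/-- The span of the `C_w`, `w ∈ D`. -/
def klSpan (φ : SBar cs → Γ) (D : Set W) : Submodule (AddMonoidAlgebra ℤ Γ) (Hecke cs φ) :=
  Submodule.span _ (klBasis cs φ '' D)

theorem klBasis_mem_klSpan {D : Set W} {w : W} (h : w ∈ D) : klBasis cs φ w ∈ klSpan φ D :=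
  Submodule.subset_span ⟨w, h, rfl⟩

theorem klSpan_mono {D D' : Set W} (h : D ⊆ D') : klSpan φ D ≤ klSpan φ D' :=
  Submodule.span_mono (Set.image_mono h)

/-- The sets stable under the elementary relation `x ← y`. -/
def Lower (φ : SBar cs → Γ) (σ : Side) (D : Set W) : Prop :=
  ∀ x y, Arrow cs φ σ x y → y ∈ D → x ∈ D

theorem Lower.mem_of_cellLE {σ : Side} {D : Set W} (hD : Lower φ σ D) {x y : W}
    (h : CellLE cs φ σ x y) (hy : y ∈ D) : x ∈ D := by
  induction h using Relation.TransGen.head_induction_on with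
  | single h => exact hD _ _ h hy
  | head h _ ih => exact hD _ _ h ih

theorem Lower.mem_iff_of_cellEquiv {σ : Side} {D : Set W} (hD : Lower φ σ D) {x y : W}
    (h : CellEquiv cs φ σ x y) : x ∈ D ↔ y ∈ D :=
  ⟨hD.mem_of_cellLE h.2, hD.mem_of_cellLE h.1⟩

theorem Lower.union {σ : Side} {D D' : Set W} (h : Lower φ σ D) (h' : Lower φ σ D') :
    Lower φ σ (D ∪ D') := fun x y hxy hy => hy.imp (h x y hxy) (h' x y hxy)

theorem lower_univ (σ : Side) : Lower φ σ Set.univ := fun _ _ _ _ => trivial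

theorem lower_empty (σ : Side) : Lower φ σ ∅ := fun _ _ _ h => h

theorem lower_setOf_cellLE (σ : Side) (C : Set W) :
    Lower φ σ {w | ∃ c ∈ C, CellLE cs φ σ w c} := by
  rintro x y hxy ⟨c, hc, hyc⟩
  exact ⟨c, hc, Relation.TransGen.head hxy hyc⟩

theorem IsCell.lower_diff {σ : Side} {C : Set W} (hC : IsCell cs φ σ C) :
    Lower φ σ {w | (∃ c ∈ C, CellLE cs φ σ w c) ∧ w ∉ C} := by
  obtain ⟨w₀, rfl⟩ := hC
  rintro x y hxy ⟨⟨c, hc, hyc⟩, hy⟩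
  refine ⟨⟨c, hc, Relation.TransGen.head hxy hyc⟩, fun hx => hy ⟨?_, ?_⟩⟩
  · exact Relation.TransGen.trans hyc hc.1
  · exact Relation.TransGen.trans hx.2 (Relation.TransGen.single hxy)

theorem CellLE.trans {σ : Side} {x y z : W} (h : CellLE cs φ σ x y) (h' : CellLE cs φ σ y z) :
    CellLE cs φ σ x z := Relation.TransGen.trans h h'

theorem CellEquiv.symm {σ : Side} {x y : W} (h : CellEquiv cs φ σ x y) :
    CellEquiv cs φ σ y x := ⟨h.2, h.1⟩

theorem CellEquiv.trans {σ : Side} {x y z : W} (h : CellEquiv cs φ σ x y)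
    (h' : CellEquiv cs φ σ y z) : CellEquiv cs φ σ x z :=
  ⟨h.1.trans h'.1, h'.2.trans h.2⟩

theorem CellLE.left_to_both {x y : W} (h : CellLE cs φ .L x y) : CellLE cs φ .LR x y := by
  refine Relation.TransGen.mono (fun a b => ?_) _ _ h
  rintro ⟨h, h1 | h1⟩
  · exact ⟨h, Or.inl ⟨trivial, h1.2⟩⟩
  · exact absurd h1.1 id

theorem CellLE.right_to_both {x y : W} (h : CellLE cs φ .R x y) : CellLE cs φ .LR x y := by
  refine Relation.TransGen.mono (fun a b => ?_) _ _ h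
  rintro ⟨h, h1 | h1⟩
  · exact absurd h1.1 id
  · exact ⟨h, Or.inr ⟨trivial, h1.2⟩⟩

theorem lower_both {D : Set W} (h : Lower φ .L D) (h' : Lower φ .R D) : Lower φ .LR D := by
  rintro x y ⟨a, h1 | h1⟩ hy
  · exact h x y ⟨a, Or.inl ⟨trivial, h1.2⟩⟩ hy
  · exact h' x y ⟨a, Or.inr ⟨trivial, h1.2⟩⟩ hy

namespace KLSystem

variable {s t : B} (K : KLSystem φ s t)
include K

/-- The Kazhdan-Lusztig basis. -/
abbrev basis : Module.Basis W (AddMonoidAlgebra ℤ Γ) (Hecke cs φ) :=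
  klB φ K.dih K.ex K.span

theorem coe_basis : ⇑K.basis = klBasis cs φ := funext (klB_apply φ K.dih K.ex K.span)

theorem repr_klBasis (w : W) : K.basis.repr (klBasis cs φ w) = Finsupp.single w 1 := by
  rw [← K.coe_basis, Module.Basis.repr_self]

theorem mem_klSpan {D : Set W} {h : Hecke cs φ} :
    h ∈ klSpan φ D ↔ ∀ x, K.basis.repr h x ≠ 0 → x ∈ D := by
  rw [klSpan, ← K.coe_basis, Module.Basis.mem_span_image]
  exact ⟨fun h' x hx => h' (Finsupp.mem_support_iff.2 hx),
    fun h' x hx => h' x (Finsupp.mem_support_iff.1 hx)⟩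

theorem klSpan_univ : klSpan φ (Set.univ : Set W) = ⊤ := by
  rw [klSpan, Set.image_univ, K.span]

theorem klSpan_induction {D : Set W} {p : Hecke cs φ → Prop} (h0 : p 0)
    (hkl : ∀ w ∈ D, p (klBasis cs φ w)) (hadd : ∀ x y, p x → p y → p (x + y))
    (hsmul : ∀ (a : AddMonoidAlgebra ℤ Γ) x, p x → p (a • x)) {h : Hecke cs φ}
    (hh : h ∈ klSpan φ D) : p h := by
  induction hh using Submodule.span_induction with
  | mem x hx =>
    obtain ⟨w, hw, rfl⟩ := hx
    exact hkl w hw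
  | zero => exact h0
  | add a b _ _ ha hb => exact hadd a b ha hb
  | smul r a _ ha => exact hsmul r a ha

theorem arrow_left_iff {x y : W} :
    Arrow cs φ .L x y ↔ ∃ h, K.basis.repr (h * klBasis cs φ y) x ≠ 0 := by
  refine exists_congr fun h => ?_
  rw [occurs_iff φ K.dih K.ex K.span]
  constructor
  · rintro (h | h)
    · exact h.2
    · exact absurd h.1 id
  · exact fun h => Or.inl ⟨trivial, h⟩

theorem arrow_right_iff {x y : W} :
    Arrow cs φ .R x y ↔ ∃ h, K.basis.repr (klBasis cs φ y * h) x ≠ 0 := by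
  refine exists_congr fun h => ?_
  rw [occurs_iff φ K.dih K.ex K.span, occurs_iff φ K.dih K.ex K.span]
  constructor
  · rintro (h | h)
    · exact absurd h.1 id
    · exact h.2
  · exact fun h => Or.inr ⟨trivial, h⟩

theorem arrow_of_mul_eq {x y : W} (h : Hecke cs φ) (hh : h * klBasis cs φ y = klBasis cs φ x) :
    Arrow cs φ .L x y :=
  K.arrow_left_iff.2 ⟨h, by rw [hh, K.repr_klBasis, Finsupp.single_eq_same]; exact one_ne_zero⟩

theorem cellLE_refl (σ : Side) (x : W) : CellLE cs φ σ x x := by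
  have h : (K.basis.repr (klBasis cs φ x)) x ≠ 0 := by
    rw [K.repr_klBasis, Finsupp.single_eq_same]
    exact one_ne_zero
  refine Relation.TransGen.single ⟨1, ?_⟩
  rw [occurs_iff φ K.dih K.ex K.span, occurs_iff φ K.dih K.ex K.span, one_mul, mul_one]
  cases σ
  · exact Or.inl ⟨trivial, h⟩
  · exact Or.inr ⟨trivial, h⟩
  · exact Or.inl ⟨trivial, h⟩

theorem cellEquiv_refl (σ : Side) (x : W) : CellEquiv cs φ σ x x :=
  ⟨K.cellLE_refl σ x, K.cellLE_refl σ x⟩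

theorem lower_left_iff {D : Set W} :
    Lower φ .L D ↔ ∀ h, ∀ x ∈ klSpan φ D, h * x ∈ klSpan φ D := by
  constructor
  · intro hD h x hx
    refine K.klSpan_induction (p := fun x => h * x ∈ klSpan φ D) ?_ ?_ ?_ ?_ hx
    · rw [mul_zero]
      exact zero_mem _
    · exact fun w hw => K.mem_klSpan.2 fun x hx => hD x w (K.arrow_left_iff.2 ⟨h, hx⟩) hw
    · intro x y hx hy
      rw [mul_add]
      exact add_mem hx hy
    · intro a x hx
      rw [mul_smul_comm]
      exact Submodule.smul_mem _ _ hx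
  · intro hD x y hxy hy
    obtain ⟨h, hh⟩ := K.arrow_left_iff.1 hxy
    exact K.mem_klSpan.1 (hD h _ (klBasis_mem_klSpan hy)) x hh

/-! ### Left and right -/

theorem tau_basis_repr (h : Hecke cs φ) (x : W) :
    K.basis.repr (tau φ h) x = K.basis.repr h x⁻¹ := by
  have hh : h ∈ klSpan φ (Set.univ : Set W) := by
    rw [K.klSpan_univ]
    trivial
  refine K.klSpan_induction (p := fun h => K.basis.repr (tau φ h) x = K.basis.repr h x⁻¹)
    ?_ ?_ ?_ ?_ hh
  · rw [map_zero, map_zero]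
    rfl
  · classical
    intro w _
    rw [tau_klBasis φ K.dih K.ex, K.repr_klBasis, K.repr_klBasis, Finsupp.single_apply,
      Finsupp.single_apply]
    congr 1
    exact propext inv_eq_iff_eq_inv
  · intro a b ha hb
    rw [map_add, map_add, map_add, Finsupp.add_apply, Finsupp.add_apply, ha, hb]
  · intro a b hb
    rw [map_smul, map_smul, map_smul, Finsupp.smul_apply, Finsupp.smul_apply, hb]

/-- The anti-involution `tau` sends `C_w` to `C_{w⁻¹}` and reverses products, so the right-hand
theory is the left-hand one transported by inversion. -/
theorem arrow_inv_iff {x y : W} : Arrow cs φ .R x y ↔ Arrow cs φ .L x⁻¹ y⁻¹ := by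
  rw [K.arrow_left_iff, K.arrow_right_iff]
  constructor
  · rintro ⟨h, hh⟩
    refine ⟨tau φ h, ?_⟩
    rwa [← tau_klBasis φ K.dih K.ex, ← tau_mul, K.tau_basis_repr, inv_inv]
  · rintro ⟨h, hh⟩
    refine ⟨tau φ h, ?_⟩
    rwa [← tau_tau φ h, ← tau_klBasis φ K.dih K.ex, ← tau_mul, K.tau_basis_repr, inv_inv] at hh

theorem lower_inv_iff {D : Set W} : Lower φ .R D ↔ Lower φ .L (D⁻¹) := by
  constructor
  · intro h x y hxy hy
    exact h _ _ (K.arrow_inv_iff.2 (by rwa [inv_inv, inv_inv])) hy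
  · intro h x y hxy hy
    have := h x⁻¹ y⁻¹ (K.arrow_inv_iff.1 hxy) (by simpa using hy)
    simpa using this

theorem cellLE_inv_iff {x y : W} : CellLE cs φ .R x y ↔ CellLE cs φ .L x⁻¹ y⁻¹ := by
  constructor
  · intro h
    induction h with
    | single h => exact Relation.TransGen.single (K.arrow_inv_iff.1 h)
    | tail _ h ih => exact Relation.TransGen.tail ih (K.arrow_inv_iff.1 h)
  · intro h
    have : ∀ a b, CellLE cs φ .L a b → CellLE cs φ .R a⁻¹ b⁻¹ := by
      intro a b h
      induction h with
      | single h =>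
        exact Relation.TransGen.single (K.arrow_inv_iff.2 (by rwa [inv_inv, inv_inv]))
      | tail _ h ih =>
        exact Relation.TransGen.tail ih (K.arrow_inv_iff.2 (by rwa [inv_inv, inv_inv]))
    simpa using this _ _ h

theorem cellEquiv_inv_iff {x y : W} : CellEquiv cs φ .R x y ↔ CellEquiv cs φ .L x⁻¹ y⁻¹ :=
  and_congr K.cellLE_inv_iff K.cellLE_inv_iff

/-! ### Simple reflections with zero parameter -/

omit K in
theorem T_simple_mul_mem_heckeNeg {i : B} (hi : par cs φ i = 0) {h : Hecke cs φ}
    (hh : h ∈ heckeNeg cs φ) : T cs φ (cs.simple i) * h ∈ heckeNeg cs φ := by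
  induction hh using AddSubgroup.closure_induction with
  | mem x hx =>
    obtain ⟨γ, hγ, w, rfl⟩ := hx
    obtain ⟨c, hc, h⟩ := T_simple_mul cs φ i w
    have hc0 : c = 0 := by
      rcases hc with h | h
      · exact h
      · rw [h, qpar, hi, neg_zero, sub_self]
    rw [mul_smul_comm, h, hc0, zero_smul, add_zero]
    exact smul_T_mem_heckeNeg φ hγ _
  | zero => rw [mul_zero]; exact zero_mem _
  | add x y _ _ hx hy => rw [mul_add]; exact add_mem hx hy
  | neg x _ hx => rw [mul_neg]; exact neg_mem hx

omit K in
theorem isKL_simple_mul {i : B} (hi : par cs φ i = 0) {w : W} {c : Hecke cs φ}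
    (h : IsKL cs φ w c) : IsKL cs φ (cs.simple i * w) (T cs φ (cs.simple i) * c) := by
  constructor
  · rw [map_mul, h.1, bar_T_simple, qpar, hi, neg_zero, sub_self, map_zero, sub_zero]
  · obtain ⟨a, ha, h1⟩ := T_simple_mul cs φ i w
    have ha0 : a = 0 := by
      rcases ha with h | h
      · exact h
      · rw [h, qpar, hi, neg_zero, sub_self]
    rw [ha0, zero_smul, add_zero] at h1
    rw [← h1, ← mul_sub]
    exact T_simple_mul_mem_heckeNeg hi h.2

/-- When the parameter of `i` vanishes, `T_i` is fixed by the bar involution and permutes the `T_w`,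
so `T_i C_w` has the characteristic properties of a Kazhdan-Lusztig element. This is the source of
the stability of cells under translation. -/
theorem klBasis_simple_mul {i : B} (hi : par cs φ i = 0) (w : W) :
    T cs φ (cs.simple i) * klBasis cs φ w = klBasis cs φ (cs.simple i * w) :=
  (IsKL.klBasis_eq φ K.dih (isKL_simple_mul hi (isKL_klBasis φ K.ex w))).symm

theorem cellEquiv_simple_mul {i : B} (hi : par cs φ i = 0) (w : W) :
    CellEquiv cs φ .L (cs.simple i * w) w := by
  have h : ∀ w, CellLE cs φ .L (cs.simple i * w) w := fun w =>
    Relation.TransGen.single (K.arrow_of_mul_eq _ (K.klBasis_simple_mul hi w))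
  refine ⟨h w, ?_⟩
  have := h (cs.simple i * w)
  rwa [cs.simple_mul_simple_cancel_left] at this

/-! ### The ideals of lower sets -/

theorem isIdealOf_klSpan {σ : Side} {D : Set W} (hD : Lower φ σ D) :
    IsIdealOf cs φ σ (klSpan φ D) := by
  have key : ∀ D : Set W, Lower φ .R D → ∀ h x, x ∈ klSpan φ D → x * h ∈ klSpan φ D := by
    intro D hD h x hx
    refine K.klSpan_induction (p := fun x => x * h ∈ klSpan φ D) ?_ ?_ ?_ ?_ hx
    · rw [zero_mul]
      exact zero_mem _
    · exact fun w hw => K.mem_klSpan.2 fun x hx => hD x w (K.arrow_right_iff.2 ⟨h, hx⟩) hw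
    · intro x y hx hy
      rw [add_mul]
      exact add_mem hx hy
    · intro a x hx
      rw [smul_mul_assoc]
      exact Submodule.smul_mem _ _ hx
  cases σ
  · exact ⟨fun _ => K.lower_left_iff.1 hD, fun h => absurd h id⟩
  · exact ⟨fun h => absurd h id, fun _ => key D hD⟩
  · refine ⟨fun _ => K.lower_left_iff.1 ?_, fun _ => key D ?_⟩
    · rintro x y ⟨h, h1 | h1⟩ hy
      · exact hD x y ⟨h, Or.inl ⟨trivial, h1.2⟩⟩ hy
      · exact absurd h1.1 id
    · rintro x y ⟨h, h1 | h1⟩ hy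
      · exact absurd h1.1 id
      · exact hD x y ⟨h, Or.inr ⟨trivial, h1.2⟩⟩ hy

theorem idealSpan_eq {σ : Side} {D : Set W} (hD : Lower φ σ D) :
    idealSpan cs φ σ {h | ∃ w, w ∈ D ∧ h = klBasis cs φ w} = klSpan φ D := by
  refine le_antisymm (sInf_le ⟨K.isIdealOf_klSpan hD, ?_⟩) (le_sInf fun I hI => ?_)
  · rintro _ ⟨w, hw, rfl⟩
    exact klBasis_mem_klSpan hw
  · refine Submodule.span_le.2 ?_
    rintro _ ⟨w, hw, rfl⟩
    exact hI.2 ⟨w, hw, rfl⟩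

theorem idealLE_eq (σ : Side) (C : Set W) :
    idealLE cs φ σ C = klSpan φ {w | ∃ c ∈ C, CellLE cs φ σ w c} :=
  K.idealSpan_eq (lower_setOf_cellLE σ C)

theorem idealLT_eq {σ : Side} {C : Set W} (hC : IsCell cs φ σ C) :
    idealLT cs φ σ C = klSpan φ {w | (∃ c ∈ C, CellLE cs φ σ w c) ∧ w ∉ C} :=
  K.idealSpan_eq hC.lower_diff

end KLSystem

end Cells

/-! ## Normalisation of the signs of the parameters -/

section Normalised

variable {B : Type u} {W : Type v} [Group W] {M : CoxeterMatrix B} {cs : CoxeterSystem M W}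
variable {Γ : Type w} [AddCommGroup Γ] (φ : SBar cs → Γ) (ε : W →* ℤˣ)

/-- The parameter of a simple reflection, multiplied by a sign. -/
def npar (i : B) : Γ := ((ε (cs.simple i) : ℤˣ) : ℤ) • par cs φ i

/-- The coefficient of the quadratic relation of `npar`. -/
def nq (i : B) : AddMonoidAlgebra ℤ Γ := ex (npar φ ε i) - ex (-npar φ ε i)

/-- The standard basis element, multiplied by a sign. -/
def TN (w : W) : Hecke cs φ := ((ε w : ℤˣ) : ℤ) • T cs φ w

theorem units_cases (u : ℤˣ) : (u : ℤ) = 1 ∨ (u : ℤ) = -1 := by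
  rcases Int.units_eq_one_or u with rfl | rfl
  · exact Or.inl rfl
  · exact Or.inr rfl

theorem smul_smul_units {A : Type*} [AddCommGroup A] (u : ℤˣ) (x : A) :
    (u : ℤ) • ((u : ℤ) • x) = x := by
  rcases units_cases u with h | h <;> rw [h] <;> simp

theorem nq_eq (i : B) : nq φ ε i = ((ε (cs.simple i) : ℤˣ) : ℤ) • qpar cs φ i := by
  rw [nq, npar, qpar]
  rcases units_cases (ε (cs.simple i)) with h | h <;> rw [h]
  · rw [one_smul, one_smul]
  · rw [neg_smul, one_smul, neg_neg, neg_smul, one_smul, neg_sub]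

theorem TN_one : TN φ ε (1 : W) = (1 : Hecke cs φ) := by
  rw [TN, map_one, T_one, Units.val_one, one_smul]

theorem TN_mul {w w' : W} (h : cs.length (w * w') = cs.length w + cs.length w') :
    TN φ ε w * TN φ ε w' = TN φ ε (w * w') := by
  rw [TN, TN, TN, smul_mul_smul_comm, T_mul cs φ _ _ h, map_mul, Units.val_mul]

/-- Changing the sign of `T_i` turns the roots `e^a`, `-e^{-a}` of its quadratic relation into
`-e^a`, `e^{-a}`, which are the roots for the parameter `-a`. -/
theorem TN_simple_sq (i : B) : TN φ ε (cs.simple i) * TN φ ε (cs.simple i) =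
    1 + nq φ ε i • TN φ ε (cs.simple i) := by
  rw [nq_eq, TN, smul_mul_smul_comm, T_simple_sq, smul_assoc, smul_comm (qpar cs φ i),
    smul_smul_units]
  rcases units_cases (ε (cs.simple i)) with h | h <;> rw [h] <;> simp [qpar]

theorem bar_TN_simple (i : B) : bar cs φ (TN φ ε (cs.simple i)) =
    TN φ ε (cs.simple i) - nq φ ε i • 1 := by
  rw [nq_eq, TN, map_zsmul, bar_T_simple, smul_sub, Algebra.algebraMap_eq_smul_one, smul_assoc]

theorem TN_simple_mul (i : B) (w : W) : ∃ c : AddMonoidAlgebra ℤ Γ, (c = 0 ∨ c = nq φ ε i) ∧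
    TN φ ε (cs.simple i) * TN φ ε w = TN φ ε (cs.simple i * w) + c • TN φ ε w := by
  obtain ⟨c, hc, h⟩ := T_simple_mul cs φ i w
  refine ⟨((ε (cs.simple i) : ℤˣ) : ℤ) • c, ?_, ?_⟩
  · rcases hc with rfl | rfl
    · exact Or.inl (smul_zero _)
    · exact Or.inr (nq_eq φ ε i).symm
  · rw [TN, TN, TN, smul_mul_smul_comm, h, smul_add, map_mul, Units.val_mul, smul_assoc,
      smul_comm c, smul_smul]

theorem tau_TN (w : W) : tau φ (TN φ ε w) = TN φ ε w⁻¹ := by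
  have h : ε w⁻¹ = ε w := by
    rw [map_inv, Int.units_inv_eq_self]
  rw [TN, TN, map_zsmul, tau_T, h]

/-- A submodule stable by left multiplication by the `TN_s` is a left ideal. -/
theorem mul_mem_of_TN_simple (I : Submodule (AddMonoidAlgebra ℤ Γ) (Hecke cs φ))
    (h : ∀ i, ∀ x ∈ I, TN φ ε (cs.simple i) * x ∈ I) (a x : Hecke cs φ) (hx : x ∈ I) :
    a * x ∈ I := by
  refine mul_mem_of_simple cs φ I (fun i x hx => ?_) a x hx
  have h1 : T cs φ (cs.simple i) = ((ε (cs.simple i) : ℤˣ) : ℤ) • TN φ ε (cs.simple i) := by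
    rw [TN, smul_smul_units]
  rw [h1, smul_mul_assoc]
  exact zsmul_mem (h i x hx) _

theorem TN_alt {s t : B} (hD : InfDihedral cs s t) (k : ℕ) :
    TN φ ε (alt (cs.simple s) (cs.simple t) k) =
      alt (TN φ ε (cs.simple s)) (TN φ ε (cs.simple t)) k := by
  induction k generalizing s t with
  | zero => exact TN_one φ ε
  | succ k ih =>
    rw [alt_succ, alt_succ, ← ih hD.symm, TN_mul]
    rw [← alt_succ, hD.length_alt, hD.symm.length_alt, cs.length_simple, add_comm]

/-! ### The lattices of elements with bounded exponents -/

variable [LinearOrder Γ] [IsOrderedAddMonoid Γ]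

/-- The elements of the Hecke algebra whose exponents are all `< δ`. -/
def ltH (δ : Γ) : AddSubgroup (Hecke cs φ) :=
  AddSubgroup.closure {x | ∃ γ : Γ, γ < δ ∧ ∃ w : W, x = ex γ • T cs φ w}

variable {φ}

theorem ltH_mono {γ δ : Γ} (h : γ ≤ δ) : ltH (cs := cs) φ γ ≤ ltH φ δ := by
  refine AddSubgroup.closure_mono ?_
  rintro _ ⟨γ', hγ, hw⟩
  exact ⟨γ', hγ.trans_le h, hw⟩

theorem TN_mem_ltH {γ δ : Γ} (h : γ < δ) (w : W) : ex γ • TN φ ε w ∈ ltH φ δ := by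
  rw [TN, smul_comm]
  have h1 : ex γ • T cs φ w ∈ ltH φ δ := AddSubgroup.subset_closure ⟨γ, h, w, rfl⟩
  exact zsmul_mem h1 _

theorem ltH_induction {δ : Γ} {p : Hecke cs φ → Prop}
    (hT : ∀ γ, γ < δ → ∀ w : W, p (ex γ • TN φ ε w)) (h0 : p 0)
    (hadd : ∀ x y, p x → p y → p (x + y)) (hneg : ∀ x, p x → p (-x)) {h : Hecke cs φ}
    (hh : h ∈ ltH φ δ) : p h := by
  induction hh using AddSubgroup.closure_induction with
  | mem x hx =>
    obtain ⟨γ, hγ, w, rfl⟩ := hx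
    have h1 : T cs φ w = ((ε w : ℤˣ) : ℤ) • TN φ ε w := by rw [TN, smul_smul_units]
    rw [h1, smul_comm]
    rcases units_cases (ε w) with h | h <;> rw [h]
    · rw [one_smul]
      exact hT γ hγ w
    · rw [neg_smul, one_smul]
      exact hneg _ (hT γ hγ w)
  | zero => exact h0
  | add x y _ _ hx hy => exact hadd x y hx hy
  | neg x _ hx => exact hneg x hx

theorem ex_smul_mem_ltH {γ δ δ' : Γ} (h : γ + δ ≤ δ') {x : Hecke cs φ} (hx : x ∈ ltH φ δ) :
    ex γ • x ∈ ltH φ δ' := by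
  refine ltH_induction (1 : W →* ℤˣ) (p := fun x => ex γ • x ∈ ltH φ δ') ?_ ?_ ?_ ?_ hx
  · intro γ' hγ' w
    rw [smul_smul, ← ex_add]
    exact TN_mem_ltH _ (((add_lt_add_iff_left γ).2 hγ').trans_le h) w
  · rw [smul_zero]
    exact zero_mem _
  · intro x y hx hy
    rw [smul_add]
    exact add_mem hx hy
  · intro x hx
    rw [smul_neg]
    exact neg_mem hx

/-- For a parameter `a ≥ 0`, the quadratic relation introduces only `e^a` and `e^{-a}`, so
multiplication by `TN_i` raises exponents by at most `a`. Such bounds replace the computation of all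
coefficients of the Kazhdan-Lusztig elements. -/
theorem TN_mul_mem_ltH {i : B} (hi : 0 ≤ npar φ ε i) {δ δ' : Γ} (h : δ + npar φ ε i ≤ δ')
    {x : Hecke cs φ} (hx : x ∈ ltH φ δ) : TN φ ε (cs.simple i) * x ∈ ltH φ δ' := by
  refine ltH_induction ε (p := fun x => TN φ ε (cs.simple i) * x ∈ ltH φ δ') ?_ ?_ ?_ ?_ hx
  · intro γ hγ w
    have h1 : γ + npar φ ε i < δ' := ((add_lt_add_iff_right _).2 hγ).trans_le h
    obtain ⟨c, hc, h⟩ := TN_simple_mul φ ε i w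
    rw [mul_smul_comm, h, smul_add, smul_smul]
    refine add_mem (TN_mem_ltH ε (lt_of_le_of_lt (le_add_of_nonneg_right hi) h1) _) ?_
    rcases hc with rfl | rfl
    · rw [mul_zero, zero_smul]
      exact zero_mem _
    · rw [nq, mul_sub, ← ex_add, ← ex_add, sub_smul]
      refine sub_mem (TN_mem_ltH ε h1 _) (TN_mem_ltH ε (lt_of_le_of_lt ?_ h1) _)
      exact add_le_add_right ((neg_nonpos.2 hi).trans hi) γ
  · rw [mul_zero]
    exact zero_mem _
  · intro x y hx hy
    rw [mul_add]
    exact add_mem hx hy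
  · intro x hx
    rw [mul_neg]
    exact neg_mem hx

theorem tau_mem_ltH {δ : Γ} {x : Hecke cs φ} (hx : x ∈ ltH φ δ) : tau φ x ∈ ltH φ δ := by
  refine ltH_induction (1 : W →* ℤˣ) (p := fun x => tau φ x ∈ ltH φ δ) ?_ ?_ ?_ ?_ hx
  · intro γ hγ w
    rw [map_smul, tau_TN]
    exact TN_mem_ltH _ hγ _
  · rw [map_zero]
    exact zero_mem _
  · intro x y hx hy
    rw [map_add]
    exact add_mem hx hy
  · intro x hx
    rw [map_neg]
    exact neg_mem hx

theorem mul_TN_mem_ltH {i : B} (hi : 0 ≤ npar φ ε i) {δ δ' : Γ} (h : δ + npar φ ε i ≤ δ')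
    {x : Hecke cs φ} (hx : x ∈ ltH φ δ) : x * TN φ ε (cs.simple i) ∈ ltH φ δ' := by
  have h1 := tau_mem_ltH (TN_mul_mem_ltH ε hi h (tau_mem_ltH hx))
  rwa [tau_mul, tau_tau, tau_TN, cs.inv_simple] at h1

/-! ### The normalised Kazhdan-Lusztig elements -/

variable (φ) in
/-- The Kazhdan-Lusztig element, multiplied by a sign. -/
def klN (w : W) : Hecke cs φ := ((ε w : ℤˣ) : ℤ) • klBasis cs φ w

theorem klBasis_eq_smul_klN (w : W) : klBasis cs φ w = ((ε w : ℤˣ) : ℤ) • klN φ ε w := by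
  rw [klN, smul_smul_units]

theorem klBasis_mem_iff {I : Submodule (AddMonoidAlgebra ℤ Γ) (Hecke cs φ)} {w : W} :
    klBasis cs φ w ∈ I ↔ klN φ ε w ∈ I :=
  ⟨fun h => zsmul_mem h _, fun h => by rw [klBasis_eq_smul_klN ε]; exact zsmul_mem h _⟩

/-- The characterisation of the normalised Kazhdan-Lusztig elements. -/
def IsKLN (φ : SBar cs → Γ) (ε : W →* ℤˣ) (w : W) (c : Hecke cs φ) : Prop :=
  bar cs φ c = c ∧ c - TN φ ε w ∈ ltH φ (0 : Γ)

variable {ε}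

theorem IsKLN.isKL {w : W} {c : Hecke cs φ} (h : IsKLN φ ε w c) :
    IsKL cs φ w (((ε w : ℤˣ) : ℤ) • c) := by
  refine ⟨by rw [map_zsmul, h.1], ?_⟩
  have h1 : T cs φ w = ((ε w : ℤˣ) : ℤ) • TN φ ε w := by rw [TN, smul_smul_units]
  rw [h1, ← smul_sub]
  exact zsmul_mem h.2 _

theorem IsKLN.klN_eq {s t : B} (hD : InfDihedral cs s t) {w : W} {c : Hecke cs φ}
    (h : IsKLN φ ε w c) : klN φ ε w = c := by
  rw [klN, h.isKL.klBasis_eq φ hD, smul_smul_units]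

theorem isKLN_one : IsKLN φ ε 1 (1 : Hecke cs φ) :=
  ⟨map_one _, by rw [TN_one, sub_self]; exact zero_mem _⟩

theorem isKLN_simple_of_pos {i : B} (hi : 0 < npar φ ε i) :
    IsKLN φ ε (cs.simple i) (TN φ ε (cs.simple i) + ex (-npar φ ε i) • 1) := by
  constructor
  · rw [map_add, bar_TN_simple, bar_smul, map_one, barZ_ex, neg_neg, nq, sub_smul]
    abel
  · rw [add_sub_cancel_left, ← TN_one φ ε]
    exact TN_mem_ltH ε (neg_lt_zero.2 hi) 1

theorem isKLN_of_zero {i : B} (hi : npar φ ε i = 0) :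
    IsKLN φ ε (cs.simple i) (TN φ ε (cs.simple i)) := by
  constructor
  · rw [bar_TN_simple, nq, hi, neg_zero, sub_self, zero_smul, sub_zero]
  · rw [sub_self]
    exact zero_mem _

theorem npar_eq_zero_iff {i : B} : npar φ ε i = 0 ↔ par cs φ i = 0 := by
  rw [npar]
  rcases units_cases (ε (cs.simple i)) with h | h <;> rw [h] <;> simp

end Normalised

/-! ### Last letters of reduced words. -/

section Words

variable {B : Type u} {W : Type v} [Group W] {M : CoxeterMatrix B} {cs : CoxeterSystem M W}
variable {s t : B}

namespace InfDihedral

/-- The set of elements whose reduced expressions end with `i`. -/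
def endSet (cs : CoxeterSystem M W) (i : B) : Set W := {w | cs.IsRightDescent w i}

theorem not_both (hD : InfDihedral cs s t) {w : W} (h : cs.IsRightDescent w s) :
    ¬ cs.IsRightDescent w t := by
  rcases hD.cases_dc w with rfl | rfl | ⟨n, p, q, rfl⟩
  · exact absurd h (cs.not_isRightDescent_one s)
  · exact absurd h hD.not_isRightDescent_simple
  · rw [hD.isRightDescent_dc_left] at h
    rw [hD.isRightDescent_dc_right, h]
    decide

theorem isRightDescent_or (hD : InfDihedral cs s t) {w : W} (h : w ≠ 1) :
    cs.IsRightDescent w s ∨ cs.IsRightDescent w t := by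
  obtain ⟨i, hi⟩ := cs.exists_rightDescent_of_ne_one h
  rcases hD.eq_or_eq i with rfl | rfl
  · exact Or.inl hi
  · exact Or.inr hi

/-- Prepending a letter to a non-empty reduced word keeps its last letter, and a non-trivial element
has exactly one last letter. The empty word has none, hence the condition `w ≠ 1`. -/
theorem isRightDescent_mul_iff (hD : InfDihedral cs s t) {w : W} {i : B} (hw : w ≠ 1)
    (h : ¬ cs.IsLeftDescent w i) (j : B) :
    cs.IsRightDescent (cs.simple i * w) j ↔ cs.IsRightDescent w j := by
  have hl := cs.not_isLeftDescent_iff.1 h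
  have key : ∀ j, cs.IsRightDescent w j → cs.IsRightDescent (cs.simple i * w) j := by
    intro j hj
    have h1 := cs.length_mul_le (cs.simple i) (w * cs.simple j)
    have h2 : cs.length (w * cs.simple j) < cs.length w := hj
    rw [cs.length_simple] at h1
    rw [CoxeterSystem.IsRightDescent, mul_assoc]
    omega
  refine ⟨fun h' => ?_, key j⟩
  rcases hD.isRightDescent_or hw with h1 | h1 <;> rcases hD.eq_or_eq j with rfl | rfl
  · exact h1
  · exact absurd h' (hD.not_both (key _ h1))
  · exact absurd h' (hD.symm.not_both (key _ h1))
  · exact h1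

theorem isRightDescent_alt (hD : InfDihedral cs s t) (k : ℕ) (j : B) :
    cs.IsRightDescent (alt (cs.simple s) (cs.simple t) (k + 2)) j ↔
      cs.IsRightDescent (alt (cs.simple t) (cs.simple s) (k + 1)) j := by
  rw [alt_succ _ _ (k + 1)]
  refine hD.isRightDescent_mul_iff ?_ ?_ j
  · intro h
    have := hD.symm.length_alt (k + 1)
    rw [h, cs.length_one] at this
    omega
  · rw [cs.not_isLeftDescent_iff, ← alt_succ, hD.length_alt, hD.symm.length_alt]

end InfDihedral

end Words

/-! ## Equal parameters -/

section EqualParameters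

variable {R : Type*} [CommRing R] {H : Type*} [Ring H] [Algebra R H]

/-- The Kazhdan-Lusztig element of an alternating product, for equal parameters. -/
def eqKL (e : R) (x y : H) : ℕ → H
  -- The value is `0` and not `C_1 = 1`: in this way `C_x C_y = C_{xy}`, which has no lower term,
  -- obeys the same formula as the longer products.
  | 0 => 0
  | k + 1 => alt x y (k + 1) + e • alt y x k + e • eqKL e x y k

theorem eqKL_succ (e : R) (x y : H) (k : ℕ) :
    eqKL e x y (k + 1) = alt x y (k + 1) + e • alt y x k + e • eqKL e x y k := rfl

theorem eqKL_one (e : R) (x y : H) : eqKL e x y 1 = x + e • 1 := by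
  simp [eqKL, alt]

theorem add_smul_mul_self {e e' : R} (he : e * e' = 1) {x : H} (hx : x * x = 1 + (e' - e) • x) :
    (x + e • 1) * x = e' • (x + e • 1) := by
  rw [add_mul, hx, smul_mul_assoc, one_mul, smul_add, smul_smul, mul_comm e', he, sub_smul,
    one_smul]
  abel

/-- Expanded, `eqKL e x y (k + 1)` is the sum of `x y ⋯` of length `k + 1` and of all shorter
alternating products, one of length `j` having weight `e^{k+1-j}`. The induction rests on `(x + e) x
= e' (x + e)`, applied to the middle term of the recursion. -/
theorem mul_eqKL {e e' : R} (he : e * e' = 1) {x y : H} (hx : x * x = 1 + (e' - e) • x)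
    (k : ℕ) :
    (x + e • 1) * eqKL e y x (k + 1) = eqKL e x y (k + 2) + eqKL e x y k := by
  induction k with
  | zero =>
    rw [eqKL_one, eqKL_succ e x y 1, eqKL_one]
    simp only [alt, eqKL, add_mul, mul_add, smul_mul_assoc, mul_smul_comm, one_mul, mul_one]
    module
  | succ k ih =>
    have h1 : (x + e • 1) * alt x y (k + 1) = e' • (alt x y (k + 1) + e • alt y x k) := by
      rw [alt_succ, ← mul_assoc, add_smul_mul_self he hx, smul_mul_assoc, add_mul, smul_mul_assoc,
        one_mul]
    rw [eqKL_succ e y x (k + 1), mul_add, mul_add, mul_smul_comm, mul_smul_comm, ih, h1, smul_smul,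
      he, one_smul, eqKL_succ e x y (k + 2), eqKL_succ e x y k, add_mul, smul_mul_assoc, one_mul,
      ← alt_succ]
    module

/-- Solving `mul_eqKL` for its leading term writes the element as a left multiple of `x + e` minus
an element two steps shorter, so the eigenvalue of `x + e` on itself propagates. -/
theorem mul_eqKL_self {e e' : R} (he : e * e' = 1) {x y : H} (hx : x * x = 1 + (e' - e) • x)
    (k : ℕ) :
    (x + e • 1) * eqKL e x y (k + 1) = (e' + e) • eqKL e x y (k + 1) := by
  have h0 : (x + e • 1) * (x + e • 1) = (e' + e) • (x + e • 1) := by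
    rw [mul_add, add_smul_mul_self he hx, mul_smul_comm, mul_one, add_smul]
  induction k using Nat.strong_induction_on with
  | _ k ih =>
    match k with
    | 0 => rw [zero_add, eqKL_one, h0]
    | 1 =>
      have h1 := mul_eqKL (y := y) he hx 0
      rw [show eqKL e x y 0 = 0 from rfl, add_zero] at h1
      rw [show 1 + 1 = 0 + 2 from rfl, ← h1, ← mul_assoc, h0, smul_mul_assoc]
    | k + 2 =>
      have h1 := mul_eqKL (y := y) he hx (k + 1)
      replace h1 := eq_sub_of_add_eq h1.symm
      rw [show k + 2 + 1 = k + 1 + 2 from rfl, h1, mul_sub, ih k (by omega), ← mul_assoc, h0,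
        smul_mul_assoc, smul_sub]

end EqualParameters

/-! ### Cells for equal non-zero parameters. -/

section EqualKL

variable {B : Type u} {W : Type v} [Group W] {M : CoxeterMatrix B} {cs : CoxeterSystem M W}
variable {Γ : Type w} [AddCommGroup Γ] [LinearOrder Γ] [IsOrderedAddMonoid Γ] {φ : SBar cs → Γ}
variable {ε : W →* ℤˣ} {s t : B}

open InfDihedral

theorem ex_neg_mul_ex (γ : Γ) : ex (-γ) * ex γ = (1 : AddMonoidAlgebra ℤ Γ) := by
  rw [mul_comm, ex_mul_ex_neg]

/-- Equal non-zero parameters, up to signs. -/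
structure EqPar (φ : SBar cs → Γ) (ε : W →* ℤˣ) (s t : B) (a : Γ) : Prop where
  dih : InfDihedral cs s t
  pos : 0 < a
  left : npar φ ε s = a
  right : npar φ ε t = a

namespace EqPar

variable {a : Γ} (E : EqPar φ ε s t a)
include E

theorem symm : EqPar φ ε t s a := ⟨E.dih.symm, E.pos, E.right, E.left⟩

theorem sq : TN φ ε (cs.simple s) * TN φ ε (cs.simple s) =
    1 + (ex a - ex (-a)) • TN φ ε (cs.simple s) := by
  rw [TN_simple_sq, nq, E.left]

/-- Bar-invariance comes from the product formula, which expresses the element through shorter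
bar-invariant ones; negativity comes from the recursion, where every added term carries a factor
`e^{-a}`. -/
theorem isKLN_alt (k : ℕ) : IsKLN φ ε (alt (cs.simple s) (cs.simple t) (k + 1))
    (eqKL (ex (-a)) (TN φ ε (cs.simple s)) (TN φ ε (cs.simple t)) (k + 1)) := by
  constructor
  · induction k using Nat.strong_induction_on generalizing s t with
    | _ k ih =>
      have hs : bar cs φ (TN φ ε (cs.simple s) + ex (-a) • 1) =
          TN φ ε (cs.simple s) + ex (-a) • 1 := by
        rw [← E.left]
        exact (isKLN_simple_of_pos (by rw [E.left]; exact E.pos)).1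
      match k with
      | 0 => rw [zero_add, eqKL_one, hs]
      | 1 =>
        have h1 := mul_eqKL (y := TN φ ε (cs.simple t)) (ex_neg_mul_ex a) E.sq 0
        rw [show eqKL (ex (-a)) (TN φ ε (cs.simple s)) (TN φ ε (cs.simple t)) 0 = 0 from rfl,
          add_zero] at h1
        rw [show 1 + 1 = 0 + 2 from rfl, ← h1, map_mul, hs, ih 0 (by omega) E.symm]
      | k + 2 =>
        have h1 := mul_eqKL (y := TN φ ε (cs.simple t)) (ex_neg_mul_ex a) E.sq (k + 1)
        replace h1 := eq_sub_of_add_eq h1.symm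
        rw [show k + 2 + 1 = k + 1 + 2 from rfl, h1, map_sub, map_mul, hs,
          ih (k + 1) (by omega) E.symm, ih k (by omega) E]
  · induction k with
    | zero =>
      rw [zero_add, eqKL_one, alt_succ, alt_zero, mul_one, add_sub_cancel_left, ← TN_one φ ε]
      exact TN_mem_ltH ε (neg_lt_zero.2 E.pos) 1
    | succ k ih =>
      rw [eqKL_succ, ← TN_alt φ ε E.dih, ← TN_alt φ ε E.dih.symm, add_assoc, add_sub_cancel_left]
      refine add_mem (TN_mem_ltH ε (neg_lt_zero.2 E.pos) _) ?_
      have h1 := add_mem (TN_mem_ltH (φ := φ) ε (neg_lt_zero.2 E.pos)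
        (alt (cs.simple s) (cs.simple t) (k + 1)))
        (ex_smul_mem_ltH (γ := -a) (δ' := 0) (by simpa using E.pos.le) ih)
      rwa [← smul_add, add_sub_cancel] at h1

theorem klN_alt (k : ℕ) : klN φ ε (alt (cs.simple s) (cs.simple t) (k + 1)) =
    eqKL (ex (-a)) (TN φ ε (cs.simple s)) (TN φ ε (cs.simple t)) (k + 1) :=
  (E.isKLN_alt k).klN_eq E.dih

theorem klN_one : klN φ ε (1 : W) = 1 := isKLN_one.klN_eq E.dih

theorem klN_simple : klN φ ε (cs.simple s) = TN φ ε (cs.simple s) + ex (-a) • 1 := by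
  have h := E.klN_alt 0
  rwa [zero_add, eqKL_one, alt_succ, alt_zero, mul_one] at h

theorem mul_klN_self (k : ℕ) :
    (TN φ ε (cs.simple s) + ex (-a) • 1) * klN φ ε (alt (cs.simple s) (cs.simple t) (k + 1)) =
      (ex a + ex (-a)) • klN φ ε (alt (cs.simple s) (cs.simple t) (k + 1)) := by
  rw [E.klN_alt, mul_eqKL_self (ex_neg_mul_ex a) E.sq]

theorem mul_klN_one :
    (TN φ ε (cs.simple s) + ex (-a) • 1) * klN φ ε (alt (cs.simple t) (cs.simple s) 1) =
      klN φ ε (alt (cs.simple s) (cs.simple t) 2) := by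
  have h := mul_eqKL (y := TN φ ε (cs.simple t)) (ex_neg_mul_ex a) E.sq 0
  rw [E.klN_alt 1, E.symm.klN_alt 0, h]
  exact add_zero _

theorem mul_klN (k : ℕ) :
    (TN φ ε (cs.simple s) + ex (-a) • 1) * klN φ ε (alt (cs.simple t) (cs.simple s) (k + 2)) =
      klN φ ε (alt (cs.simple s) (cs.simple t) (k + 3)) +
      klN φ ε (alt (cs.simple s) (cs.simple t) (k + 1)) := by
  rw [E.klN_alt (k + 2), E.klN_alt k, E.symm.klN_alt (k + 1)]
  exact mul_eqKL (ex_neg_mul_ex a) E.sq (k + 1)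

theorem exists_isKL (w : W) : ∃ c, IsKL cs φ w c := by
  obtain ⟨k, rfl | rfl⟩ := E.dih.exists_alt w
  · cases k with
    | zero => exact ⟨_, isKLN_one.isKL (ε := ε)⟩
    | succ k => exact ⟨_, (E.isKLN_alt k).isKL⟩
  · cases k with
    | zero => exact ⟨_, isKLN_one.isKL (ε := ε)⟩
    | succ k => exact ⟨_, (E.symm.isKLN_alt k).isKL⟩

/-- The span of a set with suitable closure properties is a left ideal. -/
theorem mul_mem_klSpan {D : Set W} (h1 : ∀ i, (1 : W) ∈ D → cs.simple i ∈ D)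
    (hup : ∀ w i, w ∈ D → w ≠ 1 → ¬ cs.IsLeftDescent w i → cs.simple i * w ∈ D)
    (hdown : ∀ w i, w ∈ D → cs.simple i * w ≠ 1 → cs.IsLeftDescent w i → cs.simple i * w ∈ D)
    (h x : Hecke cs φ) (hx : x ∈ klSpan φ D) : h * x ∈ klSpan φ D := by
  have hmem : ∀ w ∈ D, klN φ ε w ∈ klSpan φ D := fun w hw =>
    (klBasis_mem_iff ε).1 (klBasis_mem_klSpan hw)
  have step : ∀ s t : B, EqPar φ ε s t a → ∀ k, alt (cs.simple s) (cs.simple t) (k + 1) ∈ D →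
      (TN φ ε (cs.simple s) + ex (-a) • 1) * klN φ ε (alt (cs.simple s) (cs.simple t) (k + 1)) ∈
        klSpan φ D ∧
      (TN φ ε (cs.simple t) + ex (-a) • 1) * klN φ ε (alt (cs.simple s) (cs.simple t) (k + 1)) ∈
        klSpan φ D := by
    intro s t E k hk
    refine ⟨?_, ?_⟩
    · rw [E.mul_klN_self]
      exact Submodule.smul_mem _ _ (hmem _ hk)
    · have hlen := E.dih.length_alt (k + 1)
      have hk1 : alt (cs.simple s) (cs.simple t) (k + 1) ≠ 1 := by
        intro h
        rw [h, cs.length_one] at hlen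
        omega
      have h2 : alt (cs.simple t) (cs.simple s) (k + 2) ∈ D := by
        refine hup _ t hk hk1 ?_
        rw [cs.not_isLeftDescent_iff, ← alt_succ, E.dih.symm.length_alt, hlen]
      cases k with
      | zero =>
        rw [E.symm.mul_klN_one]
        exact hmem _ h2
      | succ k =>
        rw [E.symm.mul_klN]
        refine add_mem (hmem _ h2) (hmem _ ?_)
        have hx : cs.simple s * alt (cs.simple s) (cs.simple t) (k + 1 + 1) =
            alt (cs.simple t) (cs.simple s) (k + 1) := by
          rw [alt_succ, cs.simple_mul_simple_cancel_left]
        rw [← hx]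
        refine hdown _ s hk ?_ ?_
        · intro h
          have := E.dih.symm.length_alt (k + 1)
          rw [← hx, h, cs.length_one] at this
          omega
        · rw [CoxeterSystem.IsLeftDescent, hx, E.dih.symm.length_alt, hlen]
          omega
  have key : ∀ i, ∀ w ∈ D, (TN φ ε (cs.simple i) + ex (-a) • 1) * klN φ ε w ∈ klSpan φ D := by
    intro i w hw
    have hone : (1 : W) ∈ D →
        (TN φ ε (cs.simple i) + ex (-a) • 1) * klN φ ε (1 : W) ∈ klSpan φ D := by
      intro h
      rw [E.klN_one, mul_one]
      rcases E.dih.eq_or_eq i with rfl | rfl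
      · rw [← E.klN_simple]
        exact hmem _ (h1 _ h)
      · rw [← E.symm.klN_simple]
        exact hmem _ (h1 _ h)
    obtain ⟨k, rfl | rfl⟩ := E.dih.exists_alt w
    · cases k with
      | zero => exact hone hw
      | succ k =>
        rcases E.dih.eq_or_eq i with rfl | rfl
        · exact (step _ _ E k hw).1
        · exact (step _ _ E k hw).2
    · cases k with
      | zero => exact hone hw
      | succ k =>
        rcases E.dih.eq_or_eq i with rfl | rfl
        · exact (step _ _ E.symm k hw).2
        · exact (step _ _ E.symm k hw).1
  refine mul_mem_of_TN_simple φ ε _ (fun i x hx => ?_) h x hx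
  induction hx using Submodule.span_induction with
  | mem x hx =>
    obtain ⟨w, hw, rfl⟩ := hx
    rw [klBasis_eq_smul_klN ε, mul_smul_comm]
    refine zsmul_mem ?_ _
    have h2 := sub_mem (key i w hw) (Submodule.smul_mem _ (ex (-a)) (hmem w hw))
    rwa [add_mul, smul_mul_assoc, one_mul, add_sub_cancel_right] at h2
  | zero => rw [mul_zero]; exact zero_mem _
  | add a b _ _ ha hb => rw [mul_add]; exact add_mem ha hb
  | smul r a _ ha => rw [mul_smul_comm]; exact Submodule.smul_mem _ _ ha

theorem klSystem : KLSystem φ s t where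
  dih := E.dih
  ex := E.exists_isKL
  span := by
    rw [eq_top_iff]
    rintro x -
    have h := E.mul_mem_klSpan (D := Set.univ) (fun _ _ => trivial) (fun _ _ _ _ _ => trivial)
      (fun _ _ _ _ _ => trivial) x 1
    rw [mul_one, klSpan, Set.image_univ] at h
    refine h ?_
    rw [← E.klN_one]
    exact (klBasis_mem_iff ε).1 (Submodule.subset_span ⟨1, rfl⟩)

/-- In the product formulas all terms have the same last letter as the word one starts from, and
`C_1` never appears in a product `C_i C_w` with `w ≠ 1`. -/
theorem lower_endSet : Lower φ .L (endSet cs s) := by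
  refine E.klSystem.lower_left_iff.2 (E.mul_mem_klSpan ?_ ?_ ?_)
  · exact fun i h => absurd h (cs.not_isRightDescent_one s)
  · exact fun w i hw h1 hi => (E.dih.isRightDescent_mul_iff h1 hi s).2 hw
  · intro w i hw h1 hi
    have h2 := E.dih.isRightDescent_mul_iff h1 (cs.isLeftDescent_iff_not_isLeftDescent_mul.1 hi) s
    rw [cs.simple_mul_simple_cancel_left] at h2
    exact h2.1 hw

/-- The recursion `C_{k+3} = C_x C_{k+2} - C_{k+1}` preserves the last letter, so unwinding it ends
at `C_s`. The fact that `C_s` generates is used again to identify the image of this ideal in the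
group algebra. -/
theorem klBasis_mem_of_endSet {w : W} (hw : w ∈ endSet cs s) :
    ∃ h, klBasis cs φ w = h * klBasis cs φ (cs.simple s) := by
  let I : Submodule (AddMonoidAlgebra ℤ Γ) (Hecke cs φ) :=
    LinearMap.range (LinearMap.mulRight (AddMonoidAlgebra ℤ Γ) (klBasis cs φ (cs.simple s)))
  have hI : ∀ h x, x ∈ I → h * x ∈ I := by
    rintro h _ ⟨y, rfl⟩
    exact ⟨h * y, mul_assoc _ _ _⟩
  have hs : klN φ ε (cs.simple s) ∈ I := (klBasis_mem_iff ε).1 ⟨1, one_mul _⟩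
  suffices h : klBasis cs φ w ∈ I by
    obtain ⟨h, hh⟩ := h
    exact ⟨h, hh.symm⟩
  rw [klBasis_mem_iff ε]
  have key : ∀ k x y, EqPar φ ε x y a →
      cs.IsRightDescent (alt (cs.simple x) (cs.simple y) (k + 1)) s →
      klN φ ε (alt (cs.simple x) (cs.simple y) (k + 1)) ∈ I := by
    intro k
    induction k using Nat.strong_induction_on with
    | _ k ih =>
      intro x y E' hw
      match k with
      | 0 =>
        rw [zero_add, alt_succ, alt_zero, mul_one] at hw ⊢
        rcases E.dih.eq_or_eq x with rfl | rfl
        · exact hs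
        · exact absurd hw E.dih.not_isRightDescent_simple
      | 1 =>
        rw [show 1 + 1 = 0 + 2 from rfl, E'.dih.isRightDescent_alt] at hw
        rw [show 1 + 1 = 2 from rfl, ← E'.mul_klN_one]
        exact hI _ _ (ih 0 (by omega) _ _ E'.symm hw)
      | k + 2 =>
        rw [show k + 2 + 1 = k + 1 + 2 from rfl, E'.dih.isRightDescent_alt] at hw
        have h1 := E'.mul_klN k
        rw [show k + 2 + 1 = k + 3 from rfl, eq_sub_of_add_eq h1.symm]
        refine sub_mem (hI _ _ (ih (k + 1) (by omega) _ _ E'.symm hw)) (ih k (by omega) _ _ E' ?_)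
        rwa [show k + 1 + 1 = k + 2 from rfl, E'.symm.dih.isRightDescent_alt] at hw
  obtain ⟨k, rfl | rfl⟩ := E.dih.exists_alt w <;> cases k with
  | zero => exact absurd hw (cs.not_isRightDescent_one s)
  | succ k => first | exact key _ _ _ E hw | exact key _ _ _ E.symm hw

/-- This is the lower term of the product formula. Iterated, it descends from any word ending in `s`
to `s` itself, the direction not given by `klBasis_mem_of_endSet`. -/
theorem cellLE_alt (k : ℕ) : CellLE cs φ .L (alt (cs.simple t) (cs.simple s) (k + 1))
    (alt (cs.simple s) (cs.simple t) (k + 2)) := by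
  refine Relation.TransGen.single (E.klSystem.arrow_left_iff.2
    ⟨TN φ ε (cs.simple t) + ex (-a) • 1, ?_⟩)
  have hne : alt (cs.simple t) (cs.simple s) (k + 3) ≠ alt (cs.simple t) (cs.simple s) (k + 1) := by
    intro h
    have := congrArg cs.length h
    rw [E.dih.symm.length_alt, E.dih.symm.length_alt] at this
    omega
  rw [klBasis_eq_smul_klN ε, mul_smul_comm, E.symm.mul_klN, klN, klN, map_zsmul, map_add,
    map_zsmul, map_zsmul, E.klSystem.repr_klBasis, E.klSystem.repr_klBasis]
  have hu : ∀ u : ℤˣ, ((u : ℤ) : AddMonoidAlgebra ℤ Γ) ≠ 0 := by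
    intro u
    rcases units_cases u with h | h <;> rw [h] <;> simp
  simp [Finsupp.single_eq_of_ne hne.symm, hu]

theorem simple_cellLE {w : W} (hw : w ∈ endSet cs s) : CellLE cs φ .L (cs.simple s) w := by
  have key : ∀ k x y, EqPar φ ε x y a →
      cs.IsRightDescent (alt (cs.simple x) (cs.simple y) (k + 1)) s →
      CellLE cs φ .L (cs.simple s) (alt (cs.simple x) (cs.simple y) (k + 1)) := by
    intro k
    induction k with
    | zero =>
      intro x y E' hw
      rw [zero_add, alt_succ, alt_zero, mul_one] at hw ⊢
      rcases E.dih.eq_or_eq x with rfl | rfl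
      · exact E.klSystem.cellLE_refl _ _
      · exact absurd hw E.dih.not_isRightDescent_simple
    | succ k ih =>
      intro x y E' hw
      rw [show k + 1 + 1 = k + 2 from rfl, E'.dih.isRightDescent_alt] at hw
      exact (ih _ _ E'.symm hw).trans (E'.cellLE_alt k)
  obtain ⟨k, rfl | rfl⟩ := E.dih.exists_alt w <;> cases k with
  | zero => exact absurd hw (cs.not_isRightDescent_one s)
  | succ k => first | exact key _ _ _ E hw | exact key _ _ _ E.symm hw

end EqPar

end EqualKL

/-! ## Unequal parameters -/

section UnequalAlgebra

variable {R : Type*} [CommRing R] {H : Type*} [Ring H] [Algebra R H]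

/-- The elements `C_x (y x y ⋯ y) C_x`, where the middle factor has length `2 n - 1`,
with `C_x = x + e`. -/
def sandwich (e : R) (x y : H) : ℕ → H
  | 0 => x + e • 1
  | n + 1 => (x + e • 1) * alt y x (2 * n + 1) * (x + e • 1)

/-- The Kazhdan-Lusztig element of `x (y x)^n`, for unequal parameters. -/
def uneqKL (e q : R) (x y : H) : ℕ → H
  | 0 => x + e • 1
  | 1 => sandwich e x y 1 - (e * q) • (x + e • 1)
  -- The corrections are those for which left multiplication by `(x + e) y` obeys the three-term
  -- recurrence of `mul_uneqKL_succ`. For `e = e^{-a}` and `q = e^b - e^{-b}` with `a > b ≥ 0`, the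
  -- coefficients `e q` and `e e` have only negative exponents, so negativity is not lost.
  | n + 2 => sandwich e x y (n + 2) - (e * q) • uneqKL e q x y (n + 1) +
      (e * e) • uneqKL e q x y n

variable {e e' q : R} (he : e * e' = 1) {x y : H} (hx : x * x = 1 + (e' - e) • x)
  (hy : y * y = 1 + q • y)

include he hx

theorem add_smul_mul_add_smul : (x + e • 1) * (x + e • 1) = (e' + e) • (x + e • 1) := by
  rw [mul_add, add_smul_mul_self he hx, mul_smul_comm, mul_one, add_smul]

theorem mul_sandwich_zero :
    (x + e • 1) * y * sandwich e x y 0 = sandwich e x y 1 := by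
  simp [sandwich, alt]

theorem mul_sandwich_self (n : ℕ) :
    (x + e • 1) * sandwich e x y n = (e' + e) • sandwich e x y n := by
  cases n with
  | zero => exact add_smul_mul_add_smul he hx
  | succ n =>
    rw [sandwich, mul_assoc (x + e • 1), ← mul_assoc (x + e • 1) (x + e • 1),
      add_smul_mul_add_smul he hx, smul_mul_assoc]

theorem mul_uneqKL_self (n : ℕ) :
    (x + e • 1) * uneqKL e q x y n = (e' + e) • uneqKL e q x y n := by
  induction n using Nat.strong_induction_on with
  | _ n ih =>
    match n with
    | 0 => exact add_smul_mul_add_smul he hx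
    | 1 =>
      rw [uneqKL, mul_sub, mul_sandwich_self he hx, mul_smul_comm, add_smul_mul_add_smul he hx]
      module
    | n + 2 =>
      rw [uneqKL, mul_add, mul_sub, mul_sandwich_self he hx, mul_smul_comm, mul_smul_comm,
        ih n (by omega), ih (n + 1) (by omega)]
      module

include hy

/-- In the left factor `x + e` of the sandwich, the term `x` lengthens the word, while the term `e`
brings two letters `y` together, and `y y = 1 + q y` produces the two shorter contributions. -/
theorem mul_sandwich_succ (n : ℕ) : (x + e • 1) * y * sandwich e x y (n + 1) =
    sandwich e x y (n + 2) + (e * q) • sandwich e x y (n + 1) +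
      e • ((x + e • 1) * alt x y (2 * n) * (x + e • 1)) := by
  have h1 : y * alt y x (2 * n + 1) = alt x y (2 * n) + q • alt y x (2 * n + 1) := by
    rw [alt_succ, ← mul_assoc, hy, add_mul, one_mul, smul_mul_assoc]
  have h2 : y * (x * alt y x (2 * n + 1)) = alt y x (2 * (n + 1) + 1) := rfl
  have h3 : y * ((x + e • 1) * alt y x (2 * n + 1)) = alt y x (2 * (n + 1) + 1) +
      e • alt x y (2 * n) + (e * q) • alt y x (2 * n + 1) := by
    rw [add_mul, mul_add, h2, smul_mul_assoc, one_mul, mul_smul_comm, h1]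
    module
  have h4 : (x + e • 1) * y * sandwich e x y (n + 1) =
      (x + e • 1) * (y * ((x + e • 1) * alt y x (2 * n + 1))) * (x + e • 1) := by
    simp only [sandwich, mul_assoc]
  rw [h4, h3, sandwich, sandwich]
  generalize x + e • 1 = c
  simp only [mul_add, add_mul, mul_smul_comm, smul_mul_assoc]
  abel

theorem mul_sandwich_one : (x + e • 1) * y * sandwich e x y 1 =
    sandwich e x y 2 + (e * q) • sandwich e x y 1 + (1 + e * e) • (x + e • 1) := by
  rw [mul_sandwich_succ he hx hy 0, mul_zero, alt_zero, mul_one, add_smul_mul_add_smul he hx,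
    smul_smul, mul_add, he]

theorem mul_sandwich_add_two (n : ℕ) : (x + e • 1) * y * sandwich e x y (n + 2) =
    sandwich e x y (n + 3) + (e * q) • sandwich e x y (n + 2) + sandwich e x y (n + 1) := by
  rw [mul_sandwich_succ he hx hy (n + 1), show 2 * (n + 1) = 2 * n + 1 + 1 by ring, alt_succ,
    ← mul_assoc (x + e • 1) x, add_smul_mul_self he hx, smul_mul_assoc, smul_mul_assoc, smul_smul,
    he, one_smul]
  rfl

theorem mul_uneqKL_zero : (x + e • 1) * y * uneqKL e q x y 0 =
    uneqKL e q x y 1 + (e * q) • uneqKL e q x y 0 := by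
  have h := mul_sandwich_zero he hx (y := y)
  rw [uneqKL, uneqKL]
  rw [sandwich] at h
  rw [h]
  abel

/-- The recurrence of the sandwiches is irregular at index one, where `x + e` has coefficient `1 + e
e` instead of `1`. Rewriting the sandwiches through the `uneqKL` absorbs the irregularity, and each
case becomes a linear combination of earlier ones. -/
theorem mul_uneqKL_succ (n : ℕ) : (x + e • 1) * y * uneqKL e q x y (n + 1) =
    uneqKL e q x y (n + 2) + (e * q) • uneqKL e q x y (n + 1) + uneqKL e q x y n := by
  have hX2 : ∀ n, sandwich e x y (n + 2) = uneqKL e q x y (n + 2) +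
      (e * q) • uneqKL e q x y (n + 1) - (e * e) • uneqKL e q x y n := by
    intro n
    rw [uneqKL]
    abel
  have hX1 : sandwich e x y 1 = uneqKL e q x y 1 + (e * q) • uneqKL e q x y 0 := by
    rw [uneqKL, uneqKL]
    abel
  have hX0 : x + e • 1 = uneqKL e q x y 0 := rfl
  have hx0 := mul_uneqKL_zero he hx hy
  induction n using Nat.strong_induction_on with
  | _ n ih =>
    match n with
    | 0 =>
      have h1 := mul_sandwich_one he hx hy
      rw [hX1, hX2, hX0] at h1
      rw [hX0] at hx0
      rw [mul_add, mul_smul_comm, hx0] at h1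
      rw [hX0]
      linear_combination (norm := module) h1
    | 1 =>
      have h1 := mul_sandwich_add_two he hx hy 0
      have h2 := ih 0 (by omega)
      rw [hX0] at h1 h2 hx0 ⊢
      simp only [zero_add] at h1 h2 ⊢
      rw [hX1, hX2, hX2, mul_sub, mul_add, mul_smul_comm, mul_smul_comm, hx0, h2] at h1
      linear_combination (norm := module) h1
    | n + 2 =>
      have h1 := mul_sandwich_add_two he hx hy (n + 1)
      have h2 := ih (n + 1) (by omega)
      have h3 := ih n (by omega)
      rw [hX2, hX2, hX2, mul_sub, mul_add, mul_smul_comm, mul_smul_comm, h2, h3] at h1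
      linear_combination (norm := module) h1

end UnequalAlgebra

/-! ### Cells for unequal parameters. -/

section UnequalKL

variable {B : Type u} {W : Type v} [Group W] {M : CoxeterMatrix B} {cs : CoxeterSystem M W}
variable {Γ : Type w} [AddCommGroup Γ] [LinearOrder Γ] [IsOrderedAddMonoid Γ] {φ : SBar cs → Γ}
variable {ε : W →* ℤˣ} {s t : B}

open InfDihedral

theorem mul_dc {G : Type*} [Monoid G] (x y : G) (n : ℕ) (q : Bool) :
    y * dc x y n false q = dc x y n true q := by
  simp [dc, mul_assoc]

theorem dc_mul {G : Type*} [Monoid G] (x y : G) (n : ℕ) (p : Bool) :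
    dc x y n p false * y = dc x y n p true := by
  simp [dc]

variable (φ ε t) in
/-- The constant term of the normalised element `C_t`. -/
def del : AddMonoidAlgebra ℤ Γ := if npar φ ε t = 0 then 0 else ex (-npar φ ε t)

variable (φ ε t) in
/-- The element `C_t` (normalised) or `1`. -/
def cp (p : Bool) : Hecke cs φ :=
  bif p then TN φ ε (cs.simple t) + del φ ε t • 1 else 1

variable (φ ε s t) in
/-- The normalised Kazhdan-Lusztig element of `dc s t n p q`, for unequal parameters. -/
def uKL (n : ℕ) (p q : Bool) : Hecke cs φ :=
  cp φ ε t p * uneqKL (ex (-npar φ ε s)) (nq φ ε t) (TN φ ε (cs.simple s)) (TN φ ε (cs.simple t)) n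
    * cp φ ε t q

/-- Unequal parameters, up to signs. -/
structure UneqPar (φ : SBar cs → Γ) (ε : W →* ℤˣ) (s t : B) : Prop where
  dih : InfDihedral cs s t
  nonneg : 0 ≤ npar φ ε t
  lt : npar φ ε t < npar φ ε s

variable (φ ε s t) in
/-- The coefficient `ζ` in `C_s C_t C_x = C_{stx} + ζ C_x + ⋯`, where `x` starts with `s`. -/
def zet : AddMonoidAlgebra ℤ Γ := ex (-npar φ ε s) * nq φ ε t +
  del φ ε t * (ex (npar φ ε s) + ex (-npar φ ε s))

namespace UneqPar

variable (E : UneqPar φ ε s t)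
include E

theorem pos : 0 < npar φ ε s := E.nonneg.trans_lt E.lt

theorem sq : TN φ ε (cs.simple s) * TN φ ε (cs.simple s) =
    1 + (ex (npar φ ε s) - ex (-npar φ ε s)) • TN φ ε (cs.simple s) := by
  rw [TN_simple_sq, nq]

/-- For `b = 0` the element `C_t` is `T_t` itself, because `e^{-b} = 1` does not have a negative
exponent; hence the separate value `0`. -/
theorem del_cases : npar φ ε t = 0 ∧ del φ ε t = 0 ∨
    0 < npar φ ε t ∧ del φ ε t = ex (-npar φ ε t) := by
  rcases eq_or_ne (npar φ ε t) 0 with h | h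
  · exact Or.inl ⟨h, if_pos h⟩
  · exact Or.inr ⟨lt_of_le_of_ne E.nonneg h.symm, if_neg h⟩

theorem isKLN_cp : IsKLN φ ε (cs.simple t) (cp φ ε t true) := by
  rcases E.del_cases with ⟨h, h'⟩ | ⟨h, h'⟩ <;> rw [cp, cond_true, h']
  · rw [zero_smul, add_zero]
    exact isKLN_of_zero h
  · exact isKLN_simple_of_pos h

theorem bar_cp (p : Bool) : bar cs φ (cp φ ε t p) = cp φ ε t p := by
  cases p
  · exact map_one _
  · exact E.isKLN_cp.1

/-- The two terms `e^{-a-b}` cancel. What remains is bar-invariant, which allows bar-invariance to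
pass through the recursion for the `uKL`. -/
theorem zet_eq : npar φ ε t = 0 ∧ zet φ ε s t = 0 ∨ 0 < npar φ ε t ∧
    zet φ ε s t = ex (npar φ ε t - npar φ ε s) + ex (npar φ ε s - npar φ ε t) := by
  rcases E.del_cases with ⟨h, h'⟩ | ⟨h, h'⟩
  · refine Or.inl ⟨h, ?_⟩
    rw [zet, h', nq, h, neg_zero, sub_self, mul_zero, zero_mul, add_zero]
  · refine Or.inr ⟨h, ?_⟩
    rw [zet, h', nq, mul_sub, mul_add, ← ex_add, ← ex_add, ← ex_add, ← ex_add,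
      add_comm (-npar φ ε s) (-npar φ ε t), neg_add_eq_sub, neg_add_eq_sub]
    abel_nf

theorem barZ_zet : barZ (zet φ ε s t) = zet φ ε s t := by
  rcases E.zet_eq with ⟨-, h⟩ | ⟨-, h⟩ <;> rw [h]
  · exact map_zero _
  · rw [map_add, barZ_ex, barZ_ex, neg_sub, neg_sub, add_comm]

theorem zet_ne_zero (h : 0 < npar φ ε t) : zet φ ε s t ≠ 0 := by
  rcases E.zet_eq with ⟨h', -⟩ | ⟨-, h'⟩
  · exact absurd h' h.ne'
  · intro h0
    have := congrArg aug (h'.symm.trans h0)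
    rw [map_add, aug_ex, aug_ex, map_zero] at this
    norm_num at this

theorem mul_uKL_false (n : ℕ) (q : Bool) :
    (TN φ ε (cs.simple s) + ex (-npar φ ε s) • 1) * uKL φ ε s t n false q =
      (ex (npar φ ε s) + ex (-npar φ ε s)) • uKL φ ε s t n false q := by
  rw [uKL, cp, cond_false, one_mul, ← mul_assoc, mul_uneqKL_self (ex_neg_mul_ex _) E.sq,
    smul_mul_assoc]

theorem mul_uKL_zero (q : Bool) :
    (TN φ ε (cs.simple s) + ex (-npar φ ε s) • 1) * uKL φ ε s t 0 true q =
      uKL φ ε s t 1 false q + zet φ ε s t • uKL φ ε s t 0 false q := by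
  simp only [uKL]
  generalize cp φ ε t q = c
  rw [cp, cp, cond_true, cond_false, one_mul, one_mul, ← mul_assoc, ← mul_assoc, mul_add,
    add_mul, mul_uneqKL_zero (ex_neg_mul_ex _) E.sq (TN_simple_sq φ ε t), mul_smul_comm, mul_one,
    smul_mul_assoc, mul_uneqKL_self (ex_neg_mul_ex _) E.sq, zet, ← smul_mul_assoc, ← add_mul]
  congr 1
  module

/-- Write `C_t = T_t + del`. The part `C_s T_t` acts by the three-term recurrence, and `del C_s` by
its eigenvalue; together they give the coefficient `zet`. -/
theorem mul_uKL_succ (n : ℕ) (q : Bool) :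
    (TN φ ε (cs.simple s) + ex (-npar φ ε s) • 1) * uKL φ ε s t (n + 1) true q =
      uKL φ ε s t (n + 2) false q + zet φ ε s t • uKL φ ε s t (n + 1) false q +
        uKL φ ε s t n false q := by
  simp only [uKL]
  generalize cp φ ε t q = c
  rw [cp, cp, cond_true, cond_false, one_mul, one_mul, one_mul, ← mul_assoc, ← mul_assoc, mul_add,
    add_mul, mul_uneqKL_succ (ex_neg_mul_ex _) E.sq (TN_simple_sq φ ε t), mul_smul_comm, mul_one,
    smul_mul_assoc, mul_uneqKL_self (ex_neg_mul_ex _) E.sq, zet, ← smul_mul_assoc, ← add_mul,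
    ← add_mul]
  congr 1
  module

theorem cp_mul_uKL_false (n : ℕ) (q : Bool) :
    cp φ ε t true * uKL φ ε s t n false q = uKL φ ε s t n true q := by
  rw [uKL, uKL, mul_assoc, mul_assoc, ← mul_assoc, cp, cp, cond_false, mul_one]

theorem cp_mul_cp : npar φ ε t = 0 ∧ cp φ ε t true * cp φ ε t true = 1 ∨
    0 < npar φ ε t ∧ cp φ ε t true * cp φ ε t true =
      (ex (npar φ ε t) + ex (-npar φ ε t)) • cp φ ε t true := by
  rcases E.del_cases with ⟨h, h'⟩ | ⟨h, h'⟩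
  · refine Or.inl ⟨h, ?_⟩
    rw [cp, cond_true, h', zero_smul, add_zero, TN_simple_sq, nq, h, neg_zero, sub_self, zero_smul,
      add_zero]
  · refine Or.inr ⟨h, ?_⟩
    rw [cp, cond_true, h', add_smul_mul_add_smul (ex_neg_mul_ex _) (TN_simple_sq φ ε t)]

theorem cp_mul_uKL_true (n : ℕ) (q : Bool) :
    npar φ ε t = 0 ∧ cp φ ε t true * uKL φ ε s t n true q = uKL φ ε s t n false q ∨
    0 < npar φ ε t ∧ cp φ ε t true * uKL φ ε s t n true q =
      (ex (npar φ ε t) + ex (-npar φ ε t)) • uKL φ ε s t n true q := by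
  have h1 : cp φ ε t true * uKL φ ε s t n true q =
      cp φ ε t true * cp φ ε t true * uKL φ ε s t n false q := by
    rw [mul_assoc, E.cp_mul_uKL_false]
  rcases E.cp_mul_cp with ⟨h, h'⟩ | ⟨h, h'⟩
  · exact Or.inl ⟨h, by rw [h1, h', one_mul]⟩
  · exact Or.inr ⟨h, by rw [h1, h', smul_mul_assoc, E.cp_mul_uKL_false]⟩

/-! ### The Kazhdan-Lusztig basis -/

theorem bar_uKL (n : ℕ) (p q : Bool) : bar cs φ (uKL φ ε s t n p q) = uKL φ ε s t n p q := by
  have hs : bar cs φ (TN φ ε (cs.simple s) + ex (-npar φ ε s) • 1) =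
      TN φ ε (cs.simple s) + ex (-npar φ ε s) • 1 := (isKLN_simple_of_pos E.pos).1
  have key : bar cs φ (uKL φ ε s t n false false) = uKL φ ε s t n false false := by
    induction n using Nat.strong_induction_on with
    | _ n ih =>
      match n with
      | 0 => simpa [uKL, cp, uneqKL] using hs
      | 1 =>
        have h1 := E.mul_uKL_zero false
        rw [← E.cp_mul_uKL_false] at h1
        rw [eq_sub_of_add_eq h1.symm, map_sub, map_mul, map_mul, hs, E.bar_cp, bar_smul,
          E.barZ_zet, ih 0 (by omega)]
      | n + 2 =>
        have h1 := E.mul_uKL_succ n false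
        rw [← E.cp_mul_uKL_false, add_assoc] at h1
        rw [eq_sub_of_add_eq h1.symm, map_sub, map_mul, map_mul, hs, E.bar_cp,
          ih (n + 1) (by omega), map_add, bar_smul, E.barZ_zet, ih (n + 1) (by omega),
          ih n (by omega)]
  have h2 : uKL φ ε s t n p q = cp φ ε t p * uKL φ ε s t n false false * cp φ ε t q := by
    rw [uKL, uKL, cp, cp, cp, cond_false, one_mul, mul_one]
  rw [h2, map_mul, map_mul, E.bar_cp, E.bar_cp, key]

theorem del_smul_mem {γ : Γ} {x : Hecke cs φ} (hx : x ∈ ltH φ γ) : del φ ε t • x ∈ ltH φ γ := by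
  rcases E.del_cases with ⟨-, h⟩ | ⟨h', h⟩ <;> rw [h]
  · rw [zero_smul]
    exact zero_mem _
  · exact ex_smul_mem_ltH (by simpa using h'.le) hx

theorem del_smul_TN_mem (w : W) : del φ ε t • TN φ ε w ∈ ltH φ (0 : Γ) := by
  rcases E.del_cases with ⟨-, h⟩ | ⟨h', h⟩ <;> rw [h]
  · rw [zero_smul]
    exact zero_mem _
  · exact TN_mem_ltH ε (neg_lt_zero.2 h') w

theorem cp_mul_mem {γ γ' : Γ} (h : γ + npar φ ε t ≤ γ') (p : Bool) {x : Hecke cs φ}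
    (hx : x ∈ ltH φ γ) : cp φ ε t p * x ∈ ltH φ γ' := by
  have h' : γ ≤ γ' := (le_add_of_nonneg_right E.nonneg).trans h
  cases p
  · rw [cp, cond_false, one_mul]
    exact ltH_mono h' hx
  · rw [cp, cond_true, add_mul, smul_mul_assoc, one_mul]
    exact add_mem (TN_mul_mem_ltH ε E.nonneg h hx) (ltH_mono h' (E.del_smul_mem hx))

theorem mul_cp_mem {γ γ' : Γ} (h : γ + npar φ ε t ≤ γ') (p : Bool) {x : Hecke cs φ}
    (hx : x ∈ ltH φ γ) : x * cp φ ε t p ∈ ltH φ γ' := by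
  have h' : γ ≤ γ' := (le_add_of_nonneg_right E.nonneg).trans h
  cases p
  · rw [cp, cond_false, mul_one]
    exact ltH_mono h' hx
  · rw [cp, cond_true, mul_add, mul_smul_comm, mul_one]
    exact add_mem (mul_TN_mem_ltH ε E.nonneg h hx) (ltH_mono h' (E.del_smul_mem hx))

theorem cp_mul_TN_mem {γ γ' : Γ} (h : γ < γ') (p : Bool) {w : W}
    (hw : cs.length (cs.simple t * w) = cs.length w + 1) :
    cp φ ε t p * ex γ • TN φ ε w ∈ ltH φ γ' := by
  cases p
  · rw [cp, cond_false, one_mul]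
    exact TN_mem_ltH ε h w
  · rw [cp, cond_true, add_mul, smul_mul_assoc, one_mul, mul_smul_comm, TN_mul]
    · exact add_mem (TN_mem_ltH ε h _) (E.del_smul_mem (TN_mem_ltH ε h w))
    · rw [hw, cs.length_simple, add_comm]

theorem TN_mul_cp_mem {γ γ' : Γ} (h : γ < γ') (p : Bool) {w : W}
    (hw : cs.length (w * cs.simple t) = cs.length w + 1) :
    (ex γ • TN φ ε w) * cp φ ε t p ∈ ltH φ γ' := by
  cases p
  · rw [cp, cond_false, mul_one]
    exact TN_mem_ltH ε h w
  · rw [cp, cond_true, mul_add, mul_smul_comm, mul_one, smul_mul_assoc, TN_mul]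
    · exact add_mem (TN_mem_ltH ε h _) (E.del_smul_mem (TN_mem_ltH ε h w))
    · rw [hw, cs.length_simple]

/-- The word begins and ends with `s`, so multiplying by `T_t` on either side adds lengths. Every
other term contains a factor `del`, whose exponent is negative if it is non-zero. -/
theorem cp_mul_TN_mul_cp (n : ℕ) (p q : Bool) :
    cp φ ε t p * TN φ ε (dc (cs.simple s) (cs.simple t) n false false) * cp φ ε t q -
      TN φ ε (dc (cs.simple s) (cs.simple t) n p q) ∈ ltH φ (0 : Γ) := by
  have h1 : cp φ ε t p * TN φ ε (dc (cs.simple s) (cs.simple t) n false false) =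
      TN φ ε (dc (cs.simple s) (cs.simple t) n p false) +
        (bif p then del φ ε t else 0) • TN φ ε (dc (cs.simple s) (cs.simple t) n false false) := by
    cases p
    · simp [cp]
    · rw [cp, cond_true, add_mul, smul_mul_assoc, one_mul, TN_mul, mul_dc]
      · rfl
      · rw [mul_dc, E.dih.length_dc, E.dih.length_dc, cs.length_simple]
        simp only [Bool.toNat_true, Bool.toNat_false]
        omega
  have h2 : ∀ p, TN φ ε (dc (cs.simple s) (cs.simple t) n p false) * cp φ ε t q =
      TN φ ε (dc (cs.simple s) (cs.simple t) n p q) +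
        (bif q then del φ ε t else 0) • TN φ ε (dc (cs.simple s) (cs.simple t) n p false) := by
    intro p
    cases q
    · simp [cp]
    · rw [cp, cond_true, mul_add, mul_smul_comm, mul_one, TN_mul, dc_mul]
      · rfl
      · rw [dc_mul, E.dih.length_dc, E.dih.length_dc, cs.length_simple]
        simp only [Bool.toNat_true, Bool.toNat_false]
  have h3 : ∀ (p : Bool) (x : Hecke cs φ), x ∈ ltH φ (0 : Γ) →
      (bif p then del φ ε t else 0) • x ∈ ltH φ (0 : Γ) := by
    intro p x hx
    cases p
    · rw [cond_false, zero_smul]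
      exact zero_mem _
    · exact E.del_smul_mem hx
  have h4 : ∀ (p : Bool) (w : W), (bif p then del φ ε t else 0) • TN φ ε w ∈ ltH φ (0 : Γ) := by
    intro p w
    cases p
    · rw [cond_false, zero_smul]
      exact zero_mem _
    · exact E.del_smul_TN_mem w
  rw [h1, add_mul, h2, smul_mul_assoc, h2, smul_add]
  have := add_mem (add_mem (h4 q (dc (cs.simple s) (cs.simple t) n p false))
    (h4 p (dc (cs.simple s) (cs.simple t) n false q)))
    (h3 p _ (h4 q (dc (cs.simple s) (cs.simple t) n false false)))
  convert this using 1
  abel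

/-- The elements with negative exponents, even after multiplication by `C_t` on both sides. -/
def Good (φ : SBar cs → Γ) (ε : W →* ℤˣ) (t : B) (h : Hecke cs φ) : Prop :=
  ∀ p q, cp φ ε t p * h * cp φ ε t q ∈ ltH φ (0 : Γ)

omit E in
theorem Good.add {h h' : Hecke cs φ} (hh : Good φ ε t h) (hh' : Good φ ε t h') :
    Good φ ε t (h + h') := fun p q => by
  rw [mul_add, add_mul]
  exact add_mem (hh p q) (hh' p q)

omit E in
theorem Good.sub {h h' : Hecke cs φ} (hh : Good φ ε t h) (hh' : Good φ ε t h') :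
    Good φ ε t (h - h') := fun p q => by
  rw [mul_sub, sub_mul]
  exact sub_mem (hh p q) (hh' p q)

omit E in
theorem Good.smul {γ : Γ} (hγ : γ ≤ 0) {h : Hecke cs φ} (hh : Good φ ε t h) :
    Good φ ε t (ex γ • h) := fun p q => by
  rw [mul_smul_comm, smul_mul_assoc]
  exact ex_smul_mem_ltH (by simpa using hγ) (hh p q)

/-- On the left the product adds lengths and exponents do not rise; on the right they rise by at
most `b`, which the factor `e^{-a}` outweighs. -/
theorem good_left {w : W} (hw : cs.length (cs.simple t * w) = cs.length w + 1) :
    Good φ ε t (ex (-npar φ ε s) • TN φ ε w) := fun p q =>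
  E.mul_cp_mem (neg_add_cancel _).le q (E.cp_mul_TN_mem (neg_lt_neg E.lt) p hw)

theorem good_right {w : W} (hw : cs.length (w * cs.simple t) = cs.length w + 1) :
    Good φ ε t (ex (-npar φ ε s) • TN φ ε w) := fun p q => by
  rw [mul_assoc]
  exact E.cp_mul_mem (neg_add_cancel _).le p (E.TN_mul_cp_mem (neg_lt_neg E.lt) q hw)

/-- No length condition is available here, so exponents may rise by `b` on each side; the factor
`e^{-2a}` pays for both. -/
theorem good_sq (w : W) : Good φ ε t (ex (-npar φ ε s + -npar φ ε s) • TN φ ε w) := fun p q =>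
  E.mul_cp_mem (neg_add_cancel _).le q (E.cp_mul_mem (by rw [neg_add_cancel_right]) p
    (TN_mem_ltH ε (add_lt_add (neg_lt_neg E.lt) (neg_lt_neg E.lt)) w))

theorem good_dc {γ : Γ} (hγ : γ < 0) (n : ℕ) :
    Good φ ε t (ex γ • TN φ ε (dc (cs.simple s) (cs.simple t) n false false)) := fun p q => by
  have h1 := ex_smul_mem_ltH (γ := γ) (δ' := 0) (by simpa using hγ.le)
    (E.cp_mul_TN_mul_cp n p q)
  have h2 := add_mem h1 (TN_mem_ltH ε hγ (dc (cs.simple s) (cs.simple t) n p q))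
  rw [smul_sub, sub_add_cancel] at h2
  rwa [mul_smul_comm, smul_mul_assoc]

/-- Expanding the two outer factors `C_s`, the error terms arise by dropping the last letter `s`,
the first one, or both, with a factor `e^{-a}` for each dropped letter. A word that keeps its first
or its last `s` still adds lengths with `t` on that side. -/
theorem good_sandwich (n : ℕ) : Good φ ε t (sandwich (ex (-npar φ ε s)) (TN φ ε (cs.simple s))
    (TN φ ε (cs.simple t)) (n + 1) -
      TN φ ε (dc (cs.simple s) (cs.simple t) (n + 1) false false)) := by
  have hl := E.dih.length_alt
  have hl' := E.dih.symm.length_alt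
  have h1 : TN φ ε (cs.simple s) * TN φ ε (alt (cs.simple t) (cs.simple s) (2 * n + 1)) =
      TN φ ε (alt (cs.simple s) (cs.simple t) (2 * n + 2)) := by
    rw [TN_mul, ← alt_succ]
    rw [← alt_succ, hl, hl', cs.length_simple]
    omega
  have h2 : TN φ ε (alt (cs.simple t) (cs.simple s) (2 * n + 1)) * TN φ ε (cs.simple s) =
      TN φ ε (alt (cs.simple t) (cs.simple s) (2 * n + 2)) := by
    rw [TN_mul, alt_odd_mul]
    rw [alt_odd_mul, hl', hl', cs.length_simple]
  have h3 : TN φ ε (cs.simple s) * TN φ ε (alt (cs.simple t) (cs.simple s) (2 * n + 2)) =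
      TN φ ε (dc (cs.simple s) (cs.simple t) (n + 1) false false) := by
    rw [TN_mul, ← alt_succ, (dc_eq_alt _ _ _ _).1]
    · rfl
    · rw [← alt_succ, hl, hl', cs.length_simple]
      omega
  have h4 : sandwich (ex (-npar φ ε s)) (TN φ ε (cs.simple s)) (TN φ ε (cs.simple t)) (n + 1) -
      TN φ ε (dc (cs.simple s) (cs.simple t) (n + 1) false false) =
      ex (-npar φ ε s) • TN φ ε (alt (cs.simple s) (cs.simple t) (2 * n + 2)) +
      ex (-npar φ ε s) • TN φ ε (alt (cs.simple t) (cs.simple s) (2 * n + 2)) +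
      ex (-npar φ ε s + -npar φ ε s) • TN φ ε (alt (cs.simple t) (cs.simple s) (2 * n + 1)) := by
    rw [sandwich, ← TN_alt φ ε E.dih.symm, ← h3, ← h2, ← h1, ex_add]
    simp only [add_mul, mul_add, smul_mul_assoc, mul_smul_comm, one_mul, mul_one, mul_assoc]
    module
  rw [h4]
  refine ((E.good_left ?_).add (E.good_right ?_)).add (E.good_sq _)
  · rw [← alt_succ, hl, hl']
  · rw [show 2 * n + 2 = 2 * (n + 1) by ring, alt_even, ← cs.length_inv, ← cs.length_inv ((_ : W) ^ _),
      mul_inv_rev, ← inv_pow, mul_inv_rev, cs.inv_simple, cs.inv_simple, ← alt_even, ← alt_succ,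
      hl, hl']

/-- The corrections in `uneqKL` have coefficients `e^{b-a}`, `e^{-a-b}` and `e^{-2a}`. All exponents
are negative, and a negative multiple of `T_w` plus a good element is good for the words `w` at
hand. -/
theorem good_uneqKL (n : ℕ) : Good φ ε t (uneqKL (ex (-npar φ ε s)) (nq φ ε t)
    (TN φ ε (cs.simple s)) (TN φ ε (cs.simple t)) n -
      TN φ ε (dc (cs.simple s) (cs.simple t) n false false)) := by
  have hab : -npar φ ε s + npar φ ε t < 0 := by
    rw [neg_add_lt_iff_lt_add, add_zero]
    exact E.lt
  have hab' : -npar φ ε s + -npar φ ε t < 0 :=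
    lt_of_le_of_lt (add_le_add_right ((neg_nonpos.2 E.nonneg).trans E.nonneg) _) hab
  have haa : -npar φ ε s + -npar φ ε s < 0 := by
    rw [← neg_add, neg_lt_zero]
    exact add_pos E.pos E.pos
  have key : ∀ (n : ℕ) (γ : Γ), γ < 0 → Good φ ε t (uneqKL (ex (-npar φ ε s)) (nq φ ε t)
      (TN φ ε (cs.simple s)) (TN φ ε (cs.simple t)) n -
        TN φ ε (dc (cs.simple s) (cs.simple t) n false false)) →
      Good φ ε t (ex γ • uneqKL (ex (-npar φ ε s)) (nq φ ε t)
        (TN φ ε (cs.simple s)) (TN φ ε (cs.simple t)) n) := by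
    intro n γ hγ h
    have := (h.smul hγ.le).add (E.good_dc hγ n)
    rwa [← smul_add, sub_add_cancel] at this
  induction n using Nat.strong_induction_on with
  | _ n ih =>
    match n with
    | 0 =>
      have h : dc (cs.simple s) (cs.simple t) 0 false false = cs.simple s := by simp [dc, alt]
      rw [h, uneqKL, add_sub_cancel_left, ← TN_one φ ε]
      exact E.good_left (by simp)
    | 1 =>
      have h0 := ih 0 (by omega)
      have := (E.good_sandwich 0).sub ((key _ _ hab h0).sub (key _ _ hab' h0))
      rw [← sub_smul, ex_add, ex_add, ← mul_sub, ← nq] at this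
      rw [uneqKL]
      convert this using 1
      rw [uneqKL]
      abel
    | n + 2 =>
      have h0 := ih n (by omega)
      have h1 := ih (n + 1) (by omega)
      have := ((E.good_sandwich (n + 1)).sub ((key _ _ hab h1).sub (key _ _ hab' h1))).add
        (key _ _ haa h0)
      rw [← sub_smul, ex_add, ex_add, ex_add, ← mul_sub, ← nq] at this
      rw [uneqKL]
      convert this using 1
      abel

theorem isKLN_uKL (n : ℕ) (p q : Bool) :
    IsKLN φ ε (dc (cs.simple s) (cs.simple t) n p q) (uKL φ ε s t n p q) := by
  refine ⟨E.bar_uKL n p q, ?_⟩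
  have := add_mem (E.good_uneqKL n p q) (E.cp_mul_TN_mul_cp n p q)
  rwa [mul_sub, sub_mul, sub_add_sub_cancel] at this

theorem klN_dc (n : ℕ) (p q : Bool) :
    klN φ ε (dc (cs.simple s) (cs.simple t) n p q) = uKL φ ε s t n p q :=
  (E.isKLN_uKL n p q).klN_eq E.dih

theorem klN_one : klN φ ε (1 : W) = 1 := isKLN_one.klN_eq E.dih

theorem klN_t : klN φ ε (cs.simple t) = cp φ ε t true := E.isKLN_cp.klN_eq E.dih

theorem exists_isKL (w : W) : ∃ c, IsKL cs φ w c := by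
  rcases E.dih.cases_dc w with rfl | rfl | ⟨n, p, q, rfl⟩
  · exact ⟨_, isKLN_one.isKL (ε := ε)⟩
  · exact ⟨_, E.isKLN_cp.isKL⟩
  · exact ⟨_, (E.isKLN_uKL n p q).isKL⟩

/-! ### Left ideals -/

omit E in
/-- The elements `≠ 1, t` with a given last letter. -/
def ladder (cs : CoxeterSystem M W) (s t : B) (r : Bool) : Set W :=
  {w | ∃ n p, w = dc (cs.simple s) (cs.simple t) n p r}

omit E in
theorem klN_mem {D : Set W} {w : W} (hw : w ∈ D) : klN φ ε w ∈ klSpan φ D :=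
  (klBasis_mem_iff ε).1 (klBasis_mem_klSpan hw)

theorem mul_mem_klSpan {D : Set W}
    (hD : ∀ w ∈ D, (TN φ ε (cs.simple s) + ex (-npar φ ε s) • 1) * klN φ ε w ∈ klSpan φ D ∧
      cp φ ε t true * klN φ ε w ∈ klSpan φ D)
    (h x : Hecke cs φ) (hx : x ∈ klSpan φ D) : h * x ∈ klSpan φ D := by
  refine mul_mem_of_TN_simple φ ε _ (fun i x hx => ?_) h x hx
  induction hx using Submodule.span_induction with
  | mem x hx =>
    obtain ⟨w, hw, rfl⟩ := hx
    rw [klBasis_eq_smul_klN ε, mul_smul_comm]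
    refine zsmul_mem ?_ _
    have key : ∀ (y : Hecke cs φ) (c : AddMonoidAlgebra ℤ Γ),
        (y + c • 1) * klN φ ε w ∈ klSpan φ D → y * klN φ ε w ∈ klSpan φ D := by
      intro y c h
      have h2 := sub_mem h (Submodule.smul_mem _ c (klN_mem (ε := ε) hw))
      rwa [add_mul, smul_mul_assoc, one_mul, add_sub_cancel_right] at h2
    rcases E.dih.eq_or_eq i with rfl | rfl
    · exact key _ _ (hD w hw).1
    · exact key _ _ (hD w hw).2
  | zero => rw [mul_zero]; exact zero_mem _
  | add a b _ _ ha hb => rw [mul_add]; exact add_mem ha hb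
  | smul r a _ ha => rw [mul_smul_comm]; exact Submodule.smul_mem _ _ ha

/-- The product formulas leave the right factor of `uKL` untouched, so they preserve the last letter
`r` of the ladder. -/
theorem mul_mem_of_ladder {D : Set W} {r : Bool} (hD : ladder cs s t r ⊆ D) {w : W}
    (hw : w ∈ ladder cs s t r) :
    (TN φ ε (cs.simple s) + ex (-npar φ ε s) • 1) * klN φ ε w ∈ klSpan φ D ∧
      cp φ ε t true * klN φ ε w ∈ klSpan φ D := by
  have hm : ∀ n p, uKL φ ε s t n p r ∈ klSpan φ D := fun n p => by
    rw [← E.klN_dc]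
    exact klN_mem (hD ⟨n, p, rfl⟩)
  obtain ⟨n, p, rfl⟩ := hw
  rw [E.klN_dc]
  cases p
  · rw [E.mul_uKL_false, E.cp_mul_uKL_false]
    exact ⟨Submodule.smul_mem _ _ (hm _ _), hm _ _⟩
  · refine ⟨?_, ?_⟩
    · cases n with
      | zero =>
        rw [E.mul_uKL_zero]
        exact add_mem (hm _ _) (Submodule.smul_mem _ _ (hm _ _))
      | succ n =>
        rw [E.mul_uKL_succ]
        exact add_mem (add_mem (hm _ _) (Submodule.smul_mem _ _ (hm _ _))) (hm _ _)
    · rcases E.cp_mul_uKL_true n r with ⟨-, h⟩ | ⟨-, h⟩ <;> rw [h]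
      · exact hm _ _
      · exact Submodule.smul_mem _ _ (hm _ _)

omit E in
theorem uKL_zero (p q : Bool) : uKL φ ε s t 0 p q =
    cp φ ε t p * (TN φ ε (cs.simple s) + ex (-npar φ ε s) • 1) * cp φ ε t q := by
  rw [uKL, uneqKL]

theorem klN_s : klN φ ε (cs.simple s) = TN φ ε (cs.simple s) + ex (-npar φ ε s) • 1 :=
  (isKLN_simple_of_pos E.pos).klN_eq E.dih

theorem klSystem : KLSystem φ s t where
  dih := E.dih
  ex := E.exists_isKL
  span := by
    rw [eq_top_iff]
    rintro x -
    -- The span of all `C_w` is a left ideal, and it contains `C_1 = 1`.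
    have h := E.mul_mem_klSpan (D := Set.univ) (fun w _ => ?_) x 1
    · rw [mul_one, klSpan, Set.image_univ] at h
      refine h ?_
      rw [← E.klN_one]
      exact (klBasis_mem_iff ε).1 (Submodule.subset_span ⟨1, rfl⟩)
    · have hm : ∀ w : W, klN φ ε w ∈ klSpan φ (Set.univ : Set W) := fun w => klN_mem trivial
      rcases E.dih.cases_dc w with rfl | rfl | ⟨n, p, q, rfl⟩
      · rw [E.klN_one, mul_one, mul_one, ← E.klN_s, ← E.klN_t]
        exact ⟨hm _, hm _⟩
      · refine ⟨?_, ?_⟩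
        · have := hm (dc (cs.simple s) (cs.simple t) 0 false true)
          rwa [E.klN_dc, uKL_zero, cp, cond_false, one_mul, ← E.klN_t] at this
        · rw [E.klN_t]
          rcases E.cp_mul_cp with ⟨-, h⟩ | ⟨-, h⟩ <;> rw [h]
          · rw [← E.klN_one]
            exact hm _
          · rw [← E.klN_t]
            exact Submodule.smul_mem _ _ (hm _)
      · exact E.mul_mem_of_ladder (Set.subset_univ _) ⟨n, p, rfl⟩

theorem lower_ladder (r : Bool) : Lower φ .L (ladder cs s t r) :=
  E.klSystem.lower_left_iff.2 (E.mul_mem_klSpan fun _ hw => E.mul_mem_of_ladder subset_rfl hw)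

/-- For `b > 0` the square of `C_t` is a multiple of `C_t`; for `b = 0` it is `1`, and the set would
not be stable. -/
theorem lower_ne_one (ht : 0 < npar φ ε t) : Lower φ .L {w : W | w ≠ 1} := by
  have h1 : ∀ n p q, dc (cs.simple s) (cs.simple t) n p q ≠ 1 := by
    intro n p q h
    have := E.dih.length_dc n p q
    rw [h, cs.length_one] at this
    omega
  refine E.klSystem.lower_left_iff.2 (E.mul_mem_klSpan fun w hw => ?_)
  rcases E.dih.cases_dc w with rfl | rfl | ⟨n, p, q, rfl⟩
  · exact absurd rfl hw
  · refine ⟨?_, ?_⟩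
    · have := klN_mem (φ := φ) (ε := ε) (D := {w : W | w ≠ 1}) (h1 0 false true)
      rwa [E.klN_dc, uKL_zero, cp, cond_false, one_mul, ← E.klN_t] at this
    · rw [E.klN_t]
      rcases E.cp_mul_cp with ⟨h, -⟩ | ⟨-, h⟩
      · exact absurd h ht.ne'
      · rw [h, ← E.klN_t]
        exact Submodule.smul_mem _ _ (klN_mem hw)
  · refine E.mul_mem_of_ladder (r := q) ?_ ⟨n, p, rfl⟩
    rintro _ ⟨n, p, rfl⟩
    exact h1 n p q

/-! ### Generators of the ideals -/

/-- The product formulas, solved for their leading terms, unwind every element of the ladder to its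
bottom element. -/
theorem uKL_mem (n : ℕ) (p r : Bool) : ∃ h, uKL φ ε s t n p r = h * uKL φ ε s t 0 false r := by
  let I : Submodule (AddMonoidAlgebra ℤ Γ) (Hecke cs φ) :=
    LinearMap.range (LinearMap.mulRight (AddMonoidAlgebra ℤ Γ) (uKL φ ε s t 0 false r))
  have hI : ∀ h x, x ∈ I → h * x ∈ I := by
    rintro h _ ⟨y, rfl⟩
    exact ⟨h * y, mul_assoc _ _ _⟩
  suffices h : uKL φ ε s t n p r ∈ I by
    obtain ⟨h, hh⟩ := h
    exact ⟨h, hh.symm⟩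
  have key : uKL φ ε s t n false r ∈ I := by
    induction n using Nat.strong_induction_on with
    | _ n ih =>
      match n with
      | 0 => exact ⟨1, one_mul _⟩
      | 1 =>
        have h0 := ih 0 (by omega)
        rw [eq_sub_of_add_eq (E.mul_uKL_zero r).symm, ← E.cp_mul_uKL_false]
        exact sub_mem (hI _ _ (hI _ _ h0)) (Submodule.smul_mem _ _ h0)
      | n + 2 =>
        have h0 := ih n (by omega)
        have h1 := ih (n + 1) (by omega)
        have h2 := E.mul_uKL_succ n r
        rw [add_assoc] at h2
        rw [eq_sub_of_add_eq h2.symm, ← E.cp_mul_uKL_false]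
        exact sub_mem (hI _ _ (hI _ _ h1)) (add_mem (Submodule.smul_mem _ _ h1) h0)
  cases p
  · exact key
  · rw [← E.cp_mul_uKL_false]
    exact hI _ _ key

omit E in
theorem simple_eq_dc : dc (cs.simple s) (cs.simple t) 0 false false = cs.simple s := by
  simp [dc, alt]

theorem klBasis_mem_left {w : W} (hw : w ∈ ladder cs s t false) :
    ∃ h, klBasis cs φ w = h * klBasis cs φ (cs.simple s) := by
  obtain ⟨n, p, rfl⟩ := hw
  obtain ⟨h, hh⟩ := E.uKL_mem n p false
  rw [← E.klN_dc, ← E.klN_dc, simple_eq_dc, klN, klN] at hh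
  refine ⟨((ε (dc (cs.simple s) (cs.simple t) n p false) : ℤˣ) : ℤ) •
    ((ε (cs.simple s) : ℤˣ) : ℤ) • h, ?_⟩
  rw [smul_mul_assoc, smul_mul_assoc, ← mul_smul_comm, ← hh, smul_smul_units]

theorem klBasis_mem_both {w : W} {r : Bool} (hw : w ∈ ladder cs s t r) :
    ∃ h h', klBasis cs φ w = h * klBasis cs φ (cs.simple s) * h' := by
  obtain ⟨n, p, rfl⟩ := hw
  obtain ⟨h, hh⟩ := E.uKL_mem n p r
  rw [uKL_zero, cp, cond_false, one_mul, ← E.klN_s, ← E.klN_dc, klN, klN] at hh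
  refine ⟨((ε (dc (cs.simple s) (cs.simple t) n p r) : ℤˣ) : ℤ) •
    ((ε (cs.simple s) : ℤˣ) : ℤ) • h, cp φ ε t r, ?_⟩
  simp only [smul_mul_assoc, mul_smul_comm, mul_assoc] at hh ⊢
  rw [← hh, smul_smul_units]

theorem klBasis_mem_right {w : W} (hw : w ∈ ladder cs s t true) :
    ∃ h, klBasis cs φ w = h * klBasis cs φ (cs.simple t) := by
  obtain ⟨n, p, rfl⟩ := hw
  refine ⟨((ε (dc (cs.simple s) (cs.simple t) n p true) : ℤˣ) : ℤ) •
    ((ε (cs.simple t) : ℤˣ) : ℤ) • uKL φ ε s t n p false, ?_⟩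
  have h1 : uKL φ ε s t n p true = uKL φ ε s t n p false * klN φ ε (cs.simple t) := by
    rw [E.klN_t, uKL, uKL]
    simp [cp]
  rw [smul_mul_assoc, smul_mul_assoc, ← mul_smul_comm, klBasis_eq_smul_klN ε, E.klN_dc, h1, klN]

/-! ### Connectivity -/

theorem cellLE_ladder {r : Bool} {w : W} (hw : w ∈ ladder cs s t r) :
    CellEquiv cs φ .L w (dc (cs.simple s) (cs.simple t) 0 false r) := by
  have K := E.klSystem
  obtain ⟨n, p, rfl⟩ := hw
  have hu : ∀ w : W, ∃ u : ℤˣ, klBasis cs φ w = (u : ℤ) • klN φ ε w :=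
    fun w => ⟨_, klBasis_eq_smul_klN ε w⟩
  have arrow : ∀ x y h, K.basis.repr (h * klN φ ε y) x ≠ 0 → CellLE cs φ .L x y := by
    intro x y h hh
    refine Relation.TransGen.single (K.arrow_left_iff.2 ⟨((ε y : ℤˣ) : ℤ) • h, ?_⟩)
    rwa [smul_mul_assoc, ← mul_smul_comm, ← klN]
  have repr : ∀ x y, K.basis.repr (klN φ ε y) x =
      ((ε y : ℤˣ) : ℤ) • Finsupp.single y (1 : AddMonoidAlgebra ℤ Γ) x := by
    intro x y
    rw [klN, map_zsmul, K.repr_klBasis]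
    rfl
  have hself : ∀ y, K.basis.repr (klN φ ε y) y ≠ 0 := by
    intro y
    rw [repr, Finsupp.single_eq_same]
    rcases units_cases (ε y) with h | h <;> rw [h] <;> simp
  have hne : ∀ x y, x ≠ y → K.basis.repr (klN φ ε y) x = 0 := by
    intro x y h
    rw [repr, Finsupp.single_eq_of_ne h, smul_zero]
  have hdc : ∀ n p n' p', 2 * n + p.toNat ≠ 2 * n' + p'.toNat →
      dc (cs.simple s) (cs.simple t) n p r ≠ dc (cs.simple s) (cs.simple t) n' p' r := by
    intro n p n' p' h h'
    have := congrArg cs.length h'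
    rw [E.dih.length_dc, E.dih.length_dc] at this
    omega
  -- Multiplication by `C_t` leads from `(n, false)` to `(n, true)`, and the lowest term of
  -- multiplication by `C_s` leads from `(n + 1, true)` back to `(n, false)`.
  have up : ∀ n, CellLE cs φ .L (dc (cs.simple s) (cs.simple t) n true r)
      (dc (cs.simple s) (cs.simple t) n false r) := fun n => by
    refine arrow _ _ (cp φ ε t true) ?_
    rw [E.klN_dc, E.cp_mul_uKL_false, ← E.klN_dc]
    exact hself _
  have down : ∀ n, CellLE cs φ .L (dc (cs.simple s) (cs.simple t) n false r)
      (dc (cs.simple s) (cs.simple t) (n + 1) true r) := fun n => by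
    refine arrow _ _ (TN φ ε (cs.simple s) + ex (-npar φ ε s) • 1) ?_
    rw [E.klN_dc, E.mul_uKL_succ, ← E.klN_dc, ← E.klN_dc, ← E.klN_dc, map_add, map_add, map_smul,
      Finsupp.add_apply, Finsupp.add_apply, Finsupp.smul_apply, hne, hne, smul_zero, zero_add,
      zero_add]
    · exact hself _
    · exact hdc _ _ _ _ (by simp)
    · exact hdc _ _ _ _ (by simp)
  -- At the bottom there is no lower term. For `b = 0` one returns by `C_t C_t = 1`; for `b > 0` the
  -- term with coefficient `zet`, which is non-zero, does the work.
  have zero : CellLE cs φ .L (dc (cs.simple s) (cs.simple t) 0 false r)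
      (dc (cs.simple s) (cs.simple t) 0 true r) := by
    rcases E.cp_mul_uKL_true 0 r with ⟨-, h⟩ | ⟨h, -⟩
    · refine arrow _ _ (cp φ ε t true) ?_
      rw [E.klN_dc, h, ← E.klN_dc]
      exact hself _
    · refine arrow _ _ (TN φ ε (cs.simple s) + ex (-npar φ ε s) • 1) ?_
      rw [E.klN_dc, E.mul_uKL_zero, ← E.klN_dc, ← E.klN_dc, map_add, map_smul,
        Finsupp.add_apply, Finsupp.smul_apply, hne, zero_add, repr, Finsupp.single_eq_same]
      · rcases units_cases (ε (dc (cs.simple s) (cs.simple t) 0 false r)) with h' | h' <;>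
          rw [h'] <;> simp [E.zet_ne_zero h]
      · exact hdc _ _ _ _ (by simp)
  refine ⟨?_, ?_⟩
  · obtain ⟨h, hh⟩ := E.uKL_mem n p r
    refine arrow _ _ h ?_
    rw [E.klN_dc, ← hh, ← E.klN_dc]
    exact hself _
  · have h1 : ∀ n, CellLE cs φ .L (dc (cs.simple s) (cs.simple t) 0 false r)
        (dc (cs.simple s) (cs.simple t) n true r) := by
      intro n
      induction n with
      | zero => exact zero
      | succ n ih => exact ih.trans ((up n).trans (down n))
    cases p
    · exact (h1 n).trans (up n)
    · exact h1 n

theorem ladder_false : ladder cs s t false = endSet cs s := by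
  ext w
  constructor
  · rintro ⟨n, p, rfl⟩
    exact (E.dih.isRightDescent_dc_left _ _ _).2 rfl
  · intro hw
    rcases E.dih.cases_dc w with rfl | rfl | ⟨n, p, q, rfl⟩
    · exact absurd hw (cs.not_isRightDescent_one s)
    · exact absurd hw E.dih.not_isRightDescent_simple
    · rw [(E.dih.isRightDescent_dc_left _ _ _).1 hw]
      exact ⟨n, p, rfl⟩

end UneqPar

end UnequalKL

/-! ## The cells -/

section Structure

variable {B : Type u} {W : Type v} [Group W] {M : CoxeterMatrix B} {cs : CoxeterSystem M W}

open Classical in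
/-- The rank of an element of an infinite dihedral group. -/
def rank (cs : CoxeterSystem M W) (s t : B) (w : W) : ℕ :=
  if w = 1 then 3 else if w = cs.simple t then 2 else if cs.IsRightDescent w s then 0 else 1

/-- The left, right or two-sided rank. -/
def rankOf (cs : CoxeterSystem M W) (s t : B) : Side → W → ℕ
  | .L, w => rank cs s t w
  | .R, w => rank cs s t w⁻¹
  | .LR, w => rank cs s t w - 1

variable {Γ : Type w} [AddCommGroup Γ] [LinearOrder Γ] [IsOrderedAddMonoid Γ] {φ : SBar cs → Γ}
variable {ε : W →* ℤˣ} {s t : B}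

/-- The condition for the elements of rank `< k` to form a lower set, for the parameters `a`
and `b`. -/
def cutL (a b : Γ) : ℕ → Prop
  | 1 => 0 < a
  | 2 => b < a
  | 3 => 0 < b
  | _ => True

/-- The version of `cutL` for left, right or two-sided cells. -/
def cut (a b : Γ) : Side → ℕ → Prop
  | .L, k => cutL a b k
  | .R, k => cutL a b k
  | .LR, 0 => True
  | .LR, k + 1 => cutL a b (k + 2)

/-- The normalised parameters are ordered: `0 ≤ b ≤ a`. -/
structure NormPar (φ : SBar cs → Γ) (ε : W →* ℤˣ) (s t : B) : Prop where
  dih : InfDihedral cs s t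
  nonneg : 0 ≤ npar φ ε t
  le : npar φ ε t ≤ npar φ ε s

open InfDihedral UneqPar

namespace InfDihedral

variable (hD : InfDihedral cs s t)
include hD

theorem simple_ne_one (i : B) : cs.simple i ≠ 1 := by
  intro h
  have := cs.length_simple i
  rw [h, cs.length_one] at this
  omega

theorem rank_one : rank cs s t (1 : W) = 3 := if_pos rfl

theorem rank_t : rank cs s t (cs.simple t) = 2 := by
  rw [rank, if_neg (hD.simple_ne_one t), if_pos rfl]

theorem rank_le (w : W) : rank cs s t w ≤ 3 := by
  rw [rank]
  split_ifs <;> omega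

theorem rank_lt_three {w : W} : rank cs s t w < 3 ↔ w ≠ 1 := by
  rw [rank]
  split_ifs with h <;> simp [h]

theorem rank_lt_two {w : W} : rank cs s t w < 2 ↔ w ≠ 1 ∧ w ≠ cs.simple t := by
  rw [rank]
  split_ifs with h h' <;> simp_all

theorem rank_lt_one {w : W} : rank cs s t w < 1 ↔ w ∈ endSet cs s := by
  rw [endSet, Set.mem_ofPred_eq, rank]
  split_ifs with h h' h''
  · subst h
    simpa using cs.not_isRightDescent_one s
  · subst h'
    simpa using hD.not_isRightDescent_simple
  · simpa using h''
  · simpa using h''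

theorem rank_dc (n : ℕ) (p q : Bool) :
    rank cs s t (dc (cs.simple s) (cs.simple t) n p q) = q.toNat := by
  have hl := hD.length_dc n p q
  have h1 : dc (cs.simple s) (cs.simple t) n p q ≠ 1 := by
    intro h
    rw [h, cs.length_one] at hl
    omega
  have h2 : dc (cs.simple s) (cs.simple t) n p q ≠ cs.simple t := by
    intro h
    have h3 := hD.isRightDescent_dc_left n p q
    have h4 := hD.isRightDescent_dc_right n p q
    have h5 := congrArg cs.length h
    rw [hl, cs.length_simple] at h5
    have : q = true := h4.1 (by rw [h]; exact isRightDescent_simple_self)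
    rw [this, Bool.toNat_true] at h5
    omega
  have h3 := hD.isRightDescent_dc_left n p q
  rw [rank, if_neg h1, if_neg h2]
  cases q
  · rw [if_pos (h3.2 rfl)]
    rfl
  · rw [if_neg (by rw [h3]; decide)]
    rfl

theorem mem_ladder {r : Bool} {w : W} : w ∈ ladder cs s t r ↔ rank cs s t w = r.toNat := by
  constructor
  · rintro ⟨n, p, rfl⟩
    exact hD.rank_dc n p r
  · intro h
    rcases hD.cases_dc w with rfl | rfl | ⟨n, p, q, rfl⟩
    · rw [hD.rank_one] at h
      cases r <;> simp at h
    · rw [hD.rank_t] at h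
      cases r <;> simp at h
    · rw [hD.rank_dc] at h
      have h' : q = r := by cases q <;> cases r <;> simp_all
      exact ⟨n, p, by rw [h']⟩

theorem eq_of_rank_eq_three {w : W} (h : rank cs s t w = 3) : w = 1 := by
  by_contra h'
  have := hD.rank_lt_three.2 h'
  omega

theorem eq_of_rank_eq_two {w : W} (h : rank cs s t w = 2) : w = cs.simple t := by
  by_contra h'
  have := hD.rank_lt_two (w := w)
  have h3 : w ≠ 1 := by
    rintro rfl
    rw [hD.rank_one] at h
    omega
  have := this.2 ⟨h3, h'⟩
  omega

theorem mem_endSet_right {w : W} : w ∈ endSet cs t ↔ rank cs s t w = 1 ∨ rank cs s t w = 2 := by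
  rw [endSet, Set.mem_ofPred_eq]
  rcases hD.cases_dc w with rfl | rfl | ⟨n, p, q, rfl⟩
  · rw [hD.rank_one]
    simpa using cs.not_isRightDescent_one t
  · rw [hD.rank_t]
    simpa using isRightDescent_simple_self
  · rw [hD.rank_dc]
    refine (hD.isRightDescent_dc_right n p q).trans ?_
    cases q <;> simp

end InfDihedral

namespace NormPar

variable (N : NormPar φ ε s t)
include N

theorem cases : (npar φ ε s = 0 ∧ npar φ ε t = 0) ∨ EqPar φ ε s t (npar φ ε s) ∨
    UneqPar φ ε s t := by
  rcases N.le.lt_or_eq with h | h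
  · exact Or.inr (Or.inr ⟨N.dih, N.nonneg, h⟩)
  · rcases N.nonneg.lt_or_eq with h' | h'
    · exact Or.inr (Or.inl ⟨N.dih, by rwa [← h], rfl, h⟩)
    · exact Or.inl ⟨by rw [← h, h'], h'.symm⟩

theorem isKL_T (h : ∀ i, par cs φ i = 0) (w : W) : IsKL cs φ w (T cs φ w) := by
  induction w using cs.simple_induction_left with
  | one =>
    refine ⟨by rw [T_one, map_one], ?_⟩
    rw [sub_self]
    exact zero_mem _
  | mul_simple_left w i ih =>
    have h1 := KLSystem.isKL_simple_mul (h i) ih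
    obtain ⟨c, hc, h2⟩ := T_simple_mul cs φ i w
    have hc0 : c = 0 := by
      rcases hc with h' | h'
      · exact h'
      · rw [h', qpar, h i, neg_zero, sub_self]
    rwa [h2, hc0, zero_smul, add_zero] at h1

theorem klSystem : KLSystem φ s t := by
  rcases N.cases with ⟨h, h'⟩ | E | E
  · have h0 : ∀ i, par cs φ i = 0 := by
      intro i
      rcases N.dih.eq_or_eq i with rfl | rfl
      · exact npar_eq_zero_iff.1 h
      · exact npar_eq_zero_iff.1 h'
    refine ⟨N.dih, fun w => ⟨_, N.isKL_T h0 w⟩, ?_⟩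
    rw [← span_T cs φ]
    congr 2
    exact funext fun w => (N.isKL_T h0 w).klBasis_eq φ N.dih
  · exact E.klSystem
  · exact E.klSystem

theorem lower_left {k : ℕ} (hk : cutL (npar φ ε s) (npar φ ε t) k) :
    Lower φ .L {w | rank cs s t w < k} := by
  match k with
  | 0 => simpa using lower_empty (φ := φ) .L
  | 1 =>
    have h : {w | rank cs s t w < 1} = endSet cs s := Set.ext fun w => N.dih.rank_lt_one
    rw [h]
    rcases N.cases with ⟨h, h'⟩ | E | E
    · exact absurd h (ne_of_gt hk)
    · exact E.lower_endSet
    · rw [← E.ladder_false]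
      exact E.lower_ladder false
  | 2 =>
    have E : UneqPar φ ε s t := ⟨N.dih, N.nonneg, hk⟩
    have h : {w | rank cs s t w < 2} = ladder cs s t false ∪ ladder cs s t true := by
      ext w
      rw [Set.mem_union, N.dih.mem_ladder, N.dih.mem_ladder, Set.mem_ofPred_eq, Bool.toNat_true,
        Bool.toNat_false]
      omega
    rw [h]
    exact (E.lower_ladder _).union (E.lower_ladder _)
  | 3 =>
    have h : {w | rank cs s t w < 3} = {w | w ≠ 1} := Set.ext fun w => N.dih.rank_lt_three
    rcases N.cases with ⟨h, h'⟩ | E | E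
    · exact absurd h' (ne_of_gt hk)
    · have h : {w | rank cs s t w < 3} = endSet cs s ∪ endSet cs t := by
        ext w
        rw [Set.mem_union, N.dih.mem_endSet_right, ← N.dih.rank_lt_one, Set.mem_ofPred_eq]
        omega
      rw [h]
      exact E.lower_endSet.union E.symm.lower_endSet
    · rw [h]
      exact E.lower_ne_one hk
  | k + 4 =>
    have h : {w | rank cs s t w < k + 4} = Set.univ :=
      Set.eq_univ_of_forall fun w => (N.dih.rank_le w).trans_lt (by omega)
    rw [h]
    exact lower_univ _

/-- Lower sets separate; conversely, each missing cut is a genuine link. For `a = b > 0` all words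
ending in `t` are equivalent to `t`; for `b = 0` one has `T_t C_1 = C_t`; for `a = b = 0` every
`T_i` permutes the `C_w`. -/
theorem cellEquiv_left_iff {x y : W} : CellEquiv cs φ .L x y ↔
    ∀ k, cutL (npar φ ε s) (npar φ ε t) k → (rank cs s t x < k ↔ rank cs s t y < k) := by
  refine ⟨fun h k hk => (N.lower_left hk).mem_iff_of_cellEquiv h, fun h => ?_⟩
  have K := N.klSystem
  have hx := N.dih.rank_le x
  have hy := N.dih.rank_le y
  have h3 : rank cs s t x = 3 → rank cs s t y = 3 → CellEquiv cs φ .L x y := by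
    intro h h'
    rw [N.dih.eq_of_rank_eq_three h, N.dih.eq_of_rank_eq_three h']
    exact K.cellEquiv_refl _ _
  rcases N.cases with ⟨ha, hb⟩ | E | E
  · have h0 : ∀ w, CellEquiv cs φ .L w 1 := by
      intro w
      induction w using cs.simple_induction_left with
      | one => exact K.cellEquiv_refl _ _
      | mul_simple_left w i ih =>
        refine (K.cellEquiv_simple_mul ?_ w).trans ih
        rcases N.dih.eq_or_eq i with rfl | rfl
        · exact npar_eq_zero_iff.1 ha
        · exact npar_eq_zero_iff.1 hb
    exact (h0 x).trans (h0 y).symm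
  · have h1 := h 1 E.pos
    have h2 := h 3 (by rw [E.right]; exact E.pos : 0 < npar φ ε t)
    have key : ∀ x y i, EqPar φ ε i y (npar φ ε s) → x ∈ endSet cs i →
        CellEquiv cs φ .L x (cs.simple i) := by
      intro x y i E hx
      obtain ⟨h, hh⟩ := E.klBasis_mem_of_endSet hx
      exact ⟨Relation.TransGen.single (K.arrow_of_mul_eq h hh.symm), E.simple_cellLE hx⟩
    have hs : ∀ x, rank cs s t x < 1 → CellEquiv cs φ .L x (cs.simple s) := fun x hx =>
      key _ _ _ E (N.dih.rank_lt_one.1 hx)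
    have ht : ∀ x, ¬ rank cs s t x < 1 → rank cs s t x < 3 →
        CellEquiv cs φ .L x (cs.simple t) := fun x hx hx' =>
      key _ _ _ E.symm (N.dih.mem_endSet_right.2 (by omega))
    by_cases h4 : rank cs s t x < 1
    · exact (hs x h4).trans (hs y (h1.1 h4)).symm
    · by_cases h5 : rank cs s t x < 3
      · exact (ht x h4 h5).trans (ht y (mt h1.2 h4) (h2.1 h5)).symm
      · exact h3 (by omega) (by omega)
  · have h1 := h 1 E.pos
    have h2 := h 2 E.lt
    have hs : ∀ x y, ∀ r : Bool, rank cs s t x = r.toNat → rank cs s t y = r.toNat →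
        CellEquiv cs φ .L x y := fun x y r hx hy =>
      (E.cellLE_ladder (N.dih.mem_ladder.2 hx)).trans
        (E.cellLE_ladder (N.dih.mem_ladder.2 hy)).symm
    by_cases h4 : rank cs s t x < 1
    · exact hs x y false (by rw [Bool.toNat_false]; omega) (by rw [Bool.toNat_false]; omega)
    · by_cases h5 : rank cs s t x < 2
      · exact hs x y true (by rw [Bool.toNat_true]; omega) (by rw [Bool.toNat_true]; omega)
      · rcases N.nonneg.lt_or_eq with hb | hb
        · have h6 := h 3 hb
          by_cases h7 : rank cs s t x < 3
          · rw [N.dih.eq_of_rank_eq_two (w := x) (by omega),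
              N.dih.eq_of_rank_eq_two (w := y) (by omega)]
            exact K.cellEquiv_refl _ _
          · exact h3 (by omega) (by omega)
        · have h0 : ∀ w, 2 ≤ rank cs s t w → CellEquiv cs φ .L w 1 := by
            intro w hw
            have hw' := N.dih.rank_le w
            rcases hw.eq_or_lt with h | h
            · rw [N.dih.eq_of_rank_eq_two h.symm]
              have := K.cellEquiv_simple_mul (npar_eq_zero_iff.1 hb.symm) 1
              rwa [mul_one] at this
            · rw [N.dih.eq_of_rank_eq_three (w := w) (by omega)]
              exact K.cellEquiv_refl _ _
          exact (h0 x (by omega)).trans (h0 y (by omega)).symm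

/-- The elements of rank at least `2` are `1` and `t`, and those of rank at least `3` reduce to `1`:
both sets are stable under inversion, so these cuts are two-sided. -/
theorem rank_inv_lt {k : ℕ} (hk : 2 ≤ k) (w : W) :
    rank cs s t w⁻¹ < k ↔ rank cs s t w < k := by
  match k with
  | 2 => rw [N.dih.rank_lt_two, N.dih.rank_lt_two, Ne, inv_eq_one, Ne, inv_eq_iff_eq_inv,
      cs.inv_simple]
  | 3 => rw [N.dih.rank_lt_three, N.dih.rank_lt_three, Ne, inv_eq_one]
  | k + 4 =>
    have h := N.dih.rank_le w
    have h' := N.dih.rank_le w⁻¹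
    omega

theorem lower_rankOf {σ : Side} {k : ℕ} (hk : cut (npar φ ε s) (npar φ ε t) σ k) :
    Lower φ σ {w | rankOf cs s t σ w < k} := by
  have K := N.klSystem
  match σ, k with
  | .L, k => exact N.lower_left hk
  | .R, k =>
    rw [K.lower_inv_iff]
    have h : {w | rankOf cs s t .R w < k}⁻¹ = {w | rank cs s t w < k} := by
      ext w
      rw [Set.mem_inv, Set.mem_ofPred_eq, rankOf, inv_inv, Set.mem_ofPred_eq]
    rw [h]
    exact N.lower_left hk
  | .LR, 0 => simpa using lower_empty (φ := φ) .LR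
  | .LR, k + 1 =>
    have h : {w | rankOf cs s t .LR w < k + 1} = {w | rank cs s t w < k + 2} := by
      ext w
      rw [Set.mem_ofPred_eq, rankOf, Set.mem_ofPred_eq]
      omega
    rw [h]
    refine lower_both (N.lower_left hk) ?_
    rw [K.lower_inv_iff]
    have h : {w | rank cs s t w < k + 2}⁻¹ = {w | rank cs s t w < k + 2} := by
      ext w
      rw [Set.mem_inv, Set.mem_ofPred_eq, N.rank_inv_lt (by omega), Set.mem_ofPred_eq]
    rw [h]
    exact N.lower_left hk

theorem cellEquiv_iff {σ : Side} {x y : W} : CellEquiv cs φ σ x y ↔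
    ∀ k, cut (npar φ ε s) (npar φ ε t) σ k →
      (rankOf cs s t σ x < k ↔ rankOf cs s t σ y < k) := by
  refine ⟨fun h k hk => (N.lower_rankOf hk).mem_iff_of_cellEquiv h, fun h => ?_⟩
  have K := N.klSystem
  match σ with
  | .L => exact N.cellEquiv_left_iff.2 h
  | .R => exact K.cellEquiv_inv_iff.2 (N.cellEquiv_left_iff.2 h)
  | .LR =>
    have toLR : ∀ x y, (∀ k, cutL (npar φ ε s) (npar φ ε t) k →
        (rank cs s t x < k ↔ rank cs s t y < k)) → CellEquiv cs φ .LR x y := fun x y h =>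
      have h' := N.cellEquiv_left_iff.2 h
      ⟨h'.1.left_to_both, h'.2.left_to_both⟩
    have hx := N.dih.rank_le x
    have hy := N.dih.rank_le y
    rcases (N.nonneg.trans N.le).lt_or_eq with ha | ha
    · have hs := N.dih.rank_dc 0 false false
      have hst := N.dih.rank_dc 0 false true
      rw [simple_eq_dc] at hs
      rw [Bool.toNat_false] at hs
      rw [Bool.toNat_true] at hst
      -- The inverses `ts` and `s` both end in `s`, so `st` and `s` lie in one right cell. This
      -- merges the ranks `0` and `1` in the two-sided case.
      have link : CellEquiv cs φ .LR (dc (cs.simple s) (cs.simple t) 0 false true)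
          (cs.simple s) := by
        have h1 : CellEquiv cs φ .R (dc (cs.simple s) (cs.simple t) 0 false true)
            (cs.simple s) := by
          refine K.cellEquiv_inv_iff.2 (N.cellEquiv_left_iff.2 ?_)
          rw [dc_inv, cs.inv_simple, N.dih.rank_dc, hs]
          exact fun _ _ => Iff.rfl
        exact ⟨h1.1.right_to_both, h1.2.right_to_both⟩
      have h1 : ∀ w, rank cs s t w ≤ 1 → CellEquiv cs φ .LR w (cs.simple s) := by
        intro w hw
        by_cases hw0 : rank cs s t w = 0
        · refine toLR _ _ ?_
          rw [hw0, hs]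
          exact fun _ _ => Iff.rfl
        · refine CellEquiv.trans (toLR _ _ ?_) link
          rw [hst, show rank cs s t w = 1 by omega]
          exact fun _ _ => Iff.rfl
      have cut_of : ∀ k, cutL (npar φ ε s) (npar φ ε t) (k + 2) →
          (rank cs s t x < k + 2 ↔ rank cs s t y < k + 2) := by
        intro k hk
        have := h (k + 1) hk
        simp only [rankOf] at this
        omega
      rcases N.le.lt_or_eq with hab | hab
      · have h2 := cut_of 0 hab
        by_cases hx2 : rank cs s t x < 2
        · exact (h1 x (by omega)).trans (h1 y (by omega)).symm
        · refine toLR _ _ fun k hk => ?_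
          match k with
          | 0 => omega
          | 1 => omega
          | k + 2 => exact cut_of k hk
      · have h2 := cut_of 1 (by rw [← hab] at ha; exact ha)
        -- For `a = b` there is no cut between the ranks `1` and `2`: `t` and `st` lie in one left
        -- cell, and `t` joins the large two-sided cell.
        have h3 : ∀ w, rank cs s t w < 3 → CellEquiv cs φ .LR w (cs.simple s) := by
          intro w hw
          by_cases hw0 : rank cs s t w ≤ 1
          · exact h1 w hw0
          · refine CellEquiv.trans (toLR _ _ ?_) (h1 _ hst.le)
            intro k hk
            rw [hst]
            match k with
            | 0 => omega
            | 1 => omega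
            | 2 => exact absurd hab (ne_of_lt hk)
            | k + 3 => omega
        by_cases hx2 : rank cs s t x < 3
        · exact (h3 x hx2).trans (h3 y (h2.1 hx2)).symm
        · refine toLR _ _ fun k hk => ?_
          omega
    · refine toLR _ _ fun k hk => ?_
      have hb : npar φ ε t = 0 := le_antisymm (N.le.trans_eq ha.symm) N.nonneg
      match k with
      | 0 => omega
      | 1 => exact absurd ha (ne_of_lt hk)
      | 2 => exact absurd (hb.trans ha) (ne_of_lt hk)
      | 3 => exact absurd hb (ne_of_gt hk)
      | k + 4 => omega

end NormPar

end Structure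

/-! ## Specialisation to the group algebra -/

section Specialisation

variable {B : Type u} {W : Type v} [Group W] {M : CoxeterMatrix B} {cs : CoxeterSystem M W}
variable {Γ : Type w} [AddCommGroup Γ]

/-- The group algebra, as an algebra over `ℤ[Γ]` through the augmentation. -/
def AugGroupAlgebra (_ : Type w) (W : Type v) : Type v := MonoidAlgebra ℤ W

instance : Ring (AugGroupAlgebra Γ W) := inferInstanceAs (Ring (MonoidAlgebra ℤ W))

instance : Algebra (AddMonoidAlgebra ℤ Γ) (AugGroupAlgebra Γ W) :=
  RingHom.toAlgebra' (S := MonoidAlgebra ℤ W)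
    ((algebraMap ℤ (MonoidAlgebra ℤ W)).comp (aug (Γ := Γ)))
    (fun c x => Algebra.commutes (aug c) x)

/-- The element `w` of the group algebra. -/
def ofW (w : W) : MonoidAlgebra ℤ W := MonoidAlgebra.of ℤ W w

theorem ofW_mul (w w' : W) : ofW (w * w') = ofW w * ofW w' := map_mul _ _ _

theorem ofW_one : ofW (1 : W) = 1 := map_one _

/-- The element `w` of the group algebra. -/
def ofAug (w : W) : AugGroupAlgebra Γ W := ofW w

theorem algebraMap_augGroupAlgebra (γ : Γ) :
    algebraMap (AddMonoidAlgebra ℤ Γ) (AugGroupAlgebra Γ W) (ex γ) = 1 := by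
  have h : algebraMap ℤ (MonoidAlgebra ℤ W) (aug (ex γ)) = 1 := by rw [aug_ex, map_one]
  exact h

variable (φ : SBar cs → Γ)

theorem ofW_rel {x y : FreeAlgebra (AddMonoidAlgebra ℤ Γ) W} (h : HeckeRel cs φ x y) :
    FreeAlgebra.lift (AddMonoidAlgebra ℤ Γ) (A := AugGroupAlgebra Γ W) ofAug x =
      FreeAlgebra.lift (AddMonoidAlgebra ℤ Γ) (A := AugGroupAlgebra Γ W) ofAug y := by
  cases h with
  | one =>
    rw [FreeAlgebra.lift_ι_apply, map_one]
    exact ofW_one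
  | mul w w' h =>
    rw [map_mul, FreeAlgebra.lift_ι_apply, FreeAlgebra.lift_ι_apply, FreeAlgebra.lift_ι_apply]
    exact (ofW_mul w w').symm
  | quad i =>
    rw [map_mul, map_sub, map_add, FreeAlgebra.lift_ι_apply, AlgHom.commutes, AlgHom.commutes,
      map_zero, algebraMap_augGroupAlgebra, algebraMap_augGroupAlgebra]
    have h : (ofW (cs.simple i) - 1) * (ofW (cs.simple i) + 1) = 0 := by
      rw [sub_mul, mul_add, ← ofW_mul, cs.simple_mul_simple_self, ofW_one, one_mul, mul_one]
      abel
    exact h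

/-- The specialisation, as a morphism of algebras. -/
def spAlg : RingQuot (HeckeRel cs φ) →ₐ[AddMonoidAlgebra ℤ Γ] AugGroupAlgebra Γ W :=
  RingQuot.liftAlgHom (AddMonoidAlgebra ℤ Γ)
    ⟨FreeAlgebra.lift (AddMonoidAlgebra ℤ Γ) (A := AugGroupAlgebra Γ W) ofAug,
      fun _ _ h => ofW_rel φ h⟩

/-- The specialisation of the Hecke algebra to the group algebra of `W`. -/
def sp : Hecke cs φ →+* MonoidAlgebra ℤ W := (spAlg φ).toRingHom

theorem sp_T (w : W) : sp φ (T cs φ w) = ofW w := by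
  have h : spAlg φ (RingQuot.mkAlgHom (AddMonoidAlgebra ℤ Γ) (HeckeRel cs φ)
      (FreeAlgebra.ι _ w)) = ofAug w := by
    rw [spAlg, RingQuot.liftAlgHom_mkAlgHom_apply, FreeAlgebra.lift_ι_apply]
  exact h

theorem sp_smul (c : AddMonoidAlgebra ℤ Γ) (h : Hecke cs φ) : sp φ (c • h) = aug c • sp φ h := by
  have h1 : sp φ (algebraMap _ _ c) = algebraMap ℤ (MonoidAlgebra ℤ W) (aug c) :=
    AlgHom.commutes (spAlg φ) c
  rw [Algebra.smul_def, map_mul, h1, ← Algebra.smul_def]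

theorem sp_surjective : Function.Surjective (sp φ) := by
  intro v
  induction v using MonoidAlgebra.induction_on with
  | of w => exact ⟨T cs φ w, sp_T φ w⟩
  | add x y hx hy =>
    obtain ⟨a, rfl⟩ := hx
    obtain ⟨b, rfl⟩ := hy
    exact ⟨a + b, map_add _ _ _⟩
  | smul r x hx =>
    obtain ⟨a, rfl⟩ := hx
    exact ⟨r • a, map_zsmul _ _ _⟩

theorem sp_TN (ε : W →* ℤˣ) (w : W) : sp φ (TN φ ε w) = ((ε w : ℤˣ) : ℤ) • ofW w := by
  rw [TN, map_zsmul, sp_T]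

/-- The anti-involution `w ↦ w⁻¹` of the group algebra. -/
def invW : MonoidAlgebra ℤ W →ₗ[ℤ] MonoidAlgebra ℤ W :=
  MonoidAlgebra.mapDomainLinearMap ℤ ℤ (fun w => w⁻¹)

theorem invW_ofW (w : W) : invW (ofW w) = ofW w⁻¹ :=
  MonoidAlgebra.mapDomainLinearMap_single _ _ _

theorem sp_tau (h : Hecke cs φ) : sp φ (tau φ h) = invW (sp φ h) := by
  induction h using induction_T with
  | hT w => rw [tau_T, sp_T, sp_T, invW_ofW]
  | h0 => rw [map_zero, map_zero, map_zero]
  | hadd x y hx hy => rw [map_add, map_add, map_add, map_add, hx, hy]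
  | hsmul a x hx => rw [map_smul, sp_smul, sp_smul, map_zsmul, hx]

/-! ### The group algebra as a left, right or two-sided module -/

/-- The left factor of an element acting on the group algebra. -/
def lW : (σ : Side) → ActGroup W σ → W
  | .L, g => g
  | .R, _ => 1
  | .LR, g => g.1

/-- The right factor of an element acting on the group algebra. -/
def rW : (σ : Side) → ActGroup W σ → W
  | .L, _ => 1
  | .R, g => MulOpposite.unop g
  | .LR, g => MulOpposite.unop g.2

theorem lW_one (σ : Side) : lW σ (1 : ActGroup W σ) = 1 := by cases σ <;> rfl

theorem rW_one (σ : Side) : rW σ (1 : ActGroup W σ) = 1 := by cases σ <;> rfl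

theorem lW_mul (σ : Side) (g h : ActGroup W σ) : lW σ (g * h) = lW σ g * lW σ h := by
  cases σ
  · rfl
  · exact (one_mul (1 : W)).symm
  · rfl

theorem rW_mul (σ : Side) (g h : ActGroup W σ) : rW σ (g * h) = rW σ h * rW σ g := by
  cases σ
  · exact (one_mul (1 : W)).symm
  · rfl
  · rfl

/-- The action by multiplication on the group algebra. -/
def biAct (σ : Side) : ActGroup W σ →* Module.End ℤ (MonoidAlgebra ℤ W) where
  toFun g := LinearMap.mulLeft ℤ (ofW (lW σ g)) ∘ₗ LinearMap.mulRight ℤ (ofW (rW σ g))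
  map_one' := by
    refine LinearMap.ext fun v => ?_
    simp [lW_one, rW_one, ofW_one]
  map_mul' g h := by
    refine LinearMap.ext fun v => ?_
    simp [lW_mul, rW_mul, ofW_mul, mul_assoc]

/-- The group algebra, as a left, right or two-sided module over itself. -/
def GroupRep (W : Type v) (_ : Side) : Type v := MonoidAlgebra ℤ W

instance (σ : Side) : AddCommGroup (GroupRep W σ) :=
  inferInstanceAs (AddCommGroup (MonoidAlgebra ℤ W))

instance (σ : Side) : Module (MonoidAlgebra ℤ (ActGroup W σ)) (GroupRep W σ) :=
  Module.compHom (MonoidAlgebra ℤ W)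
    (MonoidAlgebra.lift ℤ (Module.End ℤ (MonoidAlgebra ℤ W)) (ActGroup W σ) (biAct σ)).toRingHom

/-- The identification of the group algebra with the module `GroupRep`. -/
def toRep (σ : Side) : MonoidAlgebra ℤ W ≃+ GroupRep W σ := AddEquiv.refl _

theorem of_smul_toRep (σ : Side) (g : ActGroup W σ) (v : MonoidAlgebra ℤ W) :
    MonoidAlgebra.of ℤ (ActGroup W σ) g • toRep σ v =
      toRep σ (ofW (lW σ g) * v * ofW (rW σ g)) := by
  have h : MonoidAlgebra.lift ℤ (Module.End ℤ (MonoidAlgebra ℤ W)) (ActGroup W σ) (biAct σ)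
      (MonoidAlgebra.of ℤ (ActGroup W σ) g) v = ofW (lW σ g) * v * ofW (rW σ g) := by
    rw [MonoidAlgebra.lift_of]
    exact (mul_assoc _ _ _).symm
  exact h

theorem act_tmul (σ : Side) {I J : Submodule (AddMonoidAlgebra ℤ Γ) (Hecke cs φ)}
    (hI : IsIdealOf cs φ σ I) (hJ : IsIdealOf cs φ σ J) (g : ActGroup W σ) (z : AugInt Γ) (x : I) :
    ∃ y : I, y.1 = T cs φ (lW σ g) * x.1 * T cs φ (rW σ g) ∧
      act cs φ σ hI hJ g (z ⊗ₜ Submodule.Quotient.mk x) = z ⊗ₜ Submodule.Quotient.mk y := by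
  cases σ
  · refine ⟨⟨T cs φ g * x.1, hI.1 trivial _ _ x.2⟩, ?_, rfl⟩
    rw [rW, T_one, mul_one]
    rfl
  · refine ⟨⟨x.1 * T cs φ (MulOpposite.unop g), hI.2 trivial _ _ x.2⟩, ?_, rfl⟩
    rw [lW, T_one, one_mul]
    rfl
  · exact ⟨⟨T cs φ g.1 * (x.1 * T cs φ (MulOpposite.unop g.2)),
      hI.1 trivial _ _ (hI.2 trivial _ _ x.2)⟩, (mul_assoc _ _ _).symm, rfl⟩

end Specialisation

/-- An additive map that commutes with the action of a group is linear over the group ring. -/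
def linOfComm {G A A' : Type*} [Monoid G] [AddCommGroup A] [AddCommGroup A']
    [Module (MonoidAlgebra ℤ G) A] [Module (MonoidAlgebra ℤ G) A'] (f : A →+ A')
    (h : ∀ g a, f (MonoidAlgebra.of ℤ G g • a) = MonoidAlgebra.of ℤ G g • f a) :
    A →ₗ[MonoidAlgebra ℤ G] A' where
  toFun := f
  map_add' := f.map_add
  map_smul' r a := by
    induction r using MonoidAlgebra.induction_on with
    | of g => exact h g a
    | add x y hx hy => rw [add_smul, map_add, hx, hy, RingHom.id_apply, RingHom.id_apply,
        RingHom.id_apply, add_smul]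
    | smul r x hx => rw [RingHom.id_apply, smul_assoc, smul_assoc, map_zsmul, hx, RingHom.id_apply]

/-- An additive subgroup stable under the action of a group is a submodule over the group ring. -/
def subOfComm {G A : Type*} [Monoid G] [AddCommGroup A] [Module (MonoidAlgebra ℤ G) A]
    (P : AddSubgroup A) (h : ∀ g, ∀ a ∈ P, MonoidAlgebra.of ℤ G g • a ∈ P) :
    Submodule (MonoidAlgebra ℤ G) A where
  carrier := P
  zero_mem' := P.zero_mem
  add_mem' := P.add_mem
  smul_mem' r a ha := by
    induction r using MonoidAlgebra.induction_on with
    | of g => exact h g a ha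
    | add x y hx hy =>
      rw [add_smul]
      exact P.add_mem hx hy
    | smul r x hx =>
      rw [smul_assoc]
      exact P.zsmul_mem hx r

/-! ## The specialised cell modules inside the group algebra -/

section CellModules

variable {B : Type u} {W : Type v} [Group W] {M : CoxeterMatrix B} {cs : CoxeterSystem M W}
variable {Γ : Type w} [AddCommGroup Γ] {φ : SBar cs → Γ}

/-- The image in the group algebra of an ideal of the Hecke algebra. -/
def idealImage {σ : Side} {I : Submodule (AddMonoidAlgebra ℤ Γ) (Hecke cs φ)}
    (hI : IsIdealOf cs φ σ I) : Submodule (MonoidAlgebra ℤ (ActGroup W σ)) (GroupRep W σ) :=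
  subOfComm ((I.toAddSubgroup.map (sp φ).toAddMonoidHom).map (toRep σ).toAddMonoidHom) (by
    rintro g _ ⟨_, ⟨x, hx, rfl⟩, rfl⟩
    refine ⟨_, ⟨T cs φ (lW σ g) * x * T cs φ (rW σ g), ?_, rfl⟩, ?_⟩
    · cases σ
      · rw [rW, T_one, mul_one]
        exact hI.1 trivial _ _ hx
      · rw [lW, T_one, one_mul]
        exact hI.2 trivial _ _ hx
      · exact hI.2 trivial _ _ (hI.1 trivial _ _ hx)
    · have h : sp φ (T cs φ (lW σ g) * x * T cs φ (rW σ g)) =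
          ofW (lW σ g) * sp φ x * ofW (rW σ g) := by
        rw [map_mul, map_mul, sp_T, sp_T]
      refine (congrArg (toRep σ) h).trans (of_smul_toRep σ g (sp φ x)).symm)

theorem mem_idealImage {σ : Side} {I : Submodule (AddMonoidAlgebra ℤ Γ) (Hecke cs φ)}
    (hI : IsIdealOf cs φ σ I) {v : GroupRep W σ} :
    v ∈ idealImage hI ↔ ∃ x ∈ I, toRep σ (sp φ x) = v := by
  constructor
  · rintro ⟨_, ⟨x, hx, rfl⟩, rfl⟩
    exact ⟨x, hx, rfl⟩
  · rintro ⟨x, hx, rfl⟩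
    exact ⟨_, ⟨x, hx, rfl⟩, rfl⟩

theorem spec_eq_tmul {I J : Submodule (AddMonoidAlgebra ℤ Γ) (Hecke cs φ)} (y : Spec cs φ I J) :
    ∃ x : I, y = (show AugInt Γ from (1 : ℤ)) ⊗ₜ Submodule.Quotient.mk x := by
  induction y using TensorProduct.induction_on with
  | zero => exact ⟨0, by rw [Submodule.Quotient.mk_zero, TensorProduct.tmul_zero]⟩
  | tmul z m =>
    obtain ⟨x, rfl⟩ := Submodule.Quotient.mk_surjective _ m
    have h : z = (show ℤ from z) • (show AugInt Γ from (1 : ℤ)) := by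
      exact (mul_one (show ℤ from z)).symm
    refine ⟨(show ℤ from z) • x, ?_⟩
    conv_lhs => rw [h]
    rw [TensorProduct.smul_tmul]
    rfl
  | add a b ha hb =>
    obtain ⟨x, rfl⟩ := ha
    obtain ⟨y, rfl⟩ := hb
    exact ⟨x + y, by rw [Submodule.Quotient.mk_add, TensorProduct.tmul_add]⟩

/-- The additive map `ℤ ⊗ (I / J) → Q` induced by an additive map `I → Q` that kills `J` and is
compatible with the augmentation. -/
def specLift {I J : Submodule (AddMonoidAlgebra ℤ Γ) (Hecke cs φ)} {Q : Type*} [AddCommGroup Q]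
    (f : I →+ Q) (hJ : ∀ x : I, x.1 ∈ J → f x = 0)
    (hf : ∀ (c : AddMonoidAlgebra ℤ Γ) (x : I), f (c • x) = aug c • f x) : Spec cs φ I J →+ Q :=
  TensorProduct.liftAddHom
    { toFun := fun z => (show ℤ from z) • QuotientAddGroup.lift (J.submoduleOf I).toAddSubgroup f
        (fun x hx => hJ x hx)
      map_zero' := zero_smul ℤ _
      map_add' := fun a b => add_smul (show ℤ from a) (show ℤ from b) _ }
    (by
      intro c z m
      obtain ⟨x, rfl⟩ := Submodule.Quotient.mk_surjective _ m
      have h1 : (aug c * (show ℤ from z)) • f x = (show ℤ from z) • f (c • x) := by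
        rw [hf, smul_smul, mul_comm]
      exact h1)

theorem specLift_tmul {I J : Submodule (AddMonoidAlgebra ℤ Γ) (Hecke cs φ)} {Q : Type*}
    [AddCommGroup Q] (f : I →+ Q) (hJ : ∀ x : I, x.1 ∈ J → f x = 0)
    (hf : ∀ (c : AddMonoidAlgebra ℤ Γ) (x : I), f (c • x) = aug c • f x) (z : AugInt Γ) (x : I) :
    specLift (J := J) f hJ hf (z ⊗ₜ Submodule.Quotient.mk x) = (show ℤ from z) • f x := rfl

variable [LinearOrder Γ] [IsOrderedAddMonoid Γ] {s t : B}

namespace KLSystem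

variable (K : KLSystem φ s t)
include K

/-- The augmented coordinate on `C_x` is additive and multiplies scalars by their augmentation, so
it factors through the group algebra; `θ` is the factorisation, fixed by its values on `W`. -/
theorem aug_repr_eq_zero {h : Hecke cs φ} (hh : sp φ h = 0) (x : W) :
    aug (K.basis.repr h x) = 0 := by
  let θ : MonoidAlgebra ℤ W →ₗ[ℤ] ℤ :=
    Finsupp.linearCombination ℤ (fun w => aug (K.basis.repr (T cs φ w) x)) ∘ₗ
      (MonoidAlgebra.coeffLinearEquiv ℤ).toLinearMap
  have hθ : θ (sp φ h) = aug (K.basis.repr h x) := by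
    clear hh
    induction h using induction_T with
    | hT w =>
      rw [sp_T]
      simp [θ, ofW]
    | h0 => simp
    | hadd x y hx hy =>
      rw [map_add, map_add, map_add, Finsupp.add_apply, map_add, ← hx, ← hy]
    | hsmul a x hx =>
      rw [sp_smul, map_smul, map_smul, Finsupp.smul_apply, smul_eq_mul, smul_eq_mul, map_mul, ← hx]
  rw [← hθ, hh, map_zero]

variable {σ : Side}

/-- The image in the group algebra of the span of a lower set. -/
abbrev lowerImage {D : Set W} (hD : Lower φ σ D) :
    Submodule (MonoidAlgebra ℤ (ActGroup W σ)) (GroupRep W σ) :=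
  idealImage (K.isIdealOf_klSpan hD)

theorem lowerImage_mono {D D' : Set W} (hD : Lower φ σ D) (hD' : Lower φ σ D') (h : D ⊆ D') :
    K.lowerImage hD ≤ K.lowerImage hD' := by
  intro v hv
  obtain ⟨x, hx, rfl⟩ := (mem_idealImage _).1 hv
  exact (mem_idealImage _).2 ⟨x, klSpan_mono h hx, rfl⟩

/-- Expand the element on the `C_w`. Those with `w ∈ D'` die in the quotient; for the others, the
tensor product sees only the augmentation of the coefficient, which is zero. -/
theorem tmul_eq_zero {D D' : Set W} {I J : Submodule (AddMonoidAlgebra ℤ Γ) (Hecke cs φ)}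
    (hI : I = klSpan φ D) (hJ : J = klSpan φ D') (x : I)
    (hx : ∀ w ∈ D, w ∉ D' → aug (K.basis.repr x.1 w) = 0) :
    ((show AugInt Γ from (1 : ℤ)) ⊗ₜ Submodule.Quotient.mk x : Spec cs φ I J) = 0 := by
  classical
  subst hI
  let L : ↥(klSpan φ D) →ₗ[AddMonoidAlgebra ℤ Γ] Spec cs φ (klSpan φ D) J :=
    (TensorProduct.mk _ _ _ (show AugInt Γ from (1 : ℤ))) ∘ₗ (J.submoduleOf (klSpan φ D)).mkQ
  -- The value outside `D` is arbitrary: an element of `klSpan φ D` has no coordinate there.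
  let b : W → Spec cs φ (klSpan φ D) J := fun w =>
    if h : w ∈ D then L ⟨klBasis cs φ w, klBasis_mem_klSpan h⟩ else 0
  have key : ∃ h : x.1 ∈ klSpan φ D,
      L ⟨x.1, h⟩ = K.basis.constr (AddMonoidAlgebra ℤ Γ) b x.1 := by
    refine K.klSpan_induction (p := fun x => ∃ h : x ∈ klSpan φ D,
      L ⟨x, h⟩ = K.basis.constr (AddMonoidAlgebra ℤ Γ) b x) ?_ ?_ ?_ ?_ x.2
    · refine ⟨zero_mem _, ?_⟩
      rw [map_zero]
      exact map_zero L
    · intro w hw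
      refine ⟨klBasis_mem_klSpan hw, ?_⟩
      conv_rhs => rw [← K.coe_basis]
      rw [Module.Basis.constr_basis, show b w = _ from dif_pos hw]
    · rintro x y ⟨hx, hx'⟩ ⟨hy, hy'⟩
      refine ⟨add_mem hx hy, ?_⟩
      rw [map_add, ← hx', ← hy', ← map_add]
      rfl
    · rintro a x ⟨hx, hx'⟩
      refine ⟨Submodule.smul_mem _ _ hx, ?_⟩
      rw [map_smul, ← hx', ← map_smul]
      rfl
  obtain ⟨h, hh⟩ := key
  refine Eq.trans (show _ = L ⟨x.1, h⟩ from rfl) (hh.trans ?_)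
  rw [Module.Basis.constr_apply]
  refine Finset.sum_eq_zero fun w _ => ?_
  show K.basis.repr x.1 w • b w = 0
  by_cases hw : w ∈ D
  · have hb : b w = L ⟨klBasis cs φ w, klBasis_mem_klSpan hw⟩ := dif_pos hw
    rw [hb]
    by_cases hw' : w ∈ D'
    · have h0 : (J.submoduleOf (klSpan φ D)).mkQ ⟨klBasis cs φ w, klBasis_mem_klSpan hw⟩ = 0 := by
        rw [Submodule.mkQ_apply, Submodule.Quotient.mk_eq_zero]
        show klBasis cs φ w ∈ J
        rw [hJ]
        exact klBasis_mem_klSpan hw'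
      rw [LinearMap.comp_apply, h0, map_zero, smul_zero]
    · rw [LinearMap.comp_apply, TensorProduct.mk_apply, TensorProduct.smul_tmul']
      have h0 : K.basis.repr x.1 w • (show AugInt Γ from (1 : ℤ)) = 0 := by
        have : aug (K.basis.repr x.1 w) * (1 : ℤ) = 0 := by rw [hx w hw hw', zero_mul]
        exact this
      rw [h0, TensorProduct.zero_tmul]
  · have hb : b w = 0 := dif_neg hw
    rw [hb, smul_zero]

/-- Any two lower sets with difference `C` compute the cell module, and they do so inside the group
algebra. This makes modules for different parameters comparable. The delicate point is injectivity,
which rests on `aug_repr_eq_zero`. -/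
theorem cellModule_equiv {C E E' : Set W} (hC : IsCell cs φ σ C) (hE : Lower φ σ E)
    (hE' : Lower φ σ E') (hEE' : E \ E' = C) :
    Nonempty (ZCellModule cs φ σ C ≃ₗ[MonoidAlgebra ℤ (ActGroup W σ)]
      (↥(K.lowerImage hE) ⧸ (K.lowerImage hE').submoduleOf (K.lowerImage hE))) := by
  have hI := K.idealLE_eq σ C
  have hJ := K.idealLT_eq hC
  have hsub : {w | ∃ c ∈ C, CellLE cs φ σ w c} ⊆ E := by
    rintro w ⟨c, hc, hwc⟩
    rw [← hEE'] at hc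
    exact hE.mem_of_cellLE hwc hc.1
  have hsub' : {w | (∃ c ∈ C, CellLE cs φ σ w c) ∧ w ∉ C} ⊆ E' := by
    rintro w ⟨hw, hw'⟩
    by_contra h
    exact hw' (hEE' ▸ ⟨hsub hw, h⟩)
  let Q := ↥(K.lowerImage hE) ⧸ (K.lowerImage hE').submoduleOf (K.lowerImage hE)
  have hmem : ∀ x : idealLE cs φ σ C, toRep σ (sp φ x.1) ∈ K.lowerImage hE := fun x =>
    (mem_idealImage _).2 ⟨x.1, klSpan_mono hsub (hI ▸ x.2), rfl⟩
  let f : idealLE cs φ σ C →+ Q :=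
    { toFun := fun x => Submodule.Quotient.mk ⟨toRep σ (sp φ x.1), hmem x⟩
      map_zero' := by
        rw [Submodule.Quotient.mk_eq_zero]
        show toRep σ (sp φ 0) ∈ K.lowerImage hE'
        rw [map_zero, map_zero]
        exact zero_mem _
      map_add' := by
        intro x y
        rw [← Submodule.Quotient.mk_add]
        congr 1
        refine Subtype.ext ?_
        show toRep σ (sp φ (x.1 + y.1)) = toRep σ (sp φ x.1) + toRep σ (sp φ y.1)
        rw [map_add, map_add] }
  have hfJ : ∀ x : idealLE cs φ σ C, x.1 ∈ idealLT cs φ σ C → f x = 0 := by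
    intro x hx
    refine (Submodule.Quotient.mk_eq_zero _).2 ?_
    show toRep σ (sp φ x.1) ∈ K.lowerImage hE'
    exact (mem_idealImage _).2 ⟨x.1, klSpan_mono hsub' (hJ ▸ hx), rfl⟩
  have hfs : ∀ (c : AddMonoidAlgebra ℤ Γ) (x : idealLE cs φ σ C), f (c • x) = aug c • f x := by
    intro c x
    refine congrArg (Submodule.Quotient.mk (p := (K.lowerImage hE').submoduleOf (K.lowerImage hE)))
      (a₁ := ⟨toRep σ (sp φ (c • x.1)), hmem (c • x)⟩)
      (a₂ := aug c • ⟨toRep σ (sp φ x.1), hmem x⟩) (Subtype.ext ?_)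
    show toRep σ (sp φ (c • x.1)) = aug c • toRep σ (sp φ x.1)
    rw [sp_smul, map_zsmul]
  let F : ZCellModule cs φ σ C →+ Q := specLift f hfJ hfs
  have hF : ∀ z x, F (z ⊗ₜ Submodule.Quotient.mk x) = (show ℤ from z) • f x :=
    specLift_tmul f hfJ hfs
  have hF1 : ∀ x, F ((show AugInt Γ from (1 : ℤ)) ⊗ₜ Submodule.Quotient.mk x) = f x := fun x =>
    (hF _ x).trans (one_smul ℤ (f x))
  have hcomm : ∀ g y, F (MonoidAlgebra.of ℤ (ActGroup W σ) g • y) =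
      MonoidAlgebra.of ℤ (ActGroup W σ) g • F y := by
    intro g y
    obtain ⟨x, rfl⟩ := spec_eq_tmul (cs := cs) (φ := φ) y
    obtain ⟨x', hx', hact⟩ := act_tmul φ σ (isIdealOf_idealSpan cs φ σ _)
      (isIdealOf_idealSpan cs φ σ _) g (show AugInt Γ from (1 : ℤ)) x
    have h1 : MonoidAlgebra.of ℤ (ActGroup W σ) g •
        (show ZCellModule cs φ σ C from
          (show AugInt Γ from (1 : ℤ)) ⊗ₜ Submodule.Quotient.mk x) =
        ((show AugInt Γ from (1 : ℤ)) ⊗ₜ Submodule.Quotient.mk x' :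
          Spec cs φ (idealLE cs φ σ C) (idealLT cs φ σ C)) := by
      refine Eq.trans ?_ hact
      have := MonoidAlgebra.lift_of (R := ℤ) (act cs φ σ (I := idealLE cs φ σ C)
        (J := idealLT cs φ σ C) (isIdealOf_idealSpan cs φ σ _) (isIdealOf_idealSpan cs φ σ _)) g
      exact congrArg (fun f => f ((show AugInt Γ from (1 : ℤ)) ⊗ₜ Submodule.Quotient.mk x)) this
    refine (congrArg F h1).trans ((hF1 x').trans ?_)
    refine Eq.trans ?_ (congrArg (fun y => MonoidAlgebra.of ℤ (ActGroup W σ) g • y) (hF1 x)).symm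
    refine Eq.trans ?_ (Submodule.Quotient.mk_smul _ _ _)
    refine congrArg (Submodule.Quotient.mk (p := (K.lowerImage hE').submoduleOf (K.lowerImage hE)))
      (a₁ := ⟨toRep σ (sp φ x'.1), hmem x'⟩)
      (a₂ := MonoidAlgebra.of ℤ (ActGroup W σ) g • ⟨toRep σ (sp φ x.1), hmem x⟩) (Subtype.ext ?_)
    show toRep σ (sp φ x'.1) = MonoidAlgebra.of ℤ (ActGroup W σ) g • toRep σ (sp φ x.1)
    have h2 : sp φ x'.1 = ofW (lW σ g) * sp φ x.1 * ofW (rW σ g) := by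
      rw [hx', map_mul, map_mul, sp_T, sp_T]
    rw [of_smul_toRep]
    exact congrArg (toRep σ) h2
  refine ⟨LinearEquiv.ofBijective (linOfComm F hcomm) ⟨?_, ?_⟩⟩
  · refine (injective_iff_map_eq_zero F).2 fun y hy => ?_
    obtain ⟨x, rfl⟩ := spec_eq_tmul (cs := cs) (φ := φ) y
    replace hy := (hF1 x).symm.trans hy
    have hy' : toRep σ (sp φ x.1) ∈ K.lowerImage hE' := (Submodule.Quotient.mk_eq_zero
      ((K.lowerImage hE').submoduleOf (K.lowerImage hE)) (x := ⟨_, hmem x⟩)).1 hy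
    -- Modulo the kernel of `sp`, the element `x` agrees with `j`, which has no coordinates on `C`;
    -- hence the coordinates of `x` on `C` have augmentation zero.
    obtain ⟨j, hj, hj'⟩ := (mem_idealImage _).1 hy'
    have h0 : sp φ (x.1 - j) = 0 := by
      rw [map_sub, (toRep σ).injective hj', sub_self]
    refine K.tmul_eq_zero hI hJ x fun w hw hw' => ?_
    have h1 := K.aug_repr_eq_zero h0 w
    have h2 : K.basis.repr j w = 0 := by
      by_contra h
      have hwE := K.mem_klSpan.1 hj w h
      have hwC : w ∈ C := by
        by_contra hC'
        exact hw' ⟨hw, hC'⟩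
      rw [← hEE'] at hwC
      exact hwC.2 hwE
    rwa [map_sub, Finsupp.sub_apply, h2, sub_zero] at h1
  · intro q
    obtain ⟨⟨v, hv⟩, rfl⟩ := Submodule.Quotient.mk_surjective _ q
    obtain ⟨y, hy, rfl⟩ := (mem_idealImage _).1 hv
    -- For surjectivity, drop the components along `E'`; what is left is supported on `C`.
    have hdec : ∃ x ∈ idealLE cs φ σ C, y - x ∈ klSpan φ E' := by
      refine K.klSpan_induction (p := fun y => ∃ x ∈ idealLE cs φ σ C, y - x ∈ klSpan φ E')
        ?_ ?_ ?_ ?_ hy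
      · exact ⟨0, zero_mem _, by rw [sub_zero]; exact zero_mem _⟩
      · intro w hw
        by_cases hw' : w ∈ E'
        · exact ⟨0, zero_mem _, by rw [sub_zero]; exact klBasis_mem_klSpan hw'⟩
        · refine ⟨klBasis cs φ w, ?_, by rw [sub_self]; exact zero_mem _⟩
          rw [hI]
          exact klBasis_mem_klSpan ⟨w, hEE' ▸ ⟨hw, hw'⟩, K.cellLE_refl _ _⟩
      · rintro a b ⟨x, hx, hax⟩ ⟨y, hy, hby⟩
        refine ⟨x + y, add_mem hx hy, ?_⟩
        rw [add_sub_add_comm]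
        exact add_mem hax hby
      · rintro r a ⟨x, hx, hax⟩
        refine ⟨r • x, Submodule.smul_mem _ _ hx, ?_⟩
        rw [← smul_sub]
        exact Submodule.smul_mem _ _ hax
    obtain ⟨x, hx, hxy⟩ := hdec
    refine ⟨(show AugInt Γ from (1 : ℤ)) ⊗ₜ Submodule.Quotient.mk ⟨x, hx⟩, ?_⟩
    refine (hF1 ⟨x, hx⟩).trans ?_
    refine (Submodule.Quotient.eq _).2 ?_
    show toRep σ (sp φ x) - toRep σ (sp φ y) ∈ K.lowerImage hE'
    refine (mem_idealImage _).2 ⟨x - y, ?_, ?_⟩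
    · rw [← neg_sub]
      exact neg_mem hxy
    · rw [map_sub, map_sub]

end KLSystem

end CellModules

/-! ## Independence of the parameters -/

section Independence

variable {B : Type u} {W : Type v} [Group W] {M : CoxeterMatrix B} {cs : CoxeterSystem M W}
variable {Γ : Type w} [AddCommGroup Γ] {φ : SBar cs → Γ} {ε : W →* ℤˣ} {s t : B}

/-- The image in the group algebra of the normalised element `C_i` with non-zero parameter. -/
def simpleKL (cs : CoxeterSystem M W) (ε : W →* ℤˣ) (i : B) : MonoidAlgebra ℤ W :=
  ((ε (cs.simple i) : ℤˣ) : ℤ) • ofW (cs.simple i) + 1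

/-- Generators of the image in the group algebra of the span of the elements of rank `< k`. -/
def idealGen (cs : CoxeterSystem M W) (ε : W →* ℤˣ) (s t : B) : ℕ → Set (MonoidAlgebra ℤ W)
  | 0 => ∅
  | 1 => {x | ∃ u, x = u * simpleKL cs ε s}
  | 2 => {x | ∃ u v, x = u * simpleKL cs ε s * v}
  | 3 => {x | ∃ u, x = u * simpleKL cs ε s ∨ x = u * simpleKL cs ε t}
  | _ => Set.univ

variable [LinearOrder Γ] [IsOrderedAddMonoid Γ]

open InfDihedral UneqPar

/-- Here the parameter disappears: as soon as it is positive, its exponential specialises to `1`,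
whatever its size. -/
theorem sp_klBasis_simple (hD : InfDihedral cs s t) {i : B} (hi : 0 < npar φ ε i) :
    sp φ (klBasis cs φ (cs.simple i)) = ((ε (cs.simple i) : ℤˣ) : ℤ) • simpleKL cs ε i := by
  rw [klBasis_eq_smul_klN ε, (isKLN_simple_of_pos hi).klN_eq hD, map_zsmul, map_add, sp_TN,
    sp_smul, aug_ex, one_smul, map_one, simpleKL]

theorem KLSystem.tau_mem_klSpan (K : KLSystem φ s t) {D : Set W} {x : Hecke cs φ}
    (hx : x ∈ klSpan φ D) : tau φ x ∈ klSpan φ D⁻¹ := by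
  refine K.mem_klSpan.2 fun w hw => ?_
  rw [K.tau_basis_repr] at hw
  exact K.mem_klSpan.1 hx _ hw

namespace NormPar

variable (N : NormPar φ ε s t)
include N

theorem klBasis_mem_one (ha : 0 < npar φ ε s) {w : W} (hw : rank cs s t w < 1) :
    ∃ h, klBasis cs φ w = h * klBasis cs φ (cs.simple s) := by
  rcases N.cases with ⟨h, h'⟩ | E | E
  · exact absurd h (ne_of_gt ha)
  · exact E.klBasis_mem_of_endSet (N.dih.rank_lt_one.1 hw)
  · refine E.klBasis_mem_left ?_
    rw [E.ladder_false]
    exact N.dih.rank_lt_one.1 hw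

theorem klBasis_mem_two (hab : npar φ ε t < npar φ ε s) {w : W} (hw : rank cs s t w < 2) :
    ∃ h h', klBasis cs φ w = h * klBasis cs φ (cs.simple s) * h' := by
  have E : UneqPar φ ε s t := ⟨N.dih, N.nonneg, hab⟩
  by_cases h : rank cs s t w = 0
  · exact E.klBasis_mem_both (r := false) (N.dih.mem_ladder.2 h)
  · exact E.klBasis_mem_both (r := true) (N.dih.mem_ladder.2 (by rw [Bool.toNat_true]; omega))

theorem klBasis_mem_three (hb : 0 < npar φ ε t) {w : W} (hw : rank cs s t w < 3) :
    ∃ h, klBasis cs φ w = h * klBasis cs φ (cs.simple s) ∨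
      klBasis cs φ w = h * klBasis cs φ (cs.simple t) := by
  by_cases h : rank cs s t w < 1
  · obtain ⟨h, hh⟩ := N.klBasis_mem_one (hb.trans_le N.le) h
    exact ⟨h, Or.inl hh⟩
  · rcases N.cases with ⟨-, h'⟩ | E | E
    · exact absurd h' (ne_of_gt hb)
    · obtain ⟨h, hh⟩ := E.symm.klBasis_mem_of_endSet (w := w)
        (N.dih.mem_endSet_right.2 (by omega))
      exact ⟨h, Or.inr hh⟩
    · by_cases h2 : rank cs s t w = 2
      · rw [N.dih.eq_of_rank_eq_two h2]
        exact ⟨1, Or.inr (one_mul _).symm⟩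
      · obtain ⟨h, hh⟩ := E.klBasis_mem_right (w := w)
          (N.dih.mem_ladder.2 (by rw [Bool.toNat_true]; omega))
        exact ⟨h, Or.inr hh⟩

theorem rank_s : rank cs s t (cs.simple s) = 0 := by
  have := N.dih.rank_dc 0 false false
  rwa [simple_eq_dc] at this

/-- The span of the elements of rank `< k` is a left ideal generated by `C_s` for `k = 1`, a
two-sided ideal generated by `C_s` for `k = 2`, and a left ideal generated by `C_s` and `C_t` for `k
= 3`. The generators have parameter-free images, and every element of the group algebra lifts to a
multiplier. -/
theorem map_klSpan_eq {k : ℕ} (hk : cutL (npar φ ε s) (npar φ ε t) k) :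
    (klSpan φ {w | rank cs s t w < k}).toAddSubgroup.map (sp φ).toAddMonoidHom =
      AddSubgroup.closure (idealGen cs ε s t k) := by
  have K := N.klSystem
  have hsp := fun i => sp_klBasis_simple (φ := φ) (ε := ε) N.dih (i := i)
  have hinv : ∀ i, 0 < npar φ ε i → simpleKL cs ε i =
      sp φ (((ε (cs.simple i) : ℤˣ) : ℤ) • klBasis cs φ (cs.simple i)) := by
    intro i hi
    rw [map_zsmul, hsp i hi, smul_smul_units]
  refine le_antisymm ?_ ((AddSubgroup.closure_le _).2 ?_)
  · rintro _ ⟨x, hx, rfl⟩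
    refine K.klSpan_induction (p := fun x => sp φ x ∈ AddSubgroup.closure (idealGen cs ε s t k))
      ?_ ?_ ?_ ?_ hx
    · rw [map_zero]
      exact zero_mem _
    · intro w hw
      match k with
      | 0 => exact absurd hw (Nat.not_lt_zero _)
      | 1 =>
        obtain ⟨h, hh⟩ := N.klBasis_mem_one hk hw
        rw [hh, map_mul, hsp s hk, mul_smul_comm]
        exact zsmul_mem (AddSubgroup.subset_closure (show _ ∈ idealGen cs ε s t 1 from ⟨_, rfl⟩)) _
      | 2 =>
        obtain ⟨h, h', hh⟩ := N.klBasis_mem_two hk hw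
        rw [hh, map_mul, map_mul, hsp s (N.nonneg.trans_lt hk), mul_smul_comm, smul_mul_assoc]
        exact zsmul_mem (AddSubgroup.subset_closure
          (show _ ∈ idealGen cs ε s t 2 from ⟨_, _, rfl⟩)) _
      | 3 =>
        obtain ⟨h, hh | hh⟩ := N.klBasis_mem_three hk hw
        · rw [hh, map_mul, hsp s (lt_of_lt_of_le hk N.le), mul_smul_comm]
          exact zsmul_mem (AddSubgroup.subset_closure
            (show _ ∈ idealGen cs ε s t 3 from ⟨_, Or.inl rfl⟩)) _
        · rw [hh, map_mul, hsp t hk, mul_smul_comm]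
          exact zsmul_mem (AddSubgroup.subset_closure
            (show _ ∈ idealGen cs ε s t 3 from ⟨_, Or.inr rfl⟩)) _
      | k + 4 => exact AddSubgroup.subset_closure trivial
    · intro x y hx hy
      rw [map_add]
      exact add_mem hx hy
    · intro a x hx
      rw [sp_smul]
      exact zsmul_mem hx _
  · have hmem : ∀ i, cs.simple i ∈ {w | rank cs s t w < k} →
        ((ε (cs.simple i) : ℤˣ) : ℤ) • klBasis cs φ (cs.simple i) ∈
          klSpan φ {w | rank cs s t w < k} :=
      fun i hi => zsmul_mem (klBasis_mem_klSpan hi) _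
    have hleft : ∀ i, 0 < npar φ ε i → cs.simple i ∈ {w | rank cs s t w < k} →
        ∀ u, u * simpleKL cs ε i ∈
          (klSpan φ {w | rank cs s t w < k}).toAddSubgroup.map (sp φ).toAddMonoidHom := by
      intro i hi hi' u
      obtain ⟨u, rfl⟩ := sp_surjective φ u
      rw [hinv i hi, ← map_mul]
      exact ⟨_, K.lower_left_iff.1 (N.lower_left hk) u _ (hmem i hi'), rfl⟩
    intro x hx
    match k with
    | 0 => exact absurd hx (Set.notMem_empty _)
    | 1 =>
      obtain ⟨u, rfl⟩ := hx
      exact hleft s hk (by rw [Set.mem_ofPred_eq, N.rank_s]; omega) u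
    | 2 =>
      obtain ⟨u, v, rfl⟩ := hx
      obtain ⟨v, rfl⟩ := sp_surjective φ v
      obtain ⟨y, hy, hy'⟩ := hleft s (N.nonneg.trans_lt hk)
        (by rw [Set.mem_ofPred_eq, N.rank_s]; omega) u
      -- The first two-sided cut describes the same set as `rank < 2`, so the span is also stable by
      -- right multiplication.
      have hLR := K.isIdealOf_klSpan (N.lower_rankOf (σ := .LR) (k := 1) hk)
      have hset : {w | rankOf cs s t .LR w < 1} = {w | rank cs s t w < 2} := by
        ext w
        rw [Set.mem_ofPred_eq, rankOf, Set.mem_ofPred_eq]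
        omega
      rw [hset] at hLR
      refine ⟨y * v, hLR.2 trivial v y hy, ?_⟩
      rw [← hy']
      exact map_mul (sp φ) _ _
    | 3 =>
      obtain ⟨u, rfl | rfl⟩ := hx
      · exact hleft s (lt_of_lt_of_le hk N.le) (by rw [Set.mem_ofPred_eq, N.rank_s]; omega) u
      · exact hleft t hk (by rw [Set.mem_ofPred_eq, N.dih.rank_t]; omega) u
    | k + 4 =>
      obtain ⟨x, rfl⟩ := sp_surjective φ x
      have h : {w | rank cs s t w < k + 4} = Set.univ :=
        Set.eq_univ_of_forall fun w => (N.dih.rank_le w).trans_lt (by omega)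
      rw [h, K.klSpan_univ]
      exact ⟨x, trivial, rfl⟩

omit [LinearOrder Γ] [IsOrderedAddMonoid Γ] N in
theorem invW_invW (v : MonoidAlgebra ℤ W) : invW (invW v) = v := by
  induction v using MonoidAlgebra.induction_on with
  | of w => exact (congrArg invW (invW_ofW w)).trans ((invW_ofW w⁻¹).trans (by rw [inv_inv]; rfl))
  | add x y hx hy => rw [map_add, map_add, hx, hy]
  | smul r x hx => rw [map_smul, map_smul, hx]

variable {Γ' : Type w} [AddCommGroup Γ'] [LinearOrder Γ'] [IsOrderedAddMonoid Γ']
  {φ' : SBar cs → Γ'} (N' : NormPar φ' ε s t)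
include N'

theorem exists_sp_eq {σ : Side} {k : ℕ} (hk : cut (npar φ ε s) (npar φ ε t) σ k)
    (hk' : cut (npar φ' ε s) (npar φ' ε t) σ k) {v : MonoidAlgebra ℤ W}
    (hv : ∃ x ∈ klSpan φ {w | rankOf cs s t σ w < k}, sp φ x = v) :
    ∃ x ∈ klSpan φ' {w | rankOf cs s t σ w < k}, sp φ' x = v := by
  have left : ∀ k, cutL (npar φ ε s) (npar φ ε t) k → cutL (npar φ' ε s) (npar φ' ε t) k →
      ∀ v, (∃ x ∈ klSpan φ {w | rank cs s t w < k}, sp φ x = v) →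
      ∃ x ∈ klSpan φ' {w | rank cs s t w < k}, sp φ' x = v := by
    intro k hk hk' v hv
    have h : v ∈ (klSpan φ {w | rank cs s t w < k}).toAddSubgroup.map (sp φ).toAddMonoidHom := hv
    rw [N.map_klSpan_eq hk, ← N'.map_klSpan_eq hk'] at h
    exact h
  match σ, k with
  | .L, k => exact left k hk hk' v hv
  | .R, k =>
    have hset : {w | rankOf cs s t .R w < k}⁻¹ = {w | rank cs s t w < k} := by
      ext w
      rw [Set.mem_inv, Set.mem_ofPred_eq, rankOf, inv_inv, Set.mem_ofPred_eq]
    have hset' : {w | rank cs s t w < k}⁻¹ = {w | rankOf cs s t .R w < k} := rfl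
    obtain ⟨x, hx, rfl⟩ := hv
    have h1 := N.klSystem.tau_mem_klSpan hx
    rw [hset] at h1
    obtain ⟨y, hy, hy'⟩ := left k hk hk' _ ⟨_, h1, rfl⟩
    have h2 := N'.klSystem.tau_mem_klSpan hy
    rw [hset'] at h2
    refine ⟨_, h2, ?_⟩
    rw [sp_tau, hy', sp_tau, invW_invW]
  | .LR, 0 =>
    have hset : {w : W | rankOf cs s t .LR w < 0} = ∅ := by simp
    rw [hset, klSpan, Set.image_empty, Submodule.span_empty] at hv ⊢
    obtain ⟨x, hx, rfl⟩ := hv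
    rw [Submodule.mem_bot] at hx
    exact ⟨0, zero_mem _, by rw [hx, map_zero, map_zero]⟩
  | .LR, k + 1 =>
    have hset : {w | rankOf cs s t .LR w < k + 1} = {w | rank cs s t w < k + 2} := by
      ext w
      rw [Set.mem_ofPred_eq, rankOf, Set.mem_ofPred_eq]
      omega
    rw [hset] at hv ⊢
    exact left (k + 2) hk hk' v hv

theorem lowerImage_eq {σ : Side} {k : ℕ} (hk : cut (npar φ ε s) (npar φ ε t) σ k)
    (hk' : cut (npar φ' ε s) (npar φ' ε t) σ k) :
    N.klSystem.lowerImage (N.lower_rankOf hk) = N'.klSystem.lowerImage (N'.lower_rankOf hk') := by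
  ext v
  rw [mem_idealImage, mem_idealImage]
  constructor
  · rintro ⟨x, hx, rfl⟩
    obtain ⟨y, hy, hy'⟩ := N.exists_sp_eq N' hk hk' ⟨x, hx, rfl⟩
    exact ⟨y, hy, congrArg _ hy'⟩
  · rintro ⟨x, hx, rfl⟩
    obtain ⟨y, hy, hy'⟩ := N'.exists_sp_eq N hk' hk ⟨x, hx, rfl⟩
    exact ⟨y, hy, congrArg _ hy'⟩

end NormPar

end Independence

/-! ## The filtration of the cell modules -/

section Modules

variable {R : Type*} [Ring R]

/-- Since `P₁` contains the kernel of `f`, pushing forward along `f` does not change the quotient of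
`P₂` by `P₁`. This is how the chain of ideals in the group algebra is carried to a filtration of the
cell module. -/
theorem nonempty_quotient_equiv_of_map {V M : Type*} [AddCommGroup V] [Module R V]
    [AddCommGroup M] [Module R M] {P P₁ P₂ : Submodule R V} (f : P →ₗ[R] M)
    (h₂ : P₂ ≤ P) (hf : ∀ x : P, f x = 0 → x.1 ∈ P₁) :
    Nonempty ((↥((P₂.submoduleOf P).map f) ⧸
        ((P₁.submoduleOf P).map f).submoduleOf ((P₂.submoduleOf P).map f)) ≃ₗ[R]
      (↥P₂ ⧸ P₁.submoduleOf P₂)) := by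
  let g₀ : P₂ →ₗ[R] ↥((P₂.submoduleOf P).map f) :=
    LinearMap.codRestrict _ (f ∘ₗ Submodule.inclusion h₂)
      (fun x => ⟨Submodule.inclusion h₂ x, x.2, rfl⟩)
  let g := (((P₁.submoduleOf P).map f).submoduleOf ((P₂.submoduleOf P).map f)).mkQ ∘ₗ g₀
  have hsurj : Function.Surjective g := by
    refine (Submodule.mkQ_surjective _).comp ?_
    rintro ⟨_, ⟨x, hx, rfl⟩⟩
    exact ⟨⟨x.1, hx⟩, rfl⟩
  have hker : LinearMap.ker g = P₁.submoduleOf P₂ := by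
    ext x
    rw [LinearMap.mem_ker, LinearMap.comp_apply, Submodule.mkQ_apply,
      Submodule.Quotient.mk_eq_zero]
    constructor
    · rintro ⟨y, hy, hyx⟩
      have h1 : f (Submodule.inclusion h₂ x - y) = 0 := by
        rw [map_sub, sub_eq_zero]
        exact hyx.symm
      have h2 := P₁.add_mem (hf _ h1) hy
      have h3 : (Submodule.inclusion h₂ x - y : P).1 + y.1 = x.1 := sub_add_cancel _ _
      have h4 : (Submodule.inclusion h₂ x - y : P).1 + P.subtype y = x.1 := h3
      rw [h4] at h2
      exact h2
    · intro hx
      exact ⟨Submodule.inclusion h₂ x, hx, rfl⟩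
  exact ⟨((Submodule.quotEquivOfEq _ _ hker).symm.trans (g.quotKerEquivOfSurjective hsurj)).symm⟩

theorem nonempty_equiv_directSum {ι : Type*} (M : ι → Type*) [∀ i, AddCommGroup (M i)]
    [∀ i, Module R (M i)] (i₀ : ι) (h : ∀ i, i = i₀) : Nonempty (M i₀ ≃ₗ[R] ⨁ i, M i) := by
  classical
  refine ⟨LinearEquiv.ofLinearMap (DirectSum.lof R ι M i₀) (DirectSum.component R ι M i₀) ?_ ?_⟩
  · refine DirectSum.linearMap_ext _ fun i => ?_
    obtain rfl := h i
    refine LinearMap.ext fun x => ?_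
    simp [DirectSum.component.lof_self]
  · refine LinearMap.ext fun x => ?_
    simp

end Modules

/-! ### Cells as intervals of ranks, and the induced filtrations. -/

section Filtration

variable {B : Type u} {W : Type v} [Group W] {M : CoxeterMatrix B} {cs : CoxeterSystem M W}
variable {ε : W →* ℤˣ} {s t : B}

/-- The number of ranks. -/
def topRank : Side → ℕ
  | .L => 4
  | .R => 4
  | .LR => 3

open InfDihedral

theorem InfDihedral.rankOf_lt (hD : InfDihedral cs s t) (σ : Side) (w : W) :
    rankOf cs s t σ w < topRank σ := by
  have h := hD.rank_le w
  have h' := hD.rank_le w⁻¹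
  cases σ <;> simp only [rankOf, topRank] <;> omega

theorem InfDihedral.exists_rankOf (hD : InfDihedral cs s t) (σ : Side) {k : ℕ}
    (hk : k < topRank σ) : ∃ w, rankOf cs s t σ w = k := by
  have key : ∀ k, k < 4 → ∃ w, rank cs s t w = k := by
    intro k hk
    match k with
    | 0 => exact ⟨_, hD.rank_dc 0 false false⟩
    | 1 => exact ⟨_, hD.rank_dc 0 false true⟩
    | 2 => exact ⟨_, hD.rank_t⟩
    | 3 => exact ⟨_, hD.rank_one⟩
    | k + 4 => omega
  match σ with
  | .L => exact key k hk
  | .R =>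
    obtain ⟨w, hw⟩ := key k hk
    exact ⟨w⁻¹, by rw [rankOf, inv_inv, hw]⟩
  | .LR =>
    have hk' : k < 3 := hk
    obtain ⟨w, hw⟩ := key (k + 1) (by omega)
    exact ⟨w, by rw [rankOf, hw]; omega⟩

theorem cut_topRank {Γ : Type w} [AddCommGroup Γ] [LinearOrder Γ] (a b : Γ) (σ : Side) :
    cut a b σ (topRank σ) := by
  cases σ <;> trivial

theorem cut_zero {Γ : Type w} [AddCommGroup Γ] [LinearOrder Γ] (a b : Γ) (σ : Side) :
    cut a b σ 0 := by
  cases σ <;> trivial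

theorem cut_of_lt {Γ : Type w} [AddCommGroup Γ] [LinearOrder Γ] {a b : Γ} (hb : 0 < b)
    (hab : b < a) (σ : Side) (k : ℕ) : cut a b σ k := by
  have key : ∀ k, cutL a b k := by
    intro k
    match k with
    | 0 => trivial
    | 1 => exact hb.trans hab
    | 2 => exact hab
    | 3 => exact hb
    | k + 4 => trivial
  match σ, k with
  | .L, k => exact key k
  | .R, k => exact key k
  | .LR, 0 => trivial
  | .LR, k + 1 => exact key (k + 2)

namespace NormPar

section

variable {Γ : Type w} [AddCommGroup Γ] [LinearOrder Γ] [IsOrderedAddMonoid Γ] {φ : SBar cs → Γ}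
variable (N : NormPar φ ε s t)
include N

theorem exists_interval {σ : Side} {C : Set W} (hC : IsCell cs φ σ C) : ∃ m n,
    cut (npar φ ε s) (npar φ ε t) σ m ∧ cut (npar φ ε s) (npar φ ε t) σ n ∧ m < n ∧
      n ≤ topRank σ ∧ C = {w | m ≤ rankOf cs s t σ w ∧ rankOf cs s t σ w < n} := by
  classical
  obtain ⟨w₀, rfl⟩ := hC
  let p := fun k => cut (npar φ ε s) (npar φ ε t) σ k
  have hex : ∃ k, rankOf cs s t σ w₀ < k ∧ p k :=
    ⟨_, N.dih.rankOf_lt σ w₀, cut_topRank _ _ σ⟩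
  -- The bounds are the greatest valid cut not exceeding the rank of `w₀` and the least valid cut
  -- above it.
  have hm := Nat.findGreatest_spec (P := p) (Nat.zero_le (rankOf cs s t σ w₀)) (cut_zero _ _ σ)
  have hm' := Nat.findGreatest_le (P := p) (rankOf cs s t σ w₀)
  have hn := Nat.find_spec hex
  refine ⟨Nat.findGreatest p (rankOf cs s t σ w₀), Nat.find hex, hm, hn.2,
    hm'.trans_lt hn.1, Nat.find_min' hex ⟨N.dih.rankOf_lt σ w₀, cut_topRank _ _ σ⟩, ?_⟩
  ext x
  rw [Set.mem_ofPred_eq, N.cellEquiv_iff, Set.mem_ofPred_eq]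
  constructor
  · intro h
    refine ⟨?_, (h _ hn.2).2 hn.1⟩
    by_contra h'
    have := (h _ hm).1 (not_le.1 h')
    omega
  · rintro ⟨h1, h2⟩ k hk
    constructor
    · intro hx
      by_contra hlt
      have := Nat.le_findGreatest (P := p) (not_lt.1 hlt) hk
      omega
    · intro hw
      have := Nat.find_min' hex ⟨hw, hk⟩
      omega

theorem isCell_iff_fiber (hb : 0 < npar φ ε t) (hab : npar φ ε t < npar φ ε s) {σ : Side}
    {C : Set W} : IsCell cs φ σ C ↔ ∃ k < topRank σ, C = {w | rankOf cs s t σ w = k} := by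
  have h : ∀ x y, CellEquiv cs φ σ x y ↔ rankOf cs s t σ x = rankOf cs s t σ y := by
    intro x y
    rw [N.cellEquiv_iff]
    constructor
    · intro h
      have h1 := h (rankOf cs s t σ x + 1) (cut_of_lt hb hab σ _)
      have h2 := h (rankOf cs s t σ y + 1) (cut_of_lt hb hab σ _)
      omega
    · intro h k _
      rw [h]
  constructor
  · rintro ⟨w, rfl⟩
    exact ⟨_, N.dih.rankOf_lt σ w, Set.ext fun x => h x w⟩
  · rintro ⟨k, hk, rfl⟩
    obtain ⟨w, rfl⟩ := N.dih.exists_rankOf σ hk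
    exact ⟨w, Set.ext fun x => (h x w).symm⟩

theorem rankOf_le_of_cellLE (hb : 0 < npar φ ε t) (hab : npar φ ε t < npar φ ε s) {σ : Side}
    {x y : W} (h : CellLE cs φ σ x y) : rankOf cs s t σ x ≤ rankOf cs s t σ y :=
  Nat.lt_succ_iff.1 ((N.lower_rankOf (cut_of_lt hb hab σ (rankOf cs s t σ y + 1))).mem_of_cellLE h
    (Nat.lt_succ_self _))

end

variable {X Y : Pos (ZSBar cs)} (N : NormPar (parOf cs X) ε s t) (N' : NormPar (parOf cs Y) ε s t)
include N N'

/-- At `Y` every cut is valid, so the subsets `rank < k` give a full chain of submodules of the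
group algebra. By `lowerImage_eq` the cell module at `X` is the quotient of two terms of this chain,
and the terms in between filter it. Each block of the partition consists of a single cell. -/
theorem hasCellFiltration (hb : 0 < npar (parOf cs Y) ε t)
    (hab : npar (parOf cs Y) ε t < npar (parOf cs Y) ε s) {σ : Side} {C : Set W}
    (hC : IsCell cs (parOf cs X) σ C) :
    C = (⋃ i : SubCells cs Y σ C, i.1) ∧ HasCellFiltration cs X Y σ C := by
  obtain ⟨m, n, hm, hn, hmn, hnt, hCeq⟩ := N.exists_interval hC
  have hcut := cut_of_lt hb hab σ
  have hfib : ∀ k, k < n - m →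
      IsCell cs (parOf cs Y) σ {w | rankOf cs s t σ w = m + k} ∧
        {w | rankOf cs s t σ w = m + k} ⊆ C := by
    intro k hk
    refine ⟨(N'.isCell_iff_fiber hb hab).2 ⟨m + k, by omega, rfl⟩, ?_⟩
    rw [hCeq]
    intro w hw
    have hw' : rankOf cs s t σ w = m + k := hw
    rw [Set.mem_ofPred_eq]
    omega
  have hsub : ∀ i : SubCells cs Y σ C, ∃ k : Fin (n - m),
      i.1 = {w | rankOf cs s t σ w = m + k} := by
    intro i
    obtain ⟨k, hk, hi⟩ := (N'.isCell_iff_fiber hb hab).1 i.2.1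
    obtain ⟨w, hw⟩ := N'.dih.exists_rankOf σ hk
    have h1 : w ∈ C := i.2.2 (by rw [hi]; exact hw)
    rw [hCeq, Set.mem_ofPred_eq] at h1
    refine ⟨⟨k - m, by omega⟩, ?_⟩
    rw [hi]
    ext x
    rw [Set.mem_ofPred_eq, Set.mem_ofPred_eq]
    show _ ↔ _ = m + (k - m)
    omega
  refine ⟨?_, ?_⟩
  · refine Set.Subset.antisymm (fun w hw => ?_) (Set.iUnion_subset fun i => i.2.2)
    have hw' := hw
    rw [hCeq, Set.mem_ofPred_eq] at hw'
    obtain ⟨h1, h2⟩ := hfib (rankOf cs s t σ w - m) (by omega)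
    refine Set.mem_iUnion.2 ⟨⟨_, h1, h2⟩, ?_⟩
    show rankOf cs s t σ w = m + (rankOf cs s t σ w - m)
    omega
  choose κ hκ using hsub
  have hκ' : ∀ i : SubCells cs Y σ C, ∀ w ∈ i.1, rankOf cs s t σ w = m + κ i := by
    intro i w hw
    rw [hκ i] at hw
    exact hw
  have hne : ∀ k : Fin (n - m), ∃ w, rankOf cs s t σ w = m + k := fun k =>
    N'.dih.exists_rankOf σ (by omega)
  have hκuniq : ∀ (i : SubCells cs Y σ C) (k : Fin (n - m)),
      i.1 = {w | rankOf cs s t σ w = m + k} → κ i = k := by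
    intro i k hi
    obtain ⟨w, hw⟩ := hne k
    have := hκ' i w (by rw [hi]; exact hw)
    exact Fin.ext (by omega)
  refine ⟨n - m, κ, ?_, ?_, ?_⟩
  · exact fun k => ⟨⟨_, hfib k k.2⟩, hκuniq _ k rfl⟩
  · rintro i j ⟨x, hx, y, hy, hxy⟩
    have h1 := N'.rankOf_le_of_cellLE hb hab hxy
    rw [hκ' i x hx, hκ' j y hy] at h1
    exact Fin.le_def.2 (by omega)
  have K := N'.klSystem
  let P : ℕ → Submodule (MonoidAlgebra ℤ (ActGroup W σ)) (GroupRep W σ) := fun k =>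
    K.lowerImage (N'.lower_rankOf (hcut k))
  have hPmono : Monotone P := fun k l hkl =>
    K.lowerImage_mono _ _ fun w hw => lt_of_lt_of_le hw hkl
  obtain ⟨e⟩ := N.klSystem.cellModule_equiv hC (N.lower_rankOf hn) (N.lower_rankOf hm) (by
    rw [hCeq]
    ext w
    rw [Set.mem_sdiff, Set.mem_ofPred_eq, Set.mem_ofPred_eq, Set.mem_ofPred_eq]
    omega)
  have eX : Nonempty (ZCellModule cs (parOf cs X) σ C ≃ₗ[MonoidAlgebra ℤ (ActGroup W σ)]
      (↥(P n) ⧸ (P m).submoduleOf (P n))) := by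
    have h1 : N.klSystem.lowerImage (N.lower_rankOf hn) = P n := N.lowerImage_eq N' hn (hcut n)
    have h2 : N.klSystem.lowerImage (N.lower_rankOf hm) = P m := N.lowerImage_eq N' hm (hcut m)
    rw [← h1, ← h2]
    exact ⟨e⟩
  clear e
  obtain ⟨e⟩ := eX
  let f : ↥(P n) →ₗ[MonoidAlgebra ℤ (ActGroup W σ)] ZCellModule cs (parOf cs X) σ C :=
    e.symm.toLinearMap ∘ₗ ((P m).submoduleOf (P n)).mkQ
  have hfsurj : Function.Surjective f := e.symm.surjective.comp (Submodule.mkQ_surjective _)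
  have hf0 : ∀ x : P n, f x = 0 ↔ x.1 ∈ P m := by
    intro x
    refine (e.symm.map_eq_zero_iff).trans ?_
    rw [Submodule.mkQ_apply, Submodule.Quotient.mk_eq_zero]
    rfl
  -- The filtration is the image of the chain between `P m` and `P n`, reindexed to start at `0`.
  refine ⟨fun k => ((P (m + k)).submoduleOf (P n)).map f, ?_, ?_, ?_, ?_⟩
  · intro k l hkl
    refine Submodule.map_mono fun x hx => ?_
    exact hPmono (Nat.add_le_add_left hkl m) hx
  · rw [eq_bot_iff]
    rintro _ ⟨x, hx, rfl⟩
    exact (hf0 x).2 hx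
  · rw [eq_top_iff]
    rintro y -
    obtain ⟨x, rfl⟩ := hfsurj y
    refine ⟨x, ?_, rfl⟩
    have h : m + (Fin.last (n - m) : ℕ) = n := by
      rw [Fin.val_last]
      omega
    rw [h]
    exact x.2
  · intro k
    obtain ⟨e₁⟩ := nonempty_quotient_equiv_of_map (P₁ := P (m + k)) (P₂ := P (m + (k + 1))) f
      (hPmono (by omega)) (fun x hx => hPmono (by omega) ((hf0 x).1 hx))
    let i₀ : {i : SubCells cs Y σ C // κ i = k} := ⟨⟨_, hfib k k.2⟩, hκuniq _ k rfl⟩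
    obtain ⟨e₂⟩ := K.cellModule_equiv (C := i₀.1.1) i₀.1.2.1 (N'.lower_rankOf (hcut (m + (k + 1))))
      (N'.lower_rankOf (hcut (m + k))) (by
        ext w
        rw [Set.mem_sdiff, Set.mem_ofPred_eq, Set.mem_ofPred_eq]
        show _ ↔ rankOf cs s t σ w = m + k
        omega)
    obtain ⟨e₃⟩ := nonempty_equiv_directSum (R := MonoidAlgebra ℤ (ActGroup W σ))
      (fun i : {i : SubCells cs Y σ C // κ i = k} => ZCellModule cs (parOf cs Y) σ i.1.1) i₀ (by
        intro i
        refine Subtype.ext (Subtype.ext ?_)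
        rw [hκ i.1, i.2])
    exact ⟨e₁.trans (e₂.symm.trans e₃)⟩

end NormPar

end Filtration

/-! ## Geometry of positive subsets -/

namespace Pos

section Geometry

variable {Λ : Type u} [AddCommGroup Λ]

theorem zero_le_can {X : Pos Λ} {a : Λ} : 0 ≤ X.can a ↔ a ∈ X := by
  constructor
  · rintro ⟨b, hb, h⟩
    rw [sub_zero] at h
    exact X.mem_of_can_eq h hb
  · exact fun h => ⟨a, h, by rw [sub_zero]⟩

theorem zero_lt_can {X : Pos Λ} {a : Λ} : 0 < X.can a ↔ -a ∉ X := by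
  rw [← zero_le_can, map_neg, neg_nonneg, not_le]

theorem can_le_can {X : Pos Λ} {a b : Λ} : X.can a ≤ X.can b ↔ b - a ∈ X := by
  rw [← zero_le_can, map_sub, sub_nonneg]

theorem can_lt_can {X : Pos Λ} {a b : Λ} : X.can a < X.can b ↔ a - b ∉ X := by
  rw [← can_le_can, not_le]

theorem hyp_neg (a : Λ) : hyp (-a) = hyp a := by
  ext X
  show -a ∈ X ∧ - -a ∈ X ↔ a ∈ X ∧ -a ∈ X
  rw [neg_neg, and_comm]

theorem nsmul_mem {X : Pos Λ} {a : Λ} (h : a ∈ X) (n : ℕ) : n • a ∈ X := by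
  rw [← zero_le_can, map_nsmul]
  exact nsmul_nonneg (zero_le_can.2 h) n

theorem zsmul_mem_iff {X : Pos Λ} {a : Λ} {n : ℤ} (hn : 0 < n) : n • a ∈ X ↔ a ∈ X := by
  lift n to ℕ using hn.le
  have hn' : 0 < n := by exact_mod_cast hn
  rw [natCast_zsmul]
  refine ⟨fun h => ?_, fun h => nsmul_mem h n⟩
  rcases X.mem_or_neg_mem a with h' | h'
  · exact h'
  -- If `-a` is in `X`, then `a = n a + (n - 1)(-a)` is a sum of elements of `X`.
  · have h1 := X.add_mem h (nsmul_mem h' (n - 1))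
    have h2 : n • a + (n - 1) • -a = a := by
      obtain ⟨m, rfl⟩ : ∃ m, n = m + 1 := ⟨n - 1, by omega⟩
      rw [Nat.add_sub_cancel, add_smul, one_smul, smul_neg]
      abel
    rwa [h2] at h1

theorem sameSide_aux {X Y : Pos Λ} {a : Λ} (h : a ∈ X ↔ a ∈ Y) (h' : -a ∈ X ↔ -a ∈ Y) :
    (X ∈ avoid {a} ∧ Y ∈ avoid {a}) ∨ (X ∈ hyp a ∧ Y ∈ hyp a) ∨
      (X ∈ avoid {-a} ∧ Y ∈ avoid {-a}) := by
  by_cases h1 : a ∈ X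
  · by_cases h2 : -a ∈ X
    · exact Or.inr (Or.inl ⟨⟨h1, h2⟩, h.1 h1, h'.1 h2⟩)
    · refine Or.inr (Or.inr ⟨?_, ?_⟩)
      · rintro _ rfl
        exact h2
      · rintro _ rfl
        exact mt h'.2 h2
  · refine Or.inl ⟨?_, ?_⟩
    · rintro _ rfl
      exact h1
    · rintro _ rfl
      exact mt h.2 h1

theorem sameSide_refl (H : Set (Pos Λ)) (X : Pos Λ) : SameSide H X X := by
  rintro a - rfl
  exact sameSide_aux Iff.rfl Iff.rfl

theorem SameSide.mem_iff {X Y : Pos Λ} {a : Λ} (ha : a ≠ 0) (h : SameSide (hyp a) X Y) :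
    a ∈ X ↔ a ∈ Y := by
  rcases h a ha rfl with ⟨h1, h2⟩ | ⟨h1, h2⟩ | ⟨h1, h2⟩
  · exact iff_of_false (h1 a rfl) (h2 a rfl)
  · exact iff_of_true h1.1 h2.1
  · have hX := (X.mem_or_neg_mem a).resolve_right (h1 _ rfl)
    have hY := (Y.mem_or_neg_mem a).resolve_right (h2 _ rfl)
    exact iff_of_true hX hY

theorem IsFacet.mem_iff {𝔄 : Set (Set (Pos Λ))} {F : Set (Pos Λ)} (hF : IsFacet 𝔄 F)
    {X Y : Pos Λ} (hX : X ∈ F) (hY : Y ∈ F) {a : Λ} (ha : a ≠ 0) (h : hyp a ∈ 𝔄) :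
    a ∈ X ↔ a ∈ Y := by
  obtain ⟨Z, rfl⟩ := hF
  exact (SameSide.mem_iff ha (hX _ h)).symm.trans (SameSide.mem_iff ha (hY _ h))

theorem isOpen_avoid_singleton (a : Λ) : IsOpen (avoid {a} : Set (Pos Λ)) :=
  fun _ hX => ⟨{a}, Set.finite_singleton a, hX, subset_rfl⟩

/-- The condition `a ∉ X` is open, so weak inequalities that hold on a whole facet persist on its
closure. -/
theorem mem_of_mem_closure {𝔄 : Set (Set (Pos Λ))} {F : Set (Pos Λ)} (hF : IsFacet 𝔄 F)
    {X Y : Pos Λ} (hX : X ∈ closure F) (hY : Y ∈ F) {a : Λ} (ha : a ≠ 0) (h : hyp a ∈ 𝔄)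
    (haY : a ∈ Y) : a ∈ X := by
  by_contra haX
  obtain ⟨Z, hZ, hZF⟩ := mem_closure_iff.1 hX _ (isOpen_avoid_singleton a) (by
    rintro _ rfl
    exact haX)
  exact hZ a rfl ((hF.mem_iff hZF hY ha h).2 haY)

/-- Basic neighbourhoods are given by conditions `a ∉ X`, which a smaller positive subset inherits.
In particular every `X` lies in the closure of each of its refinements. -/
theorem mem_closure_of_subset {S : Set (Pos Λ)} {X Y : Pos Λ} (hY : Y ∈ S)
    (h : ∀ a, a ∈ Y → a ∈ X) : X ∈ closure S := by
  refine mem_closure_iff.2 fun U hU hXU => ?_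
  obtain ⟨E, -, hE, hEU⟩ := hU X hXU
  exact ⟨Y, hEU fun a ha haY => hE a ha (h a haY), hY⟩

/-- The refinement of a positive subset by a linear form on `X ∩ -X`. -/
def refine (X : Pos Λ) (f : Λ →+ ℤ) : Pos Λ where
  carrier := {a | a ∈ X ∧ (-a ∈ X → 0 ≤ f a)}
  union_neg := by
    refine Set.eq_univ_of_forall fun a => ?_
    show (a ∈ X ∧ (-a ∈ X → 0 ≤ f a)) ∨ (-a ∈ X ∧ (- -a ∈ X → 0 ≤ f (-a)))
    rw [neg_neg, map_neg]
    by_cases h : a ∈ X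
    · by_cases h' : -a ∈ X
      · rcases le_total 0 (f a) with h0 | h0
        · exact Or.inl ⟨h, fun _ => h0⟩
        · exact Or.inr ⟨h', fun _ => by omega⟩
      · exact Or.inl ⟨h, fun h0 => absurd h0 h'⟩
    · exact Or.inr ⟨(X.mem_or_neg_mem a).resolve_left h, fun h0 => absurd h0 h⟩
  add_subset := by
    rintro _ ⟨a, ⟨ha, ha'⟩, b, ⟨hb, hb'⟩, rfl⟩
    refine ⟨X.add_mem ha hb, fun h => ?_⟩
    have h1 : -a ∈ X := by
      have := X.add_mem h hb
      rwa [neg_add, neg_add_cancel_right] at this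
    have h2 : -b ∈ X := by
      have := X.add_mem h ha
      rwa [neg_add_rev, neg_add_cancel_right] at this
    rw [map_add]
    exact add_nonneg (ha' h1) (hb' h2)
  inter_neg := by
    refine ⟨X.ker ⊓ f.ker, ?_⟩
    ext a
    show ((a ∈ X ∧ -a ∈ X) ∧ f a = 0) ↔
      (a ∈ X ∧ (-a ∈ X → 0 ≤ f a)) ∧ (-a ∈ X ∧ (- -a ∈ X → 0 ≤ f (-a)))
    rw [neg_neg, map_neg]
    constructor
    · rintro ⟨⟨h, h'⟩, h0⟩
      exact ⟨⟨h, fun _ => h0.ge⟩, h', fun _ => by omega⟩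
    · rintro ⟨⟨h1, h2⟩, h3, h4⟩
      have := h2 h3
      have := h4 h1
      exact ⟨⟨h1, h3⟩, by omega⟩

theorem mem_refine {X : Pos Λ} {f : Λ →+ ℤ} {a : Λ} :
    a ∈ X.refine f ↔ a ∈ X ∧ (-a ∈ X → 0 ≤ f a) := Iff.rfl

/-- The trivial positive subset. -/
def triv : Pos Λ where
  carrier := Set.univ
  union_neg := Set.univ_union _
  add_subset := Set.subset_univ _
  inter_neg := ⟨⊤, by simp⟩

/-- The positive subset attached to a linear form. -/
def half (f : Λ →+ ℤ) : Pos Λ := triv.refine f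

theorem mem_half {f : Λ →+ ℤ} {a : Λ} : a ∈ half f ↔ 0 ≤ f a :=
  ⟨fun h => h.2 trivial, fun h => ⟨trivial, fun _ => h⟩⟩

theorem neg_notMem_refine {X : Pos Λ} {f : Λ →+ ℤ} {a : Λ} (ha : a ∈ X) (h : 0 < f a) :
    -a ∉ X.refine f := by
  intro h'
  have := (mem_refine.1 h').2 (by rwa [neg_neg])
  rw [map_neg] at this
  omega

theorem refine_mem_iff {X Z : Pos Λ} {f : Λ →+ ℤ} {a : Λ} (h : a ∈ X ↔ a ∈ Z)
    (h' : -a ∈ X ↔ -a ∈ Z) : a ∈ X.refine f ↔ a ∈ Z.refine f := by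
  rw [mem_refine, mem_refine, h, h']

theorem refine_notMem_hyp {X : Pos Λ} {f : Λ →+ ℤ} {a : Λ} (h : f a ≠ 0) :
    X.refine f ∉ hyp a := by
  rintro ⟨⟨h1, h2⟩, h3, h4⟩
  have := h2 h3
  have := h4 (by rwa [neg_neg])
  rw [map_neg] at this
  omega

end Geometry

end Pos

/-! ### The rank two lattice -/

section RankTwo

variable {B : Type u} {W : Type v} [Group W] {M : CoxeterMatrix B} {cs : CoxeterSystem M W}
variable {s t : B}

/-- The linear form with given values on the classes of simple reflections. -/
def form (cs : CoxeterSystem M W) (c : SBar cs → ℤ) : ZSBar cs →+ ℤ :=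
  (Finsupp.linearCombination ℤ c).toAddMonoidHom

theorem form_cls (c : SBar cs → ℤ) (i : B) : form cs c (cls cs i) = c (Quotient.mk _ i) := by
  simp [form, cls]

namespace InfDihedral

variable (hD : InfDihedral cs s t)
include hD

theorem mk_ne : (Quotient.mk (conjSetoid cs) s) ≠ Quotient.mk (conjSetoid cs) t := fun h =>
  hD.not_isConj (Quotient.exact h)

open Classical in
theorem exists_form (m n : ℤ) :
    ∃ f : ZSBar cs →+ ℤ, f (cls cs s) = m ∧ f (cls cs t) = n := by
  refine ⟨form cs (fun ω => if ω = Quotient.mk _ s then m else n), ?_, ?_⟩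
  · rw [form_cls, if_pos rfl]
  · rw [form_cls, if_neg hD.mk_ne.symm]

theorem exists_coords (a : ZSBar cs) : ∃ m n : ℤ, a = m • cls cs s + n • cls cs t := by
  refine ⟨a (Quotient.mk _ s), a (Quotient.mk _ t), ?_⟩
  ext ω
  obtain ⟨i, rfl⟩ := Quotient.exists_rep ω
  simp only [cls, Finsupp.add_apply, Finsupp.smul_apply]
  rcases hD.eq_or_eq i with rfl | rfl
  · rw [Finsupp.single_eq_same, Finsupp.single_eq_of_ne hD.mk_ne]
    simp
  · rw [Finsupp.single_eq_same, Finsupp.single_eq_of_ne hD.mk_ne.symm]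
    simp

theorem cls_ne_zero {m n : ℤ} (h : m ≠ 0 ∨ n ≠ 0) : m • cls cs s + n • cls cs t ≠ 0 := by
  intro h0
  obtain ⟨f, hf, hf'⟩ := hD.exists_form 1 0
  obtain ⟨g, hg, hg'⟩ := hD.exists_form 0 1
  have h1 := congrArg f h0
  have h2 := congrArg g h0
  rw [map_add, map_zsmul, map_zsmul, hf, hf', map_zero] at h1
  rw [map_add, map_zsmul, map_zsmul, hg, hg', map_zero] at h2
  simp at h1 h2
  omega

theorem exists_proportional {a b : ZSBar cs} (ha : a ≠ 0) (hb : b ≠ 0)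
    (h : ∀ f : ZSBar cs →+ ℤ, f b = 0 → f a = 0) :
    ∃ p q : ℤ, 0 < p ∧ q ≠ 0 ∧ p • a = q • b := by
  obtain ⟨m, n, rfl⟩ := hD.exists_coords a
  obtain ⟨m', n', rfl⟩ := hD.exists_coords b
  -- In rank two this is, up to scalars, the only form vanishing on `b`; its vanishing on `a` is the
  -- relation `m n' = n m'`.
  obtain ⟨f, hf, hf'⟩ := hD.exists_form n' (-m')
  have h1 := h f (by
    rw [map_add, map_zsmul, map_zsmul, hf, hf', smul_eq_mul, smul_eq_mul]
    ring)
  rw [map_add, map_zsmul, map_zsmul, hf, hf', smul_eq_mul, smul_eq_mul] at h1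
  have key : ∃ p q : ℤ, p ≠ 0 ∧ p • (m • cls cs s + n • cls cs t) =
      q • (m' • cls cs s + n' • cls cs t) := by
    by_cases hm : m' = 0
    · have hn : n' ≠ 0 := by
        rintro rfl
        exact hb (by rw [hm, zero_smul, zero_smul, add_zero])
      refine ⟨n', n, hn, ?_⟩
      rw [smul_add, smul_add, smul_smul, smul_smul, smul_smul, smul_smul,
        show n' * m = n * m' by linarith, mul_comm n' n]
    · refine ⟨m', m, hm, ?_⟩
      rw [smul_add, smul_add, smul_smul, smul_smul, smul_smul, smul_smul,
        show m' * n = m * n' by linarith, mul_comm m' m]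
  obtain ⟨p, q, hp, hpq⟩ := key
  have htf : ∀ (p : ℤ) (a : ZSBar cs), p ≠ 0 → a ≠ 0 → p • a ≠ 0 := fun p a hp ha =>
    smul_ne_zero hp ha
  have hq : q ≠ 0 := by
    rintro rfl
    rw [zero_smul] at hpq
    exact htf p _ hp ha hpq
  rcases lt_or_gt_of_ne hp with h | h
  · exact ⟨-p, -q, by omega, by omega, by rw [neg_smul, neg_smul, hpq]⟩
  · exact ⟨p, q, h, hq, hpq⟩

omit hD in
theorem mem_iff_of_proportional {p q : ℤ} (hp : 0 < p) (hq : q ≠ 0) {a b : ZSBar cs}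
    (h : p • a = q • b) {X Y : Pos (ZSBar cs)} (h1 : b ∈ X ↔ b ∈ Y) (h2 : -b ∈ X ↔ -b ∈ Y) :
    a ∈ X ↔ a ∈ Y := by
  rw [← Pos.zsmul_mem_iff hp, h, ← Pos.zsmul_mem_iff (X := Y) hp, h]
  rcases lt_or_gt_of_ne hq with hq | hq
  · rw [← neg_neg q, neg_smul, ← smul_neg, Pos.zsmul_mem_iff (by omega),
      Pos.zsmul_mem_iff (by omega), h2]
  · rw [Pos.zsmul_mem_iff hq, Pos.zsmul_mem_iff hq, h1]

/-- `SameSide` quantifies over all vectors defining the hyperplane, so these must be shown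
proportional to `b`. For a form `f` vanishing on `b`, the half-space `Pos.half f` lies on the
hyperplane, which forces `f` to vanish on the other vector too. -/
theorem sameSide_of_mem_iff {b : ZSBar cs} (hb : b ≠ 0) {X Y : Pos (ZSBar cs)}
    (h1 : b ∈ X ↔ b ∈ Y) (h2 : -b ∈ X ↔ -b ∈ Y) : Pos.SameSide (Pos.hyp b) X Y := by
  intro a ha hab
  obtain ⟨p, q, hp, hq, hpq⟩ := hD.exists_proportional ha hb (fun f hf => by
    have h : Pos.half f ∈ Pos.hyp b :=
      ⟨Pos.mem_half.2 hf.ge, Pos.mem_half.2 (by rw [map_neg, hf, neg_zero])⟩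
    rw [hab] at h
    have h3 := Pos.mem_half.1 h.1
    have h4 := Pos.mem_half.1 h.2
    rw [map_neg] at h4
    omega)
  rw [hab]
  refine Pos.sameSide_aux (mem_iff_of_proportional hp hq hpq h1 h2) ?_
  exact mem_iff_of_proportional hp hq (a := -a) (b := -b) (by rw [smul_neg, smul_neg, hpq]) h2
    (by rwa [neg_neg])

theorem hyp_eq_of_proportional {p q : ℤ} (hp : 0 < p) (hq : q ≠ 0) {a b : ZSBar cs}
    (h : p • a = q • b) : Pos.hyp a = Pos.hyp b := by
  ext X
  show a ∈ X ∧ -a ∈ X ↔ b ∈ X ∧ -b ∈ X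
  rw [← Pos.zsmul_mem_iff (a := a) hp, ← Pos.zsmul_mem_iff (a := -a) hp, smul_neg, h]
  rcases lt_or_gt_of_ne hq with hq | hq
  · have hq' : 0 < -q := by omega
    rw [← Pos.zsmul_mem_iff (a := b) hq', ← Pos.zsmul_mem_iff (a := -b) hq', smul_neg, neg_smul,
      neg_neg, and_comm]
  · rw [← Pos.zsmul_mem_iff (a := b) hq, ← Pos.zsmul_mem_iff (a := -b) hq, smul_neg]

end InfDihedral

end RankTwo

/-! ## The arrangement of an infinite dihedral group -/

section Arrangement

variable {B : Type u} {W : Type v} [Group W] {M : CoxeterMatrix B} {cs : CoxeterSystem M W}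
variable {s t : B} {ε : W →* ℤˣ}

/-- The four essential hyperplanes of an infinite dihedral group. -/
def arr (cs : CoxeterSystem M W) (s t : B) : Set (Set (Pos (ZSBar cs))) :=
  {Pos.hyp (cls cs s), Pos.hyp (cls cs t), Pos.hyp (cls cs s - cls cs t),
    Pos.hyp (cls cs s + cls cs t)}

theorem arr_comm (cs : CoxeterSystem M W) (s t : B) : arr cs s t = arr cs t s := by
  have h : Pos.hyp (cls cs s - cls cs t) = Pos.hyp (cls cs t - cls cs s) := by
    rw [← Pos.hyp_neg, neg_sub]
  rw [arr, arr, h, add_comm (cls cs s), Set.insert_comm]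

/-- The class of a simple reflection, multiplied by a sign. -/
def ncls (cs : CoxeterSystem M W) (ε : W →* ℤˣ) (i : B) : ZSBar cs :=
  ((ε (cs.simple i) : ℤˣ) : ℤ) • cls cs i

theorem npar_parOf (X : Pos (ZSBar cs)) (i : B) :
    npar (parOf cs X) ε i = X.can (ncls cs ε i) := by
  rw [npar, ncls, map_zsmul]
  rfl

theorem hyp_ncls_mem_left : Pos.hyp (ncls cs ε s) ∈ arr cs s t := by
  rw [ncls]
  rcases units_cases (ε (cs.simple s)) with h | h <;> rw [h]
  · rw [one_smul]
    exact Or.inl rfl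
  · rw [neg_smul, one_smul, Pos.hyp_neg]
    exact Or.inl rfl

theorem hyp_ncls_mem_right : Pos.hyp (ncls cs ε t) ∈ arr cs s t := by
  rw [arr_comm]
  exact hyp_ncls_mem_left

/-- The wall `a = b` is `H_{s-t}` when the two signs agree and `H_{s+t}` when they differ; this
explains why both are needed. -/
theorem hyp_ncls_sub_mem : Pos.hyp (ncls cs ε s - ncls cs ε t) ∈ arr cs s t := by
  have h3 : Pos.hyp (cls cs s - cls cs t) ∈ arr cs s t := Or.inr (Or.inr (Or.inl rfl))
  have h4 : Pos.hyp (cls cs s + cls cs t) ∈ arr cs s t := Or.inr (Or.inr (Or.inr rfl))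
  rw [ncls, ncls]
  rcases units_cases (ε (cs.simple s)) with h | h <;>
    rcases units_cases (ε (cs.simple t)) with h' | h' <;> rw [h, h']
  · rwa [one_smul, one_smul]
  · rwa [one_smul, neg_smul, one_smul, sub_neg_eq_add]
  · rw [one_smul, neg_smul, one_smul, ← Pos.hyp_neg, neg_sub, sub_neg_eq_add, add_comm]
    exact h4
  · rw [neg_smul, one_smul, neg_smul, one_smul, ← Pos.hyp_neg, neg_sub, sub_neg_eq_add,
      neg_add_eq_sub]
    exact h3

namespace InfDihedral

variable (hD : InfDihedral cs s t)
include hD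

theorem arr_cases {H : Set (Pos (ZSBar cs))} (hH : H ∈ arr cs s t) : ∃ m n : ℤ,
    (m ≠ 0 ∨ n ≠ 0) ∧ m.natAbs ≤ 1 ∧ n.natAbs ≤ 1 ∧
      H = Pos.hyp (m • cls cs s + n • cls cs t) := by
  rcases hH with rfl | rfl | rfl | rfl
  · exact ⟨1, 0, by simp⟩
  · exact ⟨0, 1, by simp⟩
  · exact ⟨1, -1, by simp [sub_eq_add_neg]⟩
  · exact ⟨1, 1, by simp⟩

theorem ncls_ne_zero (i : B) : ncls cs ε i ≠ 0 := by
  have key : ∀ u : ℤˣ, (u : ℤ) ≠ 0 := fun u => by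
    rcases units_cases u with h | h <;> rw [h] <;> omega
  rcases hD.eq_or_eq i with rfl | rfl
  · have := hD.cls_ne_zero (m := (ε (cs.simple i) : ℤ)) (n := 0) (Or.inl (key _))
    rwa [zero_smul, add_zero] at this
  · have := hD.cls_ne_zero (m := 0) (n := (ε (cs.simple i) : ℤ)) (Or.inr (key _))
    rwa [zero_smul, zero_add] at this

theorem ncls_sub_ne_zero : ncls cs ε s - ncls cs ε t ≠ 0 := by
  have key : ∀ u : ℤˣ, (u : ℤ) ≠ 0 := fun u => by
    rcases units_cases u with h | h <;> rw [h] <;> omega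
  have := hD.cls_ne_zero (m := (ε (cs.simple s) : ℤ)) (n := -(ε (cs.simple t) : ℤ))
    (Or.inl (key _))
  rwa [neg_smul, ← sub_eq_add_neg] at this

theorem exists_form_ncls (ε : W →* ℤˣ) (m n : ℤ) :
    ∃ f : ZSBar cs →+ ℤ, f (ncls cs ε s) = m ∧ f (ncls cs ε t) = n := by
  obtain ⟨f, hf, hf'⟩ := hD.exists_form ((ε (cs.simple s) : ℤ) * m) ((ε (cs.simple t) : ℤ) * n)
  refine ⟨f, ?_, ?_⟩
  · rw [ncls, map_zsmul, hf, ← smul_eq_mul ((ε (cs.simple s) : ℤˣ) : ℤ), smul_smul_units]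
  · rw [ncls, map_zsmul, hf', ← smul_eq_mul ((ε (cs.simple t) : ℤˣ) : ℤ), smul_smul_units]

-- The sign of `i` is chosen so that the class of `i`, multiplied by it, belongs to `X`. The order
-- of the two resulting parameters decides which letter plays the role of `s`.
open Classical in
theorem exists_normPar (X : Pos (ZSBar cs)) :
    ∃ ε : W →* ℤˣ, NormPar (parOf cs X) ε s t ∨ NormPar (parOf cs X) ε t s := by
  obtain ⟨ε, hε⟩ := hD.exists_character (fun i => if cls cs i ∈ X then 1 else -1)
  have h0 : ∀ i, 0 ≤ npar (parOf cs X) ε i := by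
    intro i
    rw [npar_parOf, Pos.zero_le_can, ncls, hε]
    split_ifs with h
    · rwa [Units.val_one, one_smul]
    · rw [Units.val_neg, Units.val_one, neg_smul, one_smul]
      exact (X.mem_or_neg_mem _).resolve_left h
  refine ⟨ε, ?_⟩
  rcases le_total (npar (parOf cs X) ε t) (npar (parOf cs X) ε s) with h | h
  · exact Or.inl ⟨hD, h0 t, h⟩
  · exact Or.inr ⟨hD.symm, h0 s, h⟩

/-- The arrangement is finite, rational and complete. -/
theorem isCompleteArrangement : IsCompleteArrangement cs (arr cs s t) where
  finite := by
    rw [arr]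
    exact Set.toFinite _
  rational := by
    intro H hH
    obtain ⟨m, n, h, -, -, rfl⟩ := hD.arr_cases hH
    exact ⟨_, hD.cls_ne_zero h, rfl⟩
  complete := by
    intro i
    rcases hD.eq_or_eq i with rfl | rfl
    · exact Or.inl rfl
    · exact Or.inr (Or.inl rfl)

theorem npar_pos_of_chamber {Ch : Set (Pos (ZSBar cs))} (hCh : Pos.IsChamber (arr cs s t) Ch)
    {Y : Pos (ZSBar cs)} (hY : Y ∈ Ch) (N : NormPar (parOf cs Y) ε s t) :
    0 < npar (parOf cs Y) ε t ∧ npar (parOf cs Y) ε t < npar (parOf cs Y) ε s := by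
  have key : ∀ a, Pos.hyp a ∈ arr cs s t → a ∈ Y → -a ∉ Y := fun a ha h h' =>
    Set.disjoint_left.1 (hCh.2 _ ha) hY ⟨h, h'⟩
  have h1 := N.nonneg
  have h2 := N.le
  rw [npar_parOf, Pos.zero_le_can] at h1
  rw [npar_parOf, npar_parOf, Pos.can_le_can] at h2
  rw [npar_parOf, npar_parOf, Pos.zero_lt_can, Pos.can_lt_can]
  refine ⟨key _ hyp_ncls_mem_right h1, ?_⟩
  rw [← neg_sub]
  exact key _ hyp_ncls_sub_mem h2

/-- The inequalities `0 ≤ b ≤ a` are weak and attached to hyperplanes of the arrangement, so they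
survive on the closure with the same signs and the same order of the two letters. -/
theorem normPar_of_mem_closure {F : Set (Pos (ZSBar cs))} (hF : Pos.IsFacet (arr cs s t) F)
    {X Y : Pos (ZSBar cs)} (hX : X ∈ closure F) (hY : Y ∈ F) (N : NormPar (parOf cs Y) ε s t) :
    NormPar (parOf cs X) ε s t := by
  have h1 := N.nonneg
  have h2 := N.le
  rw [npar_parOf, Pos.zero_le_can] at h1
  rw [npar_parOf, npar_parOf, Pos.can_le_can] at h2
  refine ⟨hD, ?_, ?_⟩
  · rw [npar_parOf, Pos.zero_le_can]
    exact Pos.mem_of_mem_closure hF hX hY (hD.ncls_ne_zero t) hyp_ncls_mem_right h1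
  · rw [npar_parOf, npar_parOf, Pos.can_le_can]
    exact Pos.mem_of_mem_closure hF hX hY hD.ncls_sub_ne_zero hyp_ncls_sub_mem h2

theorem union_and_filtration {Ch : Set (Pos (ZSBar cs))} (hCh : Pos.IsChamber (arr cs s t) Ch)
    {X Y : Pos (ZSBar cs)} (hX : X ∈ closure Ch) (hY : Y ∈ Ch) {σ : Side} {C : Set W}
    (hC : IsCell cs (parOf cs X) σ C) :
    C = (⋃ i : SubCells cs Y σ C, i.1) ∧ HasCellFiltration cs X Y σ C := by
  obtain ⟨ε, N | N⟩ := hD.exists_normPar Y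
  · obtain ⟨h1, h2⟩ := hD.npar_pos_of_chamber hCh hY N
    exact (hD.normPar_of_mem_closure hCh.1 hX hY N).hasCellFiltration N h1 h2 hC
  · rw [arr_comm] at hCh
    obtain ⟨h1, h2⟩ := hD.symm.npar_pos_of_chamber hCh hY N
    exact (hD.symm.normPar_of_mem_closure hCh.1 hX hY N).hasCellFiltration N h1 h2 hC

/-! ### Cells are constant on facets -/

/-- The cells depend only on which of `0 < a`, `b < a`, `0 < b` hold, and these are conditions on
the sides of hyperplanes of the arrangement. -/
theorem cellEquiv_iff_of_facet_aux {F : Set (Pos (ZSBar cs))}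
    (hF : Pos.IsFacet (arr cs s t) F) {X Y : Pos (ZSBar cs)} (hX : X ∈ F) (hY : Y ∈ F)
    (N : NormPar (parOf cs X) ε s t) (σ : Side) (x y : W) :
    CellEquiv cs (parOf cs X) σ x y ↔ CellEquiv cs (parOf cs Y) σ x y := by
  have N' := hD.normPar_of_mem_closure hF (subset_closure hY) hX N
  have hneg : ∀ a, a ≠ 0 → Pos.hyp a ∈ arr cs s t → (-a ∈ X ↔ -a ∈ Y) := fun a ha h =>
    hF.mem_iff hX hY (neg_ne_zero.2 ha) (by rwa [Pos.hyp_neg])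
  have hcut : ∀ k, cutL (npar (parOf cs X) ε s) (npar (parOf cs X) ε t) k ↔
      cutL (npar (parOf cs Y) ε s) (npar (parOf cs Y) ε t) k := by
    intro k
    match k with
    | 0 => exact Iff.rfl
    | 1 =>
      show 0 < _ ↔ 0 < _
      rw [npar_parOf, npar_parOf, Pos.zero_lt_can, Pos.zero_lt_can,
        hneg _ (hD.ncls_ne_zero s) hyp_ncls_mem_left]
    | 2 =>
      show _ < _ ↔ _ < _
      rw [npar_parOf, npar_parOf, npar_parOf, npar_parOf, Pos.can_lt_can, Pos.can_lt_can,
        ← neg_sub, hneg _ hD.ncls_sub_ne_zero hyp_ncls_sub_mem]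
    | 3 =>
      show 0 < _ ↔ 0 < _
      rw [npar_parOf, npar_parOf, Pos.zero_lt_can, Pos.zero_lt_can,
        hneg _ (hD.ncls_ne_zero t) hyp_ncls_mem_right]
    | k + 4 => exact Iff.rfl
  have hcut' : ∀ k, cut (npar (parOf cs X) ε s) (npar (parOf cs X) ε t) σ k ↔
      cut (npar (parOf cs Y) ε s) (npar (parOf cs Y) ε t) σ k := by
    intro k
    match σ, k with
    | .L, k => exact hcut k
    | .R, k => exact hcut k
    | .LR, 0 => exact Iff.rfl
    | .LR, k + 1 => exact hcut (k + 2)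
  rw [N.cellEquiv_iff, N'.cellEquiv_iff]
  exact forall_congr' fun k => imp_congr_left (hcut' k)

theorem cellEquiv_iff_of_facet {F : Set (Pos (ZSBar cs))}
    (hF : Pos.IsFacet (arr cs s t) F) {X Y : Pos (ZSBar cs)} (hX : X ∈ F) (hY : Y ∈ F)
    (σ : Side) (x y : W) :
    CellEquiv cs (parOf cs X) σ x y ↔ CellEquiv cs (parOf cs Y) σ x y := by
  obtain ⟨ε, N | N⟩ := hD.exists_normPar X
  · exact hD.cellEquiv_iff_of_facet_aux hF hX hY N σ x y
  · rw [arr_comm] at hF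
    exact hD.symm.cellEquiv_iff_of_facet_aux hF hX hY N σ x y

/-! ### Cells are stable by the parabolic subgroup of the facet -/

theorem klSystem (X : Pos (ZSBar cs)) :
    KLSystem (parOf cs X) s t ∨ KLSystem (parOf cs X) t s := by
  obtain ⟨ε, N | N⟩ := hD.exists_normPar X
  · exact Or.inl N.klSystem
  · exact Or.inr N.klSystem

omit hD in
theorem par_eq_zero {F : Set (Pos (ZSBar cs))} {X : Pos (ZSBar cs)} (hX : X ∈ F) {i : B}
    (hi : F ⊆ Pos.hyp (cls cs i)) : par cs (parOf cs X) i = 0 :=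
  X.can_eq_zero (hi hX).1 (hi hX).2

omit hD in
theorem transStable_aux {X : Pos (ZSBar cs)} {s t : B} (K : KLSystem (parOf cs X) s t) {σ : Side}
    {C : Set W} (hC : IsCell cs (parOf cs X) σ C) {i : B} (hi : par cs (parOf cs X) i = 0) :
    (σ.left → ∀ x, cs.simple i * x ∈ C ↔ x ∈ C) ∧ (σ.right → ∀ x, x * cs.simple i ∈ C ↔ x ∈ C) := by
  obtain ⟨w₀, rfl⟩ := hC
  have hmem : ∀ x y, CellEquiv cs (parOf cs X) σ x y →
      (x ∈ {x | CellEquiv cs (parOf cs X) σ x w₀} ↔ y ∈ {x | CellEquiv cs (parOf cs X) σ x w₀}) :=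
    fun x y h => ⟨fun h' => h.symm.trans h', fun h' => h.trans h'⟩
  have hL := fun x => K.cellEquiv_simple_mul hi x
  have hR : ∀ x, CellEquiv cs (parOf cs X) .R (x * cs.simple i) x := by
    intro x
    rw [K.cellEquiv_inv_iff, mul_inv_rev, cs.inv_simple]
    exact hL x⁻¹
  refine ⟨fun hσ x => hmem _ _ ?_, fun hσ x => hmem _ _ ?_⟩
  · cases σ
    · exact hL x
    · exact absurd hσ id
    · exact ⟨(hL x).1.left_to_both, (hL x).2.left_to_both⟩
  · cases σ
    · exact absurd hσ id
    · exact hR x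
    · exact ⟨(hR x).1.right_to_both, (hR x).2.right_to_both⟩

theorem transStable {F : Set (Pos (ZSBar cs))} {X : Pos (ZSBar cs)} (hX : X ∈ F) {σ : Side}
    {C : Set W} (hC : IsCell cs (parOf cs X) σ C) : TransStable σ (parabolic cs F) C := by
  have key : ∀ i, F ⊆ Pos.hyp (cls cs i) →
      (σ.left → ∀ x, cs.simple i * x ∈ C ↔ x ∈ C) ∧
        (σ.right → ∀ x, x * cs.simple i ∈ C ↔ x ∈ C) := by
    intro i hi
    rcases hD.klSystem X with K | K
    · exact transStable_aux K hC (par_eq_zero hX hi)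
    · exact transStable_aux K hC (par_eq_zero hX hi)
  refine ⟨fun hσ w hw => ?_, fun hσ w hw => ?_⟩
  · suffices h : ∀ x, w * x ∈ C ↔ x ∈ C from fun x hx => (h x).2 hx
    induction hw using Subgroup.closure_induction with
    | mem w hw =>
      obtain ⟨i, hi, rfl⟩ := hw
      exact (key i hi).1 hσ
    | one => exact fun x => by rw [one_mul]
    | mul a b _ _ ha hb => exact fun x => by rw [mul_assoc, ha, hb]
    | inv a _ ha => exact fun x => by rw [← ha, mul_inv_cancel_left]
  · suffices h : ∀ x, x * w ∈ C ↔ x ∈ C from fun x hx => (h x).2 hx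
    induction hw using Subgroup.closure_induction with
    | mem w hw =>
      obtain ⟨i, hi, rfl⟩ := hw
      exact (key i hi).2 hσ
    | one => exact fun x => by rw [mul_one]
    | mul a b _ _ ha hb => exact fun x => by rw [← mul_assoc, hb, ha]
    | inv a _ ha => exact fun x => by rw [← ha, inv_mul_cancel_right]

theorem facetUnion_of_isCell {F : Set (Pos (ZSBar cs))} {X : Pos (ZSBar cs)} (hX : X ∈ F)
    {σ : Side} {C : Set W} (hC : IsCell cs (parOf cs X) σ C) :
    FacetUnion cs (arr cs s t) F σ C := by
  refine ⟨?_, ?_, hD.transStable hX hC⟩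
  · obtain ⟨w, rfl⟩ := hC
    rcases hD.klSystem X with K | K
    · exact ⟨w, K.cellEquiv_refl _ _⟩
    · exact ⟨w, K.cellEquiv_refl _ _⟩
  · intro Ch hCh hF Y hY
    have h := (hD.union_and_filtration hCh (hF hX) hY hC).1
    refine ⟨{D | IsCell cs (parOf cs Y) σ D ∧ D ⊆ C}, fun D hD => hD.1, ?_⟩
    refine Set.Subset.antisymm (fun x hx => ?_) (Set.sUnion_subset fun D hD => hD.2)
    rw [h] at hx
    obtain ⟨i, hi⟩ := Set.mem_iUnion.1 hx
    exact ⟨i.1, i.2, hi⟩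

end InfDihedral

end Arrangement

/-! ### Minimality of the cells and of the arrangement. -/

section Minimality

variable {B : Type u} {W : Type v} [Group W] {M : CoxeterMatrix B} {cs : CoxeterSystem M W}
variable {s t : B} {ε : W →* ℤˣ}

open InfDihedral UneqPar

namespace NormPar

variable {X : Pos (ZSBar cs)} (N : NormPar (parOf cs X) ε s t)
include N

/-- The values `2` and `1` break all ties in the direction `0 < b < a`, while strict inequalities of
`X` are kept. -/
theorem refine {f : ZSBar cs →+ ℤ} (hs : f (ncls cs ε s) = 2) (ht : f (ncls cs ε t) = 1) :
    NormPar (parOf cs (X.refine f)) ε s t ∧ 0 < npar (parOf cs (X.refine f)) ε t ∧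
      npar (parOf cs (X.refine f)) ε t < npar (parOf cs (X.refine f)) ε s := by
  have h1 := N.nonneg
  have h2 := N.le
  rw [npar_parOf, Pos.zero_le_can] at h1
  rw [npar_parOf, npar_parOf, Pos.can_le_can] at h2
  have h3 : 0 < npar (parOf cs (X.refine f)) ε t := by
    rw [npar_parOf, Pos.zero_lt_can]
    exact Pos.neg_notMem_refine h1 (by omega)
  have h4 : npar (parOf cs (X.refine f)) ε t < npar (parOf cs (X.refine f)) ε s := by
    rw [npar_parOf, npar_parOf, Pos.can_lt_can, ← neg_sub]
    refine Pos.neg_notMem_refine h2 ?_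
    rw [map_sub]
    omega
  exact ⟨⟨N.dih, h3.le, h4.le⟩, h3, h4⟩

/-- The facet lies in the closure of a chamber with `0 < b < a`, whose cells are the fibres of the
rank, and `D` is a union of such cells. -/
theorem mem_iff_of_rankOf_eq {F : Set (Pos (ZSBar cs))} (hF : Pos.IsFacet (arr cs s t) F)
    (hX : X ∈ F) {σ : Side} {D : Set W} (hD : FacetUnion cs (arr cs s t) F σ D) {x y : W}
    (hxy : rankOf cs s t σ x = rankOf cs s t σ y) : x ∈ D ↔ y ∈ D := by
  obtain ⟨f, hs, ht⟩ := N.dih.exists_form_ncls ε 2 1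
  obtain ⟨N', hb, hab⟩ := N.refine hs ht
  -- On the vectors of the arrangement the form takes the values `±2`, `±1` and `±2 ± 1`, none of
  -- them zero, so the refined point is on no hyperplane.
  have hf : ∀ H ∈ arr cs s t, ∃ a : ZSBar cs, a ≠ 0 ∧ H = Pos.hyp a ∧ f a ≠ 0 := by
    intro H hH
    obtain ⟨m, n, hmn, hm, hn, rfl⟩ := N.dih.arr_cases hH
    refine ⟨_, N.dih.cls_ne_zero hmn, rfl, ?_⟩
    rw [ncls, map_zsmul, smul_eq_mul] at hs ht
    rw [map_add, map_zsmul, map_zsmul, smul_eq_mul, smul_eq_mul]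
    have hs' : f (cls cs s) = 2 ∨ f (cls cs s) = -2 := by
      rcases units_cases (ε (cs.simple s)) with h | h <;> rw [h] at hs <;> omega
    have ht' : f (cls cs t) = 1 ∨ f (cls cs t) = -1 := by
      rcases units_cases (ε (cs.simple t)) with h | h <;> rw [h] at ht <;> omega
    rcases hs' with h | h <;> rcases ht' with h' | h' <;> rw [h, h'] <;> omega
  let Ch : Set (Pos (ZSBar cs)) := {Z | ∀ H ∈ arr cs s t, Pos.SameSide H (X.refine f) Z}
  have hYCh : X.refine f ∈ Ch := fun H _ => Pos.sameSide_refl H _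
  have hCh : Pos.IsChamber (arr cs s t) Ch := by
    refine ⟨⟨_, rfl⟩, fun H hH => Set.disjoint_left.2 fun Z hZ hZH => ?_⟩
    obtain ⟨a, ha, rfl, hfa⟩ := hf H hH
    have h1 := Pos.SameSide.mem_iff ha (hZ _ hH)
    have h2 := Pos.SameSide.mem_iff (a := -a) (neg_ne_zero.2 ha)
      (by rw [Pos.hyp_neg]; exact hZ _ hH)
    exact Pos.refine_notMem_hyp hfa ⟨h1.2 hZH.1, h2.2 hZH.2⟩
  have hcl : F ⊆ closure Ch := by
    intro Z hZ
    -- Points of one facet have refinements in one chamber, since the refinement at a vector depends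
    -- only on the side and on the form; and a point is in the closure of its refinement.
    refine Pos.mem_closure_of_subset (Y := Z.refine f) (fun H hH => ?_) (fun a ha => ha.1)
    obtain ⟨a, ha, rfl, -⟩ := hf H hH
    have h1 := hF.mem_iff hX hZ ha hH
    have h2 := hF.mem_iff hX hZ (neg_ne_zero.2 ha) (by rwa [Pos.hyp_neg])
    exact N.dih.sameSide_of_mem_iff ha (Pos.refine_mem_iff h1 h2)
      (Pos.refine_mem_iff h2 (by rwa [neg_neg]))
  obtain ⟨𝒮, h𝒮, hDS⟩ := hD.2.1 Ch hCh hcl _ hYCh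
  have key : ∀ x y, rankOf cs s t σ x = rankOf cs s t σ y → x ∈ D → y ∈ D := by
    intro x y hxy hx
    rw [hDS] at hx ⊢
    obtain ⟨E, hE, hxE⟩ := hx
    refine ⟨E, hE, ?_⟩
    obtain ⟨k, -, rfl⟩ := (N'.isCell_iff_fiber hb hab).1 (h𝒮 E hE)
    exact hxy.symm.trans hxE
  exact ⟨key x y hxy, key y x hxy.symm⟩

omit N in
theorem subset_hyp {F : Set (Pos (ZSBar cs))} (hF : Pos.IsFacet (arr cs s t) F) (hX : X ∈ F)
    (hD : InfDihedral cs s t) {i : B} (hi : npar (parOf cs X) ε i = 0) :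
    F ⊆ Pos.hyp (cls cs i) := by
  have hmem := hD.isCompleteArrangement.complete i
  have hne : cls cs i ≠ 0 := by
    have := hD.ncls_ne_zero (ε := ε) i
    rw [ncls] at this
    exact fun h => this (by rw [h, smul_zero])
  have h0 : X.can (cls cs i) = 0 := npar_eq_zero_iff.1 hi
  have h1 : cls cs i ∈ X := Pos.zero_le_can.1 h0.ge
  have h2 : -cls cs i ∈ X := Pos.zero_le_can.1 (by rw [map_neg, h0, neg_zero])
  exact fun Z hZ => ⟨(hF.mem_iff hX hZ hne hmem).1 h1,
    (hF.mem_iff hX hZ (neg_ne_zero.2 hne) (by rwa [Pos.hyp_neg])).1 h2⟩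

omit N in
theorem simple_mul_mem {F : Set (Pos (ZSBar cs))} {σ : Side} {D : Set W} {i : B}
    (hi : F ⊆ Pos.hyp (cls cs i)) (hD : TransStable σ (parabolic cs F) D) (hσ : σ.left) (x : W) :
    cs.simple i * x ∈ D ↔ x ∈ D := by
  have h := hD.1 hσ _ (Subgroup.subset_closure ⟨i, hi, rfl⟩)
  refine ⟨fun hx => ?_, h x⟩
  have := h _ hx
  rwa [cs.simple_mul_simple_cancel_left] at this

omit N in
theorem mul_simple_mem {F : Set (Pos (ZSBar cs))} {σ : Side} {D : Set W} {i : B}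
    (hi : F ⊆ Pos.hyp (cls cs i)) (hD : TransStable σ (parabolic cs F) D) (hσ : σ.right) (x : W) :
    x * cs.simple i ∈ D ↔ x ∈ D := by
  have h := hD.2 hσ _ (Subgroup.subset_closure ⟨i, hi, rfl⟩)
  refine ⟨fun hx => ?_, h x⟩
  have := h _ hx
  rwa [cs.simple_mul_simple_cancel_right] at this

theorem mem_of_cellEquiv {F : Set (Pos (ZSBar cs))} (hF : Pos.IsFacet (arr cs s t) F)
    (hX : X ∈ F) {σ : Side} {D : Set W} (hD : FacetUnion cs (arr cs s t) F σ D) {x y : W}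
    (hxy : CellEquiv cs (parOf cs X) σ x y) (hx : x ∈ D) : y ∈ D := by
  have hsub : ∀ i, npar (parOf cs X) ε i = 0 → F ⊆ Pos.hyp (cls cs i) := fun i hi =>
    subset_hyp hF hX N.dih hi
  have hσ : σ.left ∨ σ.right := by
    cases σ
    · exact Or.inl trivial
    · exact Or.inr trivial
    · exact Or.inl trivial
  rcases (N.nonneg.trans N.le).lt_or_eq with ha | ha
  · -- ranks `top - 2` and `top - 1` are linked when `b = 0`
    have hsat := fun x y => N.mem_iff_of_rankOf_eq hF hX hD (x := x) (y := y)
    have hrt : rankOf cs s t σ (cs.simple t) = topRank σ - 2 := by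
      cases σ
      · exact N.dih.rank_t
      · exact (congrArg (rank cs s t) (cs.inv_simple t)).trans N.dih.rank_t
      · exact congrArg (· - 1) N.dih.rank_t
    have hr1 : rankOf cs s t σ 1 = topRank σ - 1 := by
      cases σ
      · exact N.dih.rank_one
      · exact (congrArg (rank cs s t) inv_one).trans N.dih.rank_one
      · exact congrArg (· - 1) N.dih.rank_one
    have link₁ : npar (parOf cs X) ε t = 0 → (cs.simple t ∈ D ↔ (1 : W) ∈ D) := by
      intro hb
      rcases hσ with h | h
      · have := simple_mul_mem (hsub t hb) hD.2.2 h 1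
        rwa [mul_one] at this
      · have := mul_simple_mem (hsub t hb) hD.2.2 h 1
        rwa [one_mul] at this
    -- ranks `top - 3` and `top - 2` are linked when `a = b`
    have link₂ : npar (parOf cs X) ε t = npar (parOf cs X) ε s →
        ∃ w, rankOf cs s t σ w = topRank σ - 3 ∧ (w ∈ D ↔ cs.simple t ∈ D) := by
      intro hab
      -- On `a = b` the letters can be exchanged: the facet also lies in the closure of the chamber
      -- `0 < a < b`, where all words ending in `t` have the same rank.
      have N₂ : NormPar (parOf cs X) ε t s :=
        ⟨N.dih.symm, by rw [← hab]; exact N.nonneg, hab.ge⟩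
      have hF₂ := hF
      have hD₂ := hD
      rw [arr_comm] at hF₂ hD₂
      have hsat₂ := fun x y => N₂.mem_iff_of_rankOf_eq hF₂ hX hD₂ (x := x) (y := y)
      have hend : ∀ w, cs.IsRightDescent w t → rank cs t s w = 0 := fun w hw => by
        have := N₂.dih.rank_lt_one.2 hw
        omega
      have h1 : rank cs t s (cs.simple t) = 0 := hend _ isRightDescent_simple_self
      have h2 : rank cs t s (dc (cs.simple s) (cs.simple t) 0 false true) = 0 :=
        hend _ ((N.dih.isRightDescent_dc_right _ _ _).2 rfl)
      have h3 := N.dih.rank_dc 0 false true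
      cases σ
      · refine ⟨dc (cs.simple s) (cs.simple t) 0 false true, h3, hsat₂ _ _ ?_⟩
        exact h2.trans h1.symm
      · refine ⟨(dc (cs.simple s) (cs.simple t) 0 false true)⁻¹, ?_, hsat₂ _ _ ?_⟩
        · rw [rankOf, inv_inv]
          exact h3
        · rw [rankOf, rankOf, inv_inv, cs.inv_simple, h1, h2]
      · refine ⟨dc (cs.simple s) (cs.simple t) 0 false true, ?_, hsat₂ _ _ ?_⟩
        · rw [rankOf, h3]
          rfl
        · rw [rankOf, rankOf, h1, h2]
    have hcut := N.cellEquiv_iff.1 hxy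
    have hx4 := N.dih.rankOf_lt σ x
    have hy4 := N.dih.rankOf_lt σ y
    have htop : 3 ≤ topRank σ := by cases σ <;> simp [topRank]
    have hc1 : 0 < npar (parOf cs X) ε t →
        (rankOf cs s t σ x < topRank σ - 1 ↔ rankOf cs s t σ y < topRank σ - 1) := fun h =>
      hcut _ (by cases σ <;> exact h)
    have hc2 : npar (parOf cs X) ε t < npar (parOf cs X) ε s →
        (rankOf cs s t σ x < topRank σ - 2 ↔ rankOf cs s t σ y < topRank σ - 2) := fun h =>
      hcut _ (by cases σ <;> exact h)
    -- In the two-sided case `topRank σ - 3` is `0` and the cut is empty; on one side it is the cut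
    -- at `1`, valid because `a > 0`.
    have hc3 : rankOf cs s t σ x < topRank σ - 3 ↔ rankOf cs s t σ y < topRank σ - 3 :=
      hcut _ (by
        cases σ
        · exact ha
        · exact ha
        · trivial)
    have h4 : topRank σ - 3 ≤ 1 := by cases σ <;> simp [topRank]
    by_cases heq : rankOf cs s t σ x = rankOf cs s t σ y
    · exact (hsat x y heq).1 hx
    -- The ranks now differ, so the valid cuts leave only pairs of ranks joined by one of the two
    -- links.
    rcases N.nonneg.lt_or_eq with hb | hb
    · have hc1 := hc1 hb
      rcases N.le.lt_or_eq with hab | hab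
      · have hc2 := hc2 hab
        omega
      · obtain ⟨w, hw, hwt⟩ := link₂ hab
        by_cases h : rankOf cs s t σ x = topRank σ - 2
        · exact (hsat w y (by omega)).1 (hwt.2 ((hsat x _ (by omega)).1 hx))
        · exact (hsat _ y (by omega)).1 (hwt.1 ((hsat x w (by omega)).1 hx))
    · have hc2 := hc2 (by rwa [← hb])
      have hl := link₁ hb.symm
      by_cases h : rankOf cs s t σ x = topRank σ - 2
      · exact (hsat 1 y (by omega)).1 (hl.1 ((hsat x _ (by omega)).1 hx))
      · exact (hsat (cs.simple t) y (by omega)).1 (hl.2 ((hsat x 1 (by omega)).1 hx))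
  · have hb : npar (parOf cs X) ε t = 0 := le_antisymm (N.le.trans_eq ha.symm) N.nonneg
    have hall : ∀ i, F ⊆ Pos.hyp (cls cs i) := by
      intro i
      rcases N.dih.eq_or_eq i with rfl | rfl
      · exact hsub _ ha.symm
      · exact hsub _ hb
    have h1 : ∀ w, w ∈ D ↔ (1 : W) ∈ D := by
      intro w
      rcases hσ with hσ | hσ
      · induction w using cs.simple_induction_left with
        | one => exact Iff.rfl
        | mul_simple_left w i ih => rw [simple_mul_mem (hall i) hD.2.2 hσ, ih]
      · induction w using cs.simple_induction_right with
        | one => exact Iff.rfl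
        | mul_simple_right w i ih => rw [mul_simple_mem (hall i) hD.2.2 hσ, ih]
    exact (h1 y).2 ((h1 x).1 hx)

end NormPar

namespace InfDihedral

variable (hD : InfDihedral cs s t)
include hD

theorem mem_of_cellEquiv {F : Set (Pos (ZSBar cs))} (hF : Pos.IsFacet (arr cs s t) F)
    {X : Pos (ZSBar cs)} (hX : X ∈ F) {σ : Side} {D : Set W}
    (hD' : FacetUnion cs (arr cs s t) F σ D) {x y : W}
    (hxy : CellEquiv cs (parOf cs X) σ x y) (hx : x ∈ D) : y ∈ D := by
  obtain ⟨ε, N | N⟩ := hD.exists_normPar X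
  · exact N.mem_of_cellEquiv hF hX hD' hxy hx
  · rw [arr_comm] at hF hD'
    exact N.mem_of_cellEquiv hF hX hD' hxy hx

theorem satisfiesA : SatisfiesA cs (arr cs s t) where
  toIsCompleteArrangement := hD.isCompleteArrangement
  const σ F hF X hX Y hY x y := hD.cellEquiv_iff_of_facet hF hX hY σ x y
  cells := by
    intro σ F hF X hX C
    constructor
    · intro hC
      refine ⟨hD.facetUnion_of_isCell hX hC, fun D hD' hDC => ?_⟩
      obtain ⟨x, hx⟩ := hD'.1
      obtain ⟨w, rfl⟩ := hC
      exact fun y hy => hD.mem_of_cellEquiv hF hX hD' (CellEquiv.trans (hDC hx) (CellEquiv.symm hy)) hx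
    · rintro ⟨hC, hmin⟩
      obtain ⟨x, hx⟩ := hC.1
      have hcell : IsCell cs (parOf cs X) σ {y | CellEquiv cs (parOf cs X) σ y x} := ⟨x, rfl⟩
      have hsub : {y | CellEquiv cs (parOf cs X) σ y x} ⊆ C := fun y hy =>
        hD.mem_of_cellEquiv hF hX hC (CellEquiv.symm hy) hx
      rwa [Set.Subset.antisymm (hmin (hD.facetUnion_of_isCell hX hcell) hsub) hsub]

theorem hyp_sub_mem {𝔄 : Set (Set (Pos (ZSBar cs)))} (h𝔄 : SatisfiesA cs 𝔄) (ε : W →* ℤˣ) :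
    Pos.hyp (ncls cs ε s - ncls cs ε t) ∈ 𝔄 := by
  by_contra hnot
  -- The half-space of `f` lies on the wall `a = b > 0` and on no other rational hyperplane; the
  -- refinement by `g` moves it off the wall, to the side `b < a`.
  obtain ⟨f, hfs, hft⟩ := hD.exists_form_ncls ε 1 1
  obtain ⟨g, hgs, hgt⟩ := hD.exists_form_ncls ε 2 1
  have h1 : npar (parOf cs (Pos.half f)) ε t = npar (parOf cs (Pos.half f)) ε s := by
    rw [npar_parOf, npar_parOf]
    refine le_antisymm (Pos.can_le_can.2 (Pos.mem_half.2 ?_)) (Pos.can_le_can.2 (Pos.mem_half.2 ?_))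
    · rw [map_sub, hfs, hft, sub_self]
    · rw [map_sub, hfs, hft, sub_self]
  have N : NormPar (parOf cs (Pos.half f)) ε s t := by
    refine ⟨hD, ?_, h1.le⟩
    rw [npar_parOf, Pos.zero_le_can, Pos.mem_half, hft]
    exact zero_le_one
  obtain ⟨N', hb, hab⟩ := N.refine hgs hgt
  have hside : ∀ H ∈ 𝔄, Pos.SameSide H (Pos.half f) ((Pos.half f).refine g) := by
    rintro H hH a ha rfl
    have hfa : f a ≠ 0 := by
      intro h0
      refine hnot ?_
      -- A vector killed by `f` is proportional to the normal vector of the wall, so its hyperplane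
      -- would be the missing one. The four cases are the four choices of signs.
      obtain ⟨p, q, hp, hq, hpq⟩ := hD.exists_proportional ha (hD.ncls_sub_ne_zero (ε := ε)) (by
        intro g' hg'
        obtain ⟨m, n, rfl⟩ := hD.exists_coords a
        rw [ncls, ncls, map_sub, map_zsmul, map_zsmul, smul_eq_mul, smul_eq_mul] at hg'
        rw [ncls, map_zsmul, smul_eq_mul] at hfs hft
        rw [map_add, map_zsmul, map_zsmul, smul_eq_mul, smul_eq_mul] at h0 ⊢
        rcases units_cases (ε (cs.simple s)) with h | h <;>
          rcases units_cases (ε (cs.simple t)) with h' | h' <;> rw [h] at hfs hg' <;>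
          rw [h'] at hft hg' <;>
          first
          | (rw [show f (cls cs s) = 1 by omega, show f (cls cs t) = 1 by omega] at h0
             rw [show g' (cls cs s) = g' (cls cs t) by omega, ← add_mul,
               show m + n = 0 by omega, zero_mul])
          | (rw [show f (cls cs s) = 1 by omega, show f (cls cs t) = -1 by omega] at h0
             rw [show g' (cls cs s) = - g' (cls cs t) by omega, show n = m by omega]
             ring)
          | (rw [show f (cls cs s) = -1 by omega, show f (cls cs t) = 1 by omega] at h0
             rw [show g' (cls cs s) = - g' (cls cs t) by omega, show n = m by omega]
             ring)
          | (rw [show f (cls cs s) = -1 by omega, show f (cls cs t) = -1 by omega] at h0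
             rw [show g' (cls cs s) = g' (cls cs t) by omega, ← add_mul,
               show m + n = 0 by omega, zero_mul]))
      rwa [← hD.hyp_eq_of_proportional hp hq hpq]
    have key : ∀ b, f b ≠ 0 → (b ∈ Pos.half f ↔ b ∈ (Pos.half f).refine g) := by
      intro b hb
      rw [Pos.mem_refine, Pos.mem_half, Pos.mem_half, map_neg]
      constructor
      · exact fun h => ⟨h, fun h' => by omega⟩
      · exact fun h => h.1
    exact Pos.sameSide_aux (key a hfa) (key (-a) (by rw [map_neg]; omega))
  -- The two points would lie in one facet, yet `t` and `st`, of ranks `2` and `1`, form one left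
  -- cell class on the wall and are separated by the cut at `2` off it.
  have hiff := h𝔄.const .L {Z | ∀ H ∈ 𝔄, Pos.SameSide H (Pos.half f) Z} ⟨_, rfl⟩ _
    (fun H _ => Pos.sameSide_refl H _) _ hside (cs.simple t)
    (dc (cs.simple s) (cs.simple t) 0 false true)
  have hr := hD.rank_dc 0 false true
  rw [Bool.toNat_true] at hr
  have h3 : CellEquiv cs (parOf cs (Pos.half f)) .L (cs.simple t)
      (dc (cs.simple s) (cs.simple t) 0 false true) := by
    refine N.cellEquiv_left_iff.2 fun k hk => ?_
    rw [hD.rank_t, hr]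
    match k with
    | 0 => omega
    | 1 => omega
    | 2 => exact absurd h1 (ne_of_lt hk)
    | k + 3 => omega
  have h4 := N'.cellEquiv_left_iff.1 (hiff.1 h3) 2 hab
  rw [hD.rank_t, hr] at h4
  omega

theorem isEssentialArrangement : IsEssentialArrangement cs (arr cs s t) := by
  refine ⟨hD.satisfiesA, fun 𝔄 h𝔄 => ?_⟩
  have hchar : ∀ u v : ℤˣ, ∃ ε : W →* ℤˣ, ε (cs.simple s) = u ∧ ε (cs.simple t) = v := by
    classical
    intro u v
    obtain ⟨ε, hε⟩ := hD.exists_character (fun i => if i = s then u else v)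
    refine ⟨ε, ?_, ?_⟩
    · rw [hε, if_pos rfl]
    · rw [hε, if_neg hD.ne.symm]
  rintro H (rfl | rfl | rfl | rfl)
  · exact h𝔄.complete s
  · exact h𝔄.complete t
  -- Equal signs give the wall `H_{s-t}`; opposite signs, in the next case, give `H_{s+t}`.
  · obtain ⟨ε, hs, ht⟩ := hchar 1 1
    have := hD.hyp_sub_mem h𝔄 ε
    rwa [ncls, ncls, hs, ht, Units.val_one, one_smul, one_smul] at this
  · obtain ⟨ε, hs, ht⟩ := hchar 1 (-1)
    have := hD.hyp_sub_mem h𝔄 ε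
    rwa [ncls, ncls, hs, ht, Units.val_neg, Units.val_one, one_smul, neg_smul, one_smul,
      sub_neg_eq_add] at this

theorem conjectureB : ConjectureB cs := by
  intro 𝔄 h𝔄 σ X C hC Ch hCh hX Y hY
  -- A least arrangement is unique, so the given one is the arrangement of four hyperplanes.
  obtain rfl := h𝔄.unique hD.isEssentialArrangement
  exact hD.union_and_filtration hCh hX hY hC

end InfDihedral

end Minimality

end KLCells

end

/-- Let `(W, S)` be a Coxeter system with `S = {s, t}` and `st` of infinite order. Then Conjectures
A and B hold for `(W, S)`, and the essential hyperplanes are `H_s`, `H_t`, `H_{s-t}`, `H_{s+t}`. -/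
theorem mainTheorem2 {B : Type*} {W : Type*} [Group W] {M : CoxeterMatrix B}
    (cs : CoxeterSystem M W) (s t : B) (hS : ∀ i : B, i = s ∨ i = t)
    (hst : ¬ IsOfFinOrder (cs.simple s * cs.simple t)) :
    KLCells.ConjectureA cs ∧ KLCells.ConjectureB cs ∧
      KLCells.IsEssentialArrangement cs
        {KLCells.Pos.hyp (KLCells.cls cs s), KLCells.Pos.hyp (KLCells.cls cs t),
          KLCells.Pos.hyp (KLCells.cls cs s - KLCells.cls cs t),
          KLCells.Pos.hyp (KLCells.cls cs s + KLCells.cls cs t)} := by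
  have hD : KLCells.InfDihedral cs s t := ⟨hS, hst⟩
  exact ⟨⟨_, hD.satisfiesA⟩, hD.conjectureB, hD.isEssentialArrangement⟩
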